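/- All graphs are finite, simple and undirected, a graph on $n$ vertices has vertex set $\{1,\dots,n\}$, $\log$ is to base $2$, and $\mathcal F_d$ is the family of graphs of maximum degree at most $d$. An adjacency sketch with $c$-bit labels and error $\delta$ for a family $\mathcal F$ consists of a randomized encoder, which on input $G\in\mathcal F$ outputs a random labeling $\ell\colon V(G)\to\{0,1\}^{c}$, and a deterministic decoder $D\colon\{0,1\}^c\times\{0,1\}^c\to\{0,1\}$, the same for all $G \in \mathcal F$, such that for all $G\in\mathcal F$ and all $u,v\in V(G)$, $\Pr[D(\ell(u),\ell(v))=\mathbf 1_{uv\in E(G)}]\ge 1-\delta$. It has one-sided error (errs only on non-edges) if $D(\ell(u),\ell(v))=1$ with probability $1$ for every edge $uv$ of $G$. It resists adaptive adversaries with probability of forgery at most $\varepsilon$ if every computationally unbounded (possibly randomized) adversary wins the following game with probability at most $\varepsilon$: the adversary chooses $G\in\mathcal F$; the encoder draws a labeling $\ell$ of $G$; the adversary adaptively queries the labels of vertices of its choice, each query depending on the labels seen so far; finally it names two distinct vertices $x,y$ that it has not queried. It wins if $D(\ell(x),\ell(y))\ne \mathbf 1_{xy\in E(G)}$. **Theorem.**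 There is a function $\eta\colon(0,1)\to\mathbb R$ with $\eta(\varepsilon)\to0$ as $\varepsilon\to0^+$ such that for every $\varepsilon\in(0,1)$ and every integer $d\ge 0$ the family $\mathcal F_d$ has an adjacency sketch with error $\varepsilon$, with one-sided error, which resists adaptive adversaries with probability of forgery at most $\varepsilon$ and whose labels have at most $2d\log(1/\varepsilon)\,(1+\eta(\varepsilon))$ bits (in particular $O(d)$ bits for fixed $\varepsilon$, independently of the number of vertices). Moreover, for each fixed $\varepsilon$ the encoders can be computed efficiently: there is a single randomized algorithm (a random access machine with unit-cost addition and truncated subtraction, using fair random bits) which, given $d$ and a graph $G\in\mathcal F_d$ with $n$ vertices, always halts within a number of steps polynomial in $n+d$ and outputs a labeling of $G$ with the distribution prescribed by the sketch for $\mathcal F_d$. -/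

import Mathlib

open Filter Topology

/-! ## Adjacency sketches

Graphs are finite simple graphs; a graph with `n` vertices has vertex set `Fin n`. -/

/-- The graphs of maximum degree at most `d`: `maxDegreeFamily d n` is the set of those with
`n` vertices. -/
def maxDegreeFamily (d n : ℕ) : Set (SimpleGraph (Fin n)) :=
  {G | ∀ v, (G.neighborSet v).ncard ≤ d}

/-- The data of an adjacency sketch with `c`-bit labels: a randomized encoder, which for every
graph gives a probability distribution on the labelings of its vertices by `c`-bit strings, and a
deterministic decoder, which sees two labels only and is the same for all graphs. -/
structure AdjacencySketch (c : ℕ) where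
  encoder : (n : ℕ) → SimpleGraph (Fin n) → PMF (Fin n → (Fin c → Bool))
  decoder : (Fin c → Bool) → (Fin c → Bool) → Bool

namespace AdjacencySketch

variable {c : ℕ}

/-- For every graph of the family and every pair of vertices, the probability (over the labels)
that the decoder is correct is at least `1 - δ`. -/
def HasError (S : AdjacencySketch c) (F : (n : ℕ) → Set (SimpleGraph (Fin n))) (δ : ℝ) : Prop :=
  ∀ n, ∀ G ∈ F n, ∀ u v : Fin n,
    ENNReal.ofReal (1 - δ) ≤
      (S.encoder n G).toOuterMeasure {l | S.decoder (l u) (l v) = true ↔ G.Adj u v}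

/-- The sketch errs on non-edges only: edges are always decoded as edges. -/
def OneSided (S : AdjacencySketch c) (F : (n : ℕ) → Set (SimpleGraph (Fin n))) : Prop :=
  ∀ n, ∀ G ∈ F n, ∀ l ∈ (S.encoder n G).support, ∀ u v : Fin n,
    G.Adj u v → S.decoder (l u) (l v) = true

end AdjacencySketch

/-- A deterministic strategy of an adaptive, computationally unbounded adversary, on vertex set `V`
and with labels in `L`: either declare a pair of candidates, or query the label of a vertex and go
on in a way that depends on the label received. -/
inductive Strategy (V L : Type) : Type
  | declare (x y : V) : Strategy V L
  | query (x : V) (next : L → Strategy V L) : Strategy V L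

/-- `A.Wins G D l Q`: playing `A` from the position in which the vertices in `Q` have been queried,
against the labels `l` and the decoder `D`, the adversary ends with two distinct candidates that
have not been queried and whose labels are decoded wrongly. -/
def Strategy.Wins {V L : Type} (G : SimpleGraph V) (D : L → L → Bool) (l : V → L) :
    Strategy V L → Set V → Prop
  | .declare x y, Q => x ∉ Q ∧ y ∉ Q ∧ x ≠ y ∧ ¬(D (l x) (l y) = true ↔ G.Adj x y)
  | .query x next, Q => Strategy.Wins G D l (next (l x)) (insert x Q)

/-- Adversarial resilience with probability of forgery at most `ε`: for every graph of the family
and every randomized adversary (a distribution `A` on strategies, drawn independently of the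
labels), the adversary wins the game with probability at most `ε`. -/
def AdjacencySketch.Resilient {c : ℕ} (S : AdjacencySketch c)
    (F : (n : ℕ) → Set (SimpleGraph (Fin n))) (ε : ℝ) : Prop :=
  ∀ n, ∀ G ∈ F n, ∀ A : PMF (Strategy (Fin n) (Fin c → Bool)),
    (A.bind fun a => (S.encoder n G).map fun l => (a, l)).toOuterMeasure
      {w | w.1.Wins G S.decoder w.2 ∅} ≤ ENNReal.ofReal ε

/-! ## Random access machines with a step count

Structured programs for a unit-cost random access machine.  The memory consists of
two-dimensional arrays of natural numbers; a program can name only finitely many arrays, while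
the indices inside an array are computed at run time.  The arithmetic operations are addition and
truncated subtraction only (no multiplication), so that the bit length of the numbers grows by at
most one per step, and polynomial time has its usual meaning. -/

namespace Ram

/-- The memory: `σ a i j` is the entry in row `i` and column `j` of the array `a`. -/
abbrev Store : Type := ℕ → ℕ → ℕ → ℕ

inductive Term : Type
  | lit (k : ℕ) : Term
  | cell (a : ℕ) (i j : Term) : Term
  | add (e f : Term) : Term
  | sub (e f : Term) : Term

def Term.eval (σ : Store) : Term → ℕ
  | .lit k => k
  | .cell a i j => σ a (i.eval σ) (j.eval σ)
  | .add e f => e.eval σ + f.eval σ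
  | .sub e f => e.eval σ - f.eval σ

/-- The number of operations needed to evaluate a term. -/
def Term.cost : Term → ℕ
  | .lit _ => 1
  | .cell _ i j => i.cost + j.cost + 1
  | .add e f => e.cost + f.cost + 1
  | .sub e f => e.cost + f.cost + 1

inductive Program : Type
  | skip : Program
  | assign (a : ℕ) (i j e : Term) : Program
  | seq (P Q : Program) : Program
  | ite (e : Term) (P Q : Program) : Program
  | loop (e : Term) (P : Program) : Program

/-- The memory after writing `x` into the entry `(i, j)` of the array `a`. -/
def Store.write (σ : Store) (a i j x : ℕ) : Store :=
  fun a' i' j' => if a' = a ∧ i' = i ∧ j' = j then x else σ a' i' j'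

/-- `Exec P σ σ' t`: started with memory `σ`, the program `P` halts after `t` steps with
memory `σ'`.  `ite e P Q` runs `P` if `e` is nonzero and `Q` otherwise; `loop e P` repeats `P` as
long as `e` is nonzero. -/
inductive Exec : Program → Store → Store → ℕ → Prop
  | skip (σ : Store) : Exec .skip σ σ 1
  | assign (σ : Store) (a : ℕ) (i j e : Term) :
      Exec (.assign a i j e) σ (σ.write a (i.eval σ) (j.eval σ) (e.eval σ))
        (i.cost + j.cost + e.cost + 1)
  | seq {P Q : Program} {σ σ₁ σ₂ : Store} {s t : ℕ} :
      Exec P σ σ₁ s → Exec Q σ₁ σ₂ t → Exec (.seq P Q) σ σ₂ (s + t)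
  | ite_true {e : Term} {P Q : Program} {σ σ₁ : Store} {t : ℕ} :
      e.eval σ ≠ 0 → Exec P σ σ₁ t → Exec (.ite e P Q) σ σ₁ (e.cost + t + 1)
  | ite_false {e : Term} {P Q : Program} {σ σ₁ : Store} {t : ℕ} :
      e.eval σ = 0 → Exec Q σ σ₁ t → Exec (.ite e P Q) σ σ₁ (e.cost + t + 1)
  | loop_done {e : Term} {P : Program} {σ : Store} :
      e.eval σ = 0 → Exec (.loop e P) σ σ (e.cost + 1)
  | loop_step {e : Term} {P : Program} {σ σ₁ σ₂ : Store} {s t : ℕ} :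
      e.eval σ ≠ 0 → Exec P σ σ₁ s → Exec (.loop e P) σ₁ σ₂ t →
        Exec (.loop e P) σ σ₂ (e.cost + s + t + 1)

open Classical in
/-- The initial memory: array `0` holds `n` and `d`, array `1` the adjacency matrix of `G`,
row `0` of array `2` the random bits `r`, and everything else is `0`. -/
noncomputable def inputStore (d n : ℕ) (G : SimpleGraph (Fin n)) {m : ℕ} (r : Fin m → Bool) :
    Store
  | 0, 0, 0 => n
  | 0, 0, 1 => d
  | 1, i, j => if ∃ (hi : i < n) (hj : j < n), G.Adj ⟨i, hi⟩ ⟨j, hj⟩ then 1 else 0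
  | 2, 0, j => if ∃ hj : j < m, r ⟨j, hj⟩ = true then 1 else 0
  | _, _, _ => 0

/-- The labeling left in array `3`: row `i` holds the bits of the label of vertex `i`. -/
def outputLabels (n c : ℕ) (σ : Store) : Fin n → (Fin c → Bool) :=
  fun i j => decide (σ 3 i j ≠ 0)

end Ram

/-- The encoders of the sketches `S d` are computed by one randomized polynomial-time algorithm:
given `d`, a graph `G` with `n` vertices in the family `F d` and uniformly random bits,
polynomially many in `n + d`, the program halts within a number of steps polynomial in `n + d`
and its output is distributed as the labeling of `G` by `S d`. -/
def PolyTimeEncodable (F : (d n : ℕ) → Set (SimpleGraph (Fin n))) (c : ℕ → ℕ)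
    (S : (d : ℕ) → AdjacencySketch (c d)) : Prop :=
  ∃ (P : Ram.Program) (p q : Polynomial ℕ), ∀ d n, ∀ G ∈ F d n,
    ∃ lab : (Fin (q.eval (n + d)) → Bool) → Fin n → (Fin (c d) → Bool),
      (S d).encoder n G = (PMF.uniformOfFintype (Fin (q.eval (n + d)) → Bool)).map lab ∧
      ∀ r, ∃ (σ : Ram.Store) (t : ℕ),
        Ram.Exec P (Ram.inputStore d n G r) σ t ∧ t ≤ p.eval (n + d) ∧
          lab r = Ram.outputLabels n (c d) σ

/-! Let `F` be the field with `2 ^ k` elements. Every vertex owns `d` slots, and each of its edges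
occupies a slot of its own. A slot holds a pair `(a, b)` of field elements. They are random, except
that for an edge with pairs `(a, b)` and `(a', b')` at its ends the equation `b + b' = a * a'` is
enforced, by solving for the second component at the larger end. The decoder works out which slots
the two vertices would use for an edge and tests the equation, so edges are always accepted.

Consider two nonadjacent vertices and two slots of theirs, and fix all other labels. If a slot is
matched with a slot whose first component is `m`, then `(a, b)` is uniform on a line of slope `m`:
replacing it by `(a + c, b + c * m)` preserves the edge equation and all other values (`shear`,
`snd_shear_of_ne`). An unmatched slot can be moved in the same way with slope `0`. Moving both
slots, by `c` and `c'`, turns the tested equation into the equation of a hyperbola in `(c, c')`,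
with at most `2 * |F|` of the `|F| ^ 2` points. Hence the error is at most `2 / |F|` even given all
other labels (`card_mul_card_equation_le`). The transcript of an adaptive adversary only conditions
on labels of other vertices, so induction on the strategy gives the same bound for forgeries
(`Strategy.card_wins_le`). For a vertex paired with itself, characteristic two reduces the test to
`a * a = 0`.

The decoder must find the slots from two labels, at a cost of `O(d)` bits for each vertex. Vertices
with a common neighbour get different colours, at most `d * d + 1` in all. Every vertex stores a
multi-level perfect hash table for the colours of its neighbours: level `j` has `4 * (d / 2 ^ j)`
positions and a seed for which at most half of the `d / 2 ^ j` allowed keys collide (`exists_seed`).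
Keys alone at their position are marked there, the others pass to the next level. The slot of a
neighbour is the rank of its mark. Colour, seeds and tables fit into `24 * d` bits
(`extra_length_le`), so a label has `(2 * k + 24) * d` bits. With `k = ⌈log (1 / ε)⌉ + 1` the error
is at most `ε`.

Colouring, seed search and tables need no randomness and are computed by greedy choice and
exhaustive search over polynomially many candidates. A small program logic bounds the time by a
polynomial in a common bound `B` for the rounds of all loops. For fixed `k` the field arithmetic is
a finite case distinction built into the program. -/

open scoped Finset

/-! ## A program logic for the random access machine -/

namespace Ram

/-- A bound for the running time of a program all of whose loops run at most `B` rounds, as a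
polynomial in `B`. -/
noncomputable def Program.time : Program → Polynomial ℕ
  | .skip => 1
  | .assign _ i j e => Polynomial.C (i.cost + j.cost + e.cost + 1)
  | .seq P Q => P.time + Q.time
  | .ite e P Q => Polynomial.C (e.cost + 1) + P.time + Q.time
  | .loop e P => (Polynomial.X + 1) * (Polynomial.C (e.cost + 1) + P.time)

/-- Started in `σ`, the program halts within the time allowed for loops of at most `B` rounds, in
a memory satisfying `Q`. -/
def Runs (B : ℕ) (P : Program) (σ : Store) (Q : Store → Prop) : Prop :=
  ∃ σ' t, Exec P σ σ' t ∧ t ≤ P.time.eval B ∧ Q σ'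

variable {B : ℕ} {P P' : Program} {σ : Store} {Q R : Store → Prop}

theorem Runs.mono (h : Runs B P σ Q) (hQ : ∀ τ, Q τ → R τ) : Runs B P σ R := by
  obtain ⟨σ', t, h1, h2, h3⟩ := h
  exact ⟨σ', t, h1, h2, hQ _ h3⟩

theorem Runs.skip (h : Q σ) : Runs B .skip σ Q :=
  ⟨σ, 1, .skip σ, by simp [Program.time], h⟩

theorem Runs.assign {a : ℕ} {i j e : Term}
    (h : Q (σ.write a (i.eval σ) (j.eval σ) (e.eval σ))) : Runs B (.assign a i j e) σ Q :=
  ⟨_, _, .assign σ a i j e, by simp [Program.time], h⟩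

theorem Runs.seq (h : Runs B P σ fun τ => Runs B P' τ Q) : Runs B (.seq P P') σ Q := by
  obtain ⟨σ₁, s, h1, h2, σ₂, t, h3, h4, h5⟩ := h
  exact ⟨σ₂, s + t, .seq h1 h3, by simp only [Program.time, Polynomial.eval_add]; omega, h5⟩

theorem Runs.ite {e : Term} (ht : e.eval σ ≠ 0 → Runs B P σ Q)
    (hf : e.eval σ = 0 → Runs B P' σ Q) : Runs B (.ite e P P') σ Q := by
  by_cases h : e.eval σ = 0
  · obtain ⟨σ₁, s, h1, h2, h3⟩ := hf h
    refine ⟨σ₁, _, .ite_false h h1, ?_, h3⟩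
    simp only [Program.time, Polynomial.eval_add, Polynomial.eval_C]; omega
  · obtain ⟨σ₁, s, h1, h2, h3⟩ := ht h
    refine ⟨σ₁, _, .ite_true h h1, ?_, h3⟩
    simp only [Program.time, Polynomial.eval_add, Polynomial.eval_C]; omega

/-- Induction on the number `m` of rounds still allowed. By `hs` the body is only entered after
fewer than `N` rounds, so the test must fail once `m = 0`. -/
theorem exists_exec_loop {e : Term} {T : ℕ} (I : ℕ → Store → Prop) (N : ℕ)
    (hs : ∀ i τ, I i τ → e.eval τ ≠ 0 → i < N ∧ ∃ τ' t, Exec P τ τ' t ∧ t ≤ T ∧ I (i + 1) τ') :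
    ∀ m i σ, i + m = N → I i σ → ∃ τ t j, Exec (.loop e P) σ τ t ∧
      t ≤ (m + 1) * (e.cost + 1 + T) ∧ I j τ ∧ e.eval τ = 0 := by
  intro m
  induction m with
  | zero =>
    intro i σ hi hI
    by_cases h : e.eval σ = 0
    · exact ⟨σ, _, i, .loop_done h, by omega, hI, h⟩
    · have := (hs i σ hI h).1; omega
  | succ m ih =>
    intro i σ hi hI
    by_cases h : e.eval σ = 0
    · exact ⟨σ, _, i, .loop_done h, by nlinarith, hI, h⟩
    · obtain ⟨_, τ', t, h1, h2, h3⟩ := hs i σ hI h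
      obtain ⟨τ, t', j, h4, h5, h6, h7⟩ := ih (i + 1) τ' (by omega) h3
      exact ⟨τ, _, j, .loop_step h h1 h4, by nlinarith, h6, h7⟩

/-- The rule for loops: `I i` is an invariant that holds after `i` rounds. -/
theorem Runs.loop {e : Term} (I : ℕ → Store → Prop) (N : ℕ) (hN : N ≤ B) (h0 : I 0 σ)
    (hs : ∀ i τ, I i τ → e.eval τ ≠ 0 → i < N ∧ Runs B P τ (I (i + 1)))
    (hQ : ∀ i τ, I i τ → e.eval τ = 0 → Q τ) : Runs B (.loop e P) σ Q := by
  obtain ⟨τ, t, j, h1, h2, h3, h4⟩ :=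
    exists_exec_loop (T := P.time.eval B) I N hs N 0 σ (by omega) h0
  refine ⟨τ, t, h1, h2.trans ?_, hQ j τ h3 h4⟩
  simp only [Program.time, Polynomial.eval_mul, Polynomial.eval_add, Polynomial.eval_C,
    Polynomial.eval_X, Polynomial.eval_one]
  gcongr

/-! ### Frames -/

/-- Whether the program contains an assignment to the array `a`. -/
def Program.writes : Program → ℕ → Bool
  | .skip, _ => false
  | .assign b _ _ _, a => a == b
  | .seq P Q, a => P.writes a || Q.writes a
  | .ite _ P Q, a => P.writes a || Q.writes a
  | .loop _ P, a => P.writes a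

/-- With this, a specification only has to mention the arrays that a program changes; for a concrete
program the side condition is settled by evaluating `writes`. -/
theorem Exec.frame {P : Program} {σ τ : Store} {t : ℕ} (h : Exec P σ τ t) {a : ℕ}
    (ha : P.writes a = false) : τ a = σ a := by
  induction h with
  | skip => rfl
  | assign σ b i j e =>
    have : a ≠ b := by simpa [Program.writes] using ha
    funext i' j'
    simp [Store.write, this]
  | seq _ _ ih1 ih2 =>
    simp only [Program.writes, Bool.or_eq_false_iff] at ha
    rw [ih2 ha.2, ih1 ha.1]
  | ite_true _ _ ih =>
    simp only [Program.writes, Bool.or_eq_false_iff] at ha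
    exact ih ha.1
  | ite_false _ _ ih =>
    simp only [Program.writes, Bool.or_eq_false_iff] at ha
    exact ih ha.2
  | loop_done => rfl
  | loop_step _ _ _ ih1 ih2 => rw [ih2 ha, ih1 ha]

theorem Runs.frame (h : Runs B P σ Q) :
    Runs B P σ fun τ => Q τ ∧ ∀ a, P.writes a = false → τ a = σ a := by
  obtain ⟨σ', t, h1, h2, h3⟩ := h
  exact ⟨σ', t, h1, h2, h3, fun a ha => h1.frame ha⟩

/-- Whether the term reads the array `a`. -/
def Term.reads : Term → ℕ → Bool
  | .lit _, _ => false
  | .cell b i j, a => a == b || i.reads a || j.reads a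
  | .add e f, a => e.reads a || f.reads a
  | .sub e f, a => e.reads a || f.reads a

/-- Whether the array `a` occurs in the program. -/
def Program.uses : Program → ℕ → Bool
  | .skip, _ => false
  | .assign b i j e, a => a == b || i.reads a || j.reads a || e.reads a
  | .seq P Q, a => P.uses a || Q.uses a
  | .ite e P Q, a => e.reads a || P.uses a || Q.uses a
  | .loop e P, a => e.reads a || P.uses a

theorem Term.eval_update {e : Term} {a : ℕ} (h : e.reads a = false) (σ : Store) (z : ℕ → ℕ → ℕ) :
    e.eval (Function.update σ a z) = e.eval σ := by
  induction e with
  | lit => rfl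
  | cell b i j hi hj =>
    simp only [reads, Bool.or_eq_false_iff, beq_eq_false_iff_ne] at h
    simp only [eval, hi h.1.2, hj h.2, Function.update_of_ne h.1.1.symm]
  | add e f he hf | sub e f he hf =>
    simp only [reads, Bool.or_eq_false_iff] at h
    simp only [eval, he h.1, hf h.2]

/-- Needed for the array of random bits: the deterministic part of the encoder is analysed once,
without random bits, and its run is then transported to every sequence of random bits. Its results
therefore cannot depend on them. -/
theorem Exec.update {P : Program} {σ τ : Store} {t : ℕ} (h : Exec P σ τ t) {a : ℕ}
    (ha : P.uses a = false) (z : ℕ → ℕ → ℕ) :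
    Exec P (Function.update σ a z) (Function.update τ a z) t := by
  induction h with
  | skip => exact .skip _
  | assign σ b i j e =>
    simp only [Program.uses, Bool.or_eq_false_iff, beq_eq_false_iff_ne] at ha
    have key := Exec.assign (Function.update σ a z) b i j e
    rw [Term.eval_update ha.1.1.2, Term.eval_update ha.1.2, Term.eval_update ha.2] at key
    convert key using 1
    funext b' i' j'
    by_cases hb : b' = a
    · subst hb
      simp [Store.write, ha.1.1.1]
    · simp [Store.write, Function.update_of_ne hb]
  | seq _ _ ih1 ih2 =>
    simp only [Program.uses, Bool.or_eq_false_iff] at ha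
    exact .seq (ih1 ha.1) (ih2 ha.2)
  | ite_true h _ ih =>
    simp only [Program.uses, Bool.or_eq_false_iff] at ha
    exact .ite_true (by rwa [Term.eval_update ha.1.1]) (ih ha.1.2)
  | ite_false h _ ih =>
    simp only [Program.uses, Bool.or_eq_false_iff] at ha
    exact .ite_false (by rwa [Term.eval_update ha.1.1]) (ih ha.2)
  | loop_done h =>
    simp only [Program.uses, Bool.or_eq_false_iff] at ha
    exact .loop_done (by rwa [Term.eval_update ha.1])
  | loop_step h _ _ ih1 ih2 =>
    have ha' := ha
    simp only [Program.uses, Bool.or_eq_false_iff] at ha'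
    exact .loop_step (by rwa [Term.eval_update ha'.1]) (ih1 ha'.2) (ih2 ha)

/-! ### Variables and counting loops -/

theorem Store.write_apply (σ : Store) (a i j x a' i' : ℕ) :
    σ.write a i j x a' i' = if a' = a ∧ i' = i then Function.update (σ a i) j x else σ a' i' := by
  funext j'
  by_cases h : a' = a ∧ i' = i
  · obtain ⟨rfl, rfl⟩ := h
    simp [Store.write, Function.update_apply]
  · simp [Store.write, ← and_assoc, h]

theorem Store.write_of_ne (σ : Store) {a a' : ℕ} (i j x : ℕ) (h : a' ≠ a) :
    σ.write a i j x a' = σ a' := by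
  funext i' j'
  simp [Store.write, h]

/-- The variable `a`: the entry `(0, 0)` of the array `a`. -/
def Term.var (a : ℕ) : Term := .cell a (.lit 0) (.lit 0)

/-- The entry `i` of the one-dimensional array `a`, which is stored in row `0`. -/
def Term.arr (a : ℕ) (i : Term) : Term := .cell a (.lit 0) i

/-- Set the variable `a` to `e`. -/
def Program.set (a : ℕ) (e : Term) : Program := .assign a (.lit 0) (.lit 0) e

/-- Set the entry `i` of the one-dimensional array `a` to `e`. -/
def Program.setArr (a : ℕ) (i e : Term) : Program := .assign a (.lit 0) i e

/-- Repeat `P` for the values `0, 1, …` below `e` of the variable `v`. -/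
def Program.forLoop (v : ℕ) (e : Term) (P : Program) : Program :=
  .seq (.set v (.lit 0)) (.loop (.sub e (.var v)) (.seq P (.set v (.add (.var v) (.lit 1)))))

theorem Runs.set {a : ℕ} {e : Term} (h : Q (σ.write a 0 0 (e.eval σ))) :
    Runs B (.set a e) σ Q :=
  .assign h

theorem Runs.setArr {a : ℕ} {i e : Term} (h : Q (σ.write a 0 (i.eval σ) (e.eval σ))) :
    Runs B (.setArr a i e) σ Q :=
  .assign h

/-- The rule for counting loops.  The invariant may take for granted that arrays which the loop
does not change keep their initial values. -/
theorem Runs.forLoop {v : ℕ} {e : Term} (I : ℕ → Store → Prop) (N : ℕ) (hN : N ≤ B)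
    (hv : P.writes v = false)
    (h0 : I 0 (σ.write v 0 0 0))
    (he : ∀ i τ, (∀ a, (Program.forLoop v e P).writes a = false → τ a = σ a) → I i τ →
      e.eval τ = N)
    (hs : ∀ i < N, ∀ τ, (∀ a, (Program.forLoop v e P).writes a = false → τ a = σ a) →
      τ v 0 0 = i → I i τ → Runs B P τ fun τ' => I (i + 1) (τ'.write v 0 0 (i + 1)))
    (hQ : ∀ τ, (∀ a, (Program.forLoop v e P).writes a = false → τ a = σ a) →
      I N τ → Q τ) :
    Runs B (.forLoop v e P) σ Q := by
  have hw : ∀ a, (Program.forLoop v e P).writes a = false → a ≠ v ∧ P.writes a = false := by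
    intro a ha
    simp only [Program.forLoop, Program.set, Program.writes, Bool.or_eq_false_iff,
      beq_eq_false_iff_ne] at ha
    exact ⟨ha.1, ha.2.1⟩
  refine .seq (.set ?_)
  refine Runs.loop (fun i τ => (∀ a, (Program.forLoop v e P).writes a = false → τ a = σ a) ∧
    τ v 0 0 = i ∧ i ≤ N ∧ I i τ) N hN ?_ ?_ ?_
  · refine ⟨fun a ha => Store.write_of_ne _ _ _ _ (hw a ha).1, ?_, by omega, h0⟩
    simp [Store.write, Term.eval]
  · rintro i τ ⟨hf, hvi, hi, hI⟩ hne
    have hlt : i < N := by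
      simp only [Term.eval, Term.var, he i τ hf hI, hvi] at hne
      omega
    refine ⟨hlt, .seq ((hs i hlt τ hf hvi hI).frame.mono ?_)⟩
    rintro τ' ⟨h1, h2⟩
    have hv' : τ' v 0 0 = i := by rw [h2 v hv, hvi]
    refine .set ?_
    simp only [Term.eval, Term.var, hv']
    refine ⟨fun a ha => ?_, by simp [Store.write], by omega, h1⟩
    rw [Store.write_of_ne _ _ _ _ (hw a ha).1, h2 a (hw a ha).2, hf a ha]
  · rintro i τ ⟨hf, hvi, hi, hI⟩ h0
    simp only [Term.eval, Term.var, he i τ hf hI, hvi] at h0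
    obtain rfl : i = N := by omega
    exact hQ τ hf hI

end Ram

/-! ## Multi-level perfect hashing -/

/-- The hash value of `x` in a table of `4 * D` positions, for the seed `(m, a)`. -/
def hashVal (m a D x : ℕ) : ℕ := a * x % (m + 1) % (4 * D)

theorem hashVal_lt {m a D x : ℕ} (hD : 0 < D) : hashVal m a D x < 4 * D :=
  Nat.mod_lt _ (by omega)

theorem card_Ico_filter_dvd (p M : ℕ) : #{z ∈ Finset.Ico 1 p | M ∣ z} = (p - 1) / M := by
  rw [← Nat.Ioc_filter_dvd_card_eq_div (p - 1) M]
  rfl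

/-- Multiplication by a random residue modulo a prime is a universal hash function. -/
theorem card_hash_collision_le {p M x y : ℕ} (hp : p.Prime) (hx : x < p) (hy : y < p)
    (hxy : x ≠ y) :
    #{a ∈ Finset.Ico 1 p | a * x % p % M = a * y % p % M} ≤ 2 * ((p - 1) / M) := by
  have : Fact p.Prime := ⟨hp⟩
  have hp0 := hp.pos
  -- `z a` is the residue of `a * (x - y)`; the summand `p` avoids truncation. Since `x - y` is
  -- invertible, `z` is injective on the nonzero residues. If the two residues agree modulo `M`,
  -- then `M` divides `z a` or `p - z a`, depending on which residue is larger, and each case allows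
  -- at most `(p - 1) / M` values.
  set z : ℕ → ℕ := fun a => (a * x % p + p - a * y % p) % p with hz
  have hcast : ∀ a, ((z a : ℕ) : ZMod p) = a * ((x : ZMod p) - y) := by
    intro a
    have h1 : a * y % p ≤ a * x % p + p := by have := Nat.mod_lt (a * y) hp0; omega
    simp only [hz, ZMod.natCast_mod, Nat.cast_sub h1, Nat.cast_add, Nat.cast_mul,
      CharP.cast_eq_zero]
    ring
  have hsub : (x : ZMod p) - y ≠ 0 := by
    intro h
    rw [sub_eq_zero, ZMod.natCast_eq_natCast_iff, Nat.ModEq, Nat.mod_eq_of_lt hx,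
      Nat.mod_eq_of_lt hy] at h
    exact hxy h
  have hinj : Set.InjOn z (Finset.Ico 1 p) := by
    intro a ha b hb hab
    simp only [Finset.coe_Ico, Set.mem_Ico] at ha hb
    have h1 : ((z a : ℕ) : ZMod p) = (z b : ℕ) := by rw [hab]
    rw [hcast, hcast] at h1
    have h2 := mul_right_cancel₀ hsub h1
    rwa [ZMod.natCast_eq_natCast_iff, Nat.ModEq, Nat.mod_eq_of_lt ha.2,
      Nat.mod_eq_of_lt hb.2] at h2
  have hpos : ∀ a ∈ Finset.Ico 1 p, z a ∈ Finset.Ico 1 p := by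
    intro a ha
    rw [Finset.mem_Ico] at ha ⊢
    refine ⟨Nat.one_le_iff_ne_zero.2 fun h => ?_, Nat.mod_lt _ hp0⟩
    have h1 := hcast a
    rw [h, Nat.cast_zero, eq_comm, mul_eq_zero, or_iff_left hsub,
      ZMod.natCast_eq_zero_iff] at h1
    exact absurd (Nat.le_of_dvd (by omega) h1) (by omega)
  have hdvd : ∀ a, a * x % p % M = a * y % p % M → M ∣ z a ∨ M ∣ p - z a := by
    intro a h
    have hu := Nat.mod_lt (a * x) hp0
    have hv := Nat.mod_lt (a * y) hp0
    simp only [hz]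
    generalize a * x % p = u at *
    generalize a * y % p = v at *
    rcases le_or_gt v u with hle | hlt
    · left
      have : (u + p - v) % p = u - v := by
        rw [show u + p - v = u - v + p by omega, Nat.add_mod_right, Nat.mod_eq_of_lt (by omega)]
      rw [this]
      exact (Nat.modEq_iff_dvd' hle).1 h.symm
    · right
      rw [Nat.mod_eq_of_lt (by omega), show p - (u + p - v) = v - u by omega]
      exact (Nat.modEq_iff_dvd' hlt.le).1 h
  have hcard : #{z ∈ Finset.Ico 1 p | M ∣ p - z} ≤ (p - 1) / M := by
    rw [← card_Ico_filter_dvd]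
    refine Finset.card_le_card_of_injOn (fun z => p - z) ?_ ?_
    · intro a ha
      simp only [Finset.coe_filter, Finset.mem_Ico, Set.mem_ofPred_eq] at ha ⊢
      exact ⟨by omega, ha.2⟩
    · intro a ha b hb hab
      simp only [Finset.coe_filter, Finset.mem_Ico, Set.mem_ofPred_eq] at ha hb hab
      omega
  calc #{a ∈ Finset.Ico 1 p | a * x % p % M = a * y % p % M}
      ≤ #({z ∈ Finset.Ico 1 p | M ∣ z} ∪ {z ∈ Finset.Ico 1 p | M ∣ p - z}) := by
        refine Finset.card_le_card_of_injOn z ?_ (hinj.mono ?_)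
        · intro a ha
          simp only [Finset.coe_filter, Set.mem_ofPred_eq] at ha
          simp only [Finset.coe_union, Finset.coe_filter, Set.mem_union, Set.mem_ofPred_eq,
            ← and_or_left]
          exact ⟨hpos a ha.1, hdvd a ha.2⟩
        · intro a ha
          simp only [Finset.coe_filter, Set.mem_ofPred_eq] at ha
          exact ha.1
    _ ≤ 2 * ((p - 1) / M) := by
        refine (Finset.card_union_le _ _).trans ?_
        rw [card_Ico_filter_dvd]
        omega

/-- Some seed separates at least half of the elements from all others. -/
theorem exists_seed (s : Finset ℕ) (χ : ℕ → ℕ) {N D : ℕ} (hN : 0 < N)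
    (hχ : ∀ i ∈ s, χ i < N) (hinj : Set.InjOn χ s) (hs : #s ≤ D) :
    ∃ m < 2 * N, ∃ a < 2 * N,
      2 * #{i ∈ s | 2 ≤ #{i' ∈ s | hashVal m a D (χ i') = hashVal m a D (χ i)}} ≤ D := by
  -- Bertrand's postulate gives a prime above all keys that is still a valid bound for seeds. The
  -- seed stores `p - 1`.
  obtain ⟨p, hp, hNp, hpN⟩ := Nat.exists_prime_lt_and_le_two_mul N hN.ne'
  have hp1 := hp.one_lt
  have hm : p - 1 + 1 = p := by omega
  set col : ℕ → Finset (ℕ × ℕ) := fun a =>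
    {x ∈ s.offDiag | hashVal (p - 1) a D (χ x.1) = hashVal (p - 1) a D (χ x.2)} with hcol
  have hsum : ∑ a ∈ Finset.Ico 1 p, #(col a) ≤ #s.offDiag * (2 * ((p - 1) / (4 * D))) := by
    simp only [hcol, Finset.card_filter]
    rw [Finset.sum_comm, ← smul_eq_mul, ← Finset.sum_const]
    refine Finset.sum_le_sum fun x hx => ?_
    rw [Finset.mem_offDiag] at hx
    rw [← Finset.card_filter]
    simp only [hashVal, hm]
    exact card_hash_collision_le hp ((hχ _ hx.1).trans hNp) ((hχ _ hx.2.1).trans hNp)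
      fun h => hx.2.2 (hinj hx.1 hx.2.1 h)
  -- Averaging over `a`: there are at most `D * D` ordered pairs, each colliding for at most `2 *
  -- ((p - 1) / (4 * D))` multipliers, so the average number of colliding ordered pairs is at most
  -- `D / 2`. This is where the factor `4` in the table size is used.
  obtain ⟨a, ha, hca⟩ : ∃ a ∈ Finset.Ico 1 p, 2 * #(col a) ≤ D := by
    by_contra! hcon
    have h1 : (p - 1) * (D + 1) ≤ 2 * ∑ a ∈ Finset.Ico 1 p, #(col a) := by
      rw [Finset.mul_sum]
      calc (p - 1) * (D + 1) = ∑ a ∈ Finset.Ico 1 p, (D + 1) := by simp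
        _ ≤ _ := Finset.sum_le_sum fun a ha => hcon a ha
    have h2 : #s.offDiag ≤ D * D := by
      rw [Finset.offDiag_card]
      exact (Nat.sub_le _ _).trans (Nat.mul_le_mul hs hs)
    have h3 : (p - 1) / (4 * D) * (4 * D) ≤ p - 1 := Nat.div_mul_le_self _ _
    have h4 : 2 * ∑ a ∈ Finset.Ico 1 p, #(col a) ≤ (p - 1) * D := by
      calc 2 * ∑ a ∈ Finset.Ico 1 p, #(col a)
          ≤ 2 * (D * D * (2 * ((p - 1) / (4 * D)))) := by
            gcongr; exact hsum.trans (Nat.mul_le_mul_right _ h2)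
        _ = (p - 1) / (4 * D) * (4 * D) * D := by ring
        _ ≤ (p - 1) * D := Nat.mul_le_mul_right _ h3
    have h5 : (p - 1) * (D + 1) = (p - 1) * D + (p - 1) := by ring
    omega
  rw [Finset.mem_Ico] at ha
  refine ⟨p - 1, by omega, a, by omega, le_trans (Nat.mul_le_mul_left 2 ?_) hca⟩
  -- Every element in a collision is the first component of some colliding ordered pair.
  refine (Finset.card_le_card ?_).trans (Finset.card_image_le (s := col a) (f := Prod.fst))
  intro i hi
  rw [Finset.mem_filter] at hi
  obtain ⟨hi, h2⟩ := hi
  obtain ⟨i', hi', hne⟩ := Finset.exists_mem_ne h2 i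
  rw [Finset.mem_filter] at hi'
  rw [Finset.mem_image]
  refine ⟨(i, i'), ?_, rfl⟩
  simp only [hcol, Finset.mem_filter, Finset.mem_offDiag]
  exact ⟨⟨hi, hi'.1, hne.symm⟩, hi'.2.symm⟩

/-- The first position of level `j` in the sequence of tables. -/
def levelStart (d j : ℕ) : ℕ := ∑ i ∈ Finset.range j, 4 * (d / 2 ^ i)

theorem levelStart_succ (d j : ℕ) : levelStart d (j + 1) = levelStart d j + 4 * (d / 2 ^ j) := by
  simp [levelStart, Finset.sum_range_succ]

theorem levelStart_le (d j : ℕ) : levelStart d j ≤ 8 * d := by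
  -- Geometric series: the extra term reserves room for all remaining levels, which makes the
  -- induction go through.
  have : ∀ j, levelStart d j + 8 * (d / 2 ^ j) ≤ 8 * d := by
    intro j
    induction j with
    | zero => simp [levelStart]
    | succ j ih =>
      rw [levelStart_succ, pow_succ, ← Nat.div_div_eq_div_mul]
      omega
  have := this j
  omega

/-- The position of `x` on level `i`. -/
def hashPos (d : ℕ) (sm sa : ℕ → ℕ) (x i : ℕ) : ℕ :=
  levelStart d i + hashVal (sm i) (sa i) (d / 2 ^ i) x

/-- The number of marked positions below `p`. -/
def onesBelow (bm : ℕ → ℕ) (p : ℕ) : ℕ := #{p' ∈ Finset.range p | bm p' ≠ 0}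

theorem onesBelow_congr {bm bm' : ℕ → ℕ} {p : ℕ} (h : ∀ q < p, bm q = bm' q) :
    onesBelow bm p = onesBelow bm' p := by
  unfold onesBelow
  congr 1
  refine Finset.filter_congr fun q hq => ?_
  rw [h q (Finset.mem_range.1 hq)]

theorem onesBelow_succ (bm : ℕ → ℕ) (p : ℕ) :
    onesBelow bm (p + 1) = onesBelow bm p + if bm p ≠ 0 then 1 else 0 := by
  unfold onesBelow
  rw [Finset.range_add_one, Finset.filter_insert]
  split_ifs <;> simp

/-- The element `x` has been found on level `i`, and on no earlier level. -/
def HitAt (d : ℕ) (sm sa bm : ℕ → ℕ) (x i : ℕ) : Prop :=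
  bm (hashPos d sm sa x i) ≠ 0 ∧ ∀ i' < i, bm (hashPos d sm sa x i') = 0

/-- The state of the construction of the tables for the elements `ns`: the elements `w` with
`U w ≠ 0` are missed on all levels below `j`, the others have been found on a level below `l` and
their slots are the numbers below `k`. -/
structure HashState (d : ℕ) (ns : Finset ℕ) (χ sm sa bm slot U : ℕ → ℕ) (j l pos k : ℕ) :
    Prop where
  card_eq : k + #{w ∈ ns | U w ≠ 0} = #ns
  ones_eq : onesBelow bm pos = k
  bm_eq_zero : ∀ p, pos ≤ p → bm p = 0
  slot_lt : ∀ w ∈ ns, U w = 0 → slot w < k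
  hit : ∀ w ∈ ns, U w = 0 → ∃ i < l, HitAt d sm sa bm (χ w) i ∧
    slot w = onesBelow bm (hashPos d sm sa (χ w) i)
  slot_inj : ∀ w ∈ ns, ∀ w' ∈ ns, U w = 0 → U w' = 0 → slot w = slot w' → w = w'
  miss : ∀ w ∈ ns, U w ≠ 0 → ∀ i < j, bm (hashPos d sm sa (χ w) i) = 0

theorem HashState.init (d : ℕ) {ns : Finset ℕ} {χ sm sa bm slot U : ℕ → ℕ}
    (hU : ∀ w ∈ ns, U w ≠ 0) (hbm : ∀ p, bm p = 0) :
    HashState d ns χ sm sa bm slot U 0 0 0 0 where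
  card_eq := by rw [Finset.filter_true_of_mem hU, zero_add]
  ones_eq := rfl
  bm_eq_zero := fun p _ => hbm p
  slot_lt := fun w hw h => absurd h (hU w hw)
  hit := fun w hw h => absurd h (hU w hw)
  slot_inj := fun w hw _ _ h => absurd h (hU w hw)
  miss := fun w _ _ i hi => absurd hi (by omega)

/-- The state during the construction of level `j`, when `c` positions have been dealt with. -/
structure LevelState (d : ℕ) (ns : Finset ℕ) (χ sm sa bm slot U cnt own : ℕ → ℕ)
    (j c k : ℕ) : Prop where
  state : HashState d ns χ sm sa bm slot U j (j + 1) (levelStart d j + c) k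
  done : ∀ w ∈ ns, U w ≠ 0 → hashVal (sm j) (sa j) (d / 2 ^ j) (χ w) < c →
    2 ≤ cnt (hashVal (sm j) (sa j) (d / 2 ^ j) (χ w)) ∧ bm (hashPos d sm sa (χ w) j) = 0
  cnt_eq : ∀ c', c ≤ c' → c' < 4 * (d / 2 ^ j) →
    cnt c' = #{w ∈ ns | U w ≠ 0 ∧ hashVal (sm j) (sa j) (d / 2 ^ j) (χ w) = c'}
  own_mem : ∀ c', c ≤ c' → c' < 4 * (d / 2 ^ j) →
    ∀ w ∈ ns, U w ≠ 0 → hashVal (sm j) (sa j) (d / 2 ^ j) (χ w) = c' →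
      own c' ∈ ns ∧ U (own c') ≠ 0 ∧ hashVal (sm j) (sa j) (d / 2 ^ j) (χ (own c')) = c'

/-! ### Invariants for building one level of the tables -/

section

variable {d : ℕ} {ns : Finset ℕ} {χ sm sa bm slot U cnt own : ℕ → ℕ} {j c k : ℕ}

theorem hashPos_update_of_lt {x i m a : ℕ} (hi : i < j) :
    hashPos d (Function.update sm j m) (Function.update sa j a) x i = hashPos d sm sa x i := by
  simp [hashPos, Function.update_of_ne hi.ne]

/-- Only the seeds at index `j` are overwritten, and everything recorded so far refers to positions
on lower levels. -/
theorem HashState.levelState {m a : ℕ}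
    (h : HashState d ns χ sm sa bm slot U j j (levelStart d j) k)
    (hc : ∀ c' < 4 * (d / 2 ^ j),
      cnt c' = #{w ∈ ns | U w ≠ 0 ∧ hashVal m a (d / 2 ^ j) (χ w) = c'})
    (ho : ∀ c' < 4 * (d / 2 ^ j), ∀ w ∈ ns, U w ≠ 0 → hashVal m a (d / 2 ^ j) (χ w) = c' →
      own c' ∈ ns ∧ U (own c') ≠ 0 ∧ hashVal m a (d / 2 ^ j) (χ (own c')) = c') :
    LevelState d ns χ (Function.update sm j m) (Function.update sa j a) bm slot U cnt own j 0
      k where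
  state :=
    { card_eq := h.card_eq
      ones_eq := h.ones_eq
      bm_eq_zero := h.bm_eq_zero
      slot_lt := h.slot_lt
      hit := by
        intro w hw hU
        obtain ⟨i, hi, h1, h2⟩ := h.hit w hw hU
        refine ⟨i, by omega, ⟨?_, fun i' hi' => ?_⟩, ?_⟩
        · rw [hashPos_update_of_lt hi]; exact h1.1
        · rw [hashPos_update_of_lt (hi'.trans hi)]; exact h1.2 i' hi'
        · rw [hashPos_update_of_lt hi]; exact h2
      slot_inj := h.slot_inj
      miss := by
        intro w hw hU i hi
        rw [hashPos_update_of_lt hi]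
        exact h.miss w hw hU i hi }
  done := fun w _ _ h => absurd h (by omega)
  cnt_eq := fun c' _ h => by simpa using hc c' h
  own_mem := fun c' _ h => by simpa using ho c' h

/-- A position hit by no live element or by several ones stays unmarked, so the live elements hashed
there are missed on this level too. -/
theorem LevelState.step_of_ne
    (h : LevelState d ns χ sm sa bm slot U cnt own j c k) (hc : c < 4 * (d / 2 ^ j))
    (hne : cnt c ≠ 1) :
    LevelState d ns χ sm sa bm slot U cnt own j (c + 1) k where
  state :=
    { h.state with
      ones_eq := by
        rw [← add_assoc, onesBelow_succ, h.state.bm_eq_zero _ le_rfl]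
        simpa using h.state.ones_eq
      bm_eq_zero := fun p hp => h.state.bm_eq_zero p (by omega) }
  done := by
    intro w hw hU hlt
    rcases Nat.lt_succ_iff_lt_or_eq.1 hlt with h1 | h1
    · exact h.done w hw hU h1
    · refine ⟨?_, h.state.bm_eq_zero _ (by simp only [hashPos]; omega)⟩
      rw [h1]
      have h2 : 0 < cnt c := by
        rw [h.cnt_eq c le_rfl hc, Finset.card_pos]
        exact ⟨w, Finset.mem_filter.2 ⟨hw, hU, h1⟩⟩
      omega
  cnt_eq := fun c' h1 h2 => h.cnt_eq c' (by omega) h2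
  own_mem := fun c' h1 h2 => h.own_mem c' (by omega) h2

/-- Count one forces the owner to be the only live element at this position. The new mark lies to
the right of all earlier ones, so the ranks recorded before are unchanged and the new rank is `k`,
larger than all slots in use. Elements found earlier cannot be confused by the new mark: only their
first hit counts, and levels below `j` are untouched. -/
theorem LevelState.step_of_eq
    (h : LevelState d ns χ sm sa bm slot U cnt own j c k) (hc : c < 4 * (d / 2 ^ j))
    (heq : cnt c = 1) :
    own c ∈ ns ∧ LevelState d ns χ sm sa (Function.update bm (levelStart d j + c) 1)
      (Function.update slot (own c) k) (Function.update U (own c) 0) cnt own j (c + 1) (k + 1) := by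
  have hcard := h.cnt_eq c le_rfl hc
  rw [heq] at hcard
  obtain ⟨w₀, hw₀⟩ := Finset.card_eq_one.1 hcard.symm
  have hmem : ∀ w ∈ ns, U w ≠ 0 → hashVal (sm j) (sa j) (d / 2 ^ j) (χ w) = c → w = w₀ := by
    intro w h1 h2 h3
    rw [← Finset.mem_singleton, ← hw₀]
    exact Finset.mem_filter.2 ⟨h1, h2, h3⟩
  have hw₀' : w₀ ∈ ({w₀} : Finset ℕ) := Finset.mem_singleton_self _
  rw [← hw₀, Finset.mem_filter] at hw₀'
  obtain ⟨hon, hoU, hoh⟩ := h.own_mem c le_rfl hc w₀ hw₀'.1 hw₀'.2.1 hw₀'.2.2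
  obtain rfl := hmem _ hon hoU hoh
  set o := own c with ho
  set pos := levelStart d j + c with hpos
  have hopos : hashPos d sm sa (χ o) j = pos := by rw [hashPos, hoh]
  have hlt : ∀ p, bm p ≠ 0 → p < pos := fun p hp => by
    by_contra hcon
    exact hp (h.state.bm_eq_zero p (by omega))
  have hbm : ∀ p, bm p ≠ 0 → Function.update bm pos 1 p ≠ 0 := fun p hp => by
    rw [Function.update_of_ne (hlt p hp).ne]; exact hp
  have hones : ∀ p ≤ pos, onesBelow (Function.update bm pos 1) p = onesBelow bm p :=
    fun p hp => onesBelow_congr fun q hq => Function.update_of_ne (by omega) _ _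
  -- positions on the levels below `j`, and those of other live elements, are unchanged
  have hlevel : ∀ x, ∀ i < j, bm (hashPos d sm sa x i) = 0 →
      Function.update bm pos 1 (hashPos d sm sa x i) = 0 := by
    intro x i hi hx
    rw [Function.update_of_ne, hx]
    -- An empty level below `j` would make level `j` empty, contrary to `hc`. Otherwise the hash
    -- value stays within level `i`, which ends before level `j` begins.
    rcases Nat.eq_zero_or_pos (d / 2 ^ i) with h0 | h0
    · have h1 : d / 2 ^ j ≤ d / 2 ^ i :=
        Nat.div_le_div_left (Nat.pow_le_pow_right (by norm_num) hi.le) (by positivity)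
      omega
    · have h1 : levelStart d (i + 1) ≤ levelStart d j :=
        Finset.sum_le_sum_of_subset (Finset.range_mono hi)
      have h2 := hashVal_lt (m := sm i) (a := sa i) (x := x) h0
      rw [levelStart_succ] at h1
      simp only [hashPos]
      omega
  have hUne : ∀ w, Function.update U o 0 w ≠ 0 → w ≠ o ∧ U w ≠ 0 := by
    intro w hw
    by_cases hwo : w = o
    · simp [hwo] at hw
    · rw [Function.update_of_ne hwo] at hw; exact ⟨hwo, hw⟩
  refine ⟨hon, ⟨⟨?_, ?_, ?_, ?_, ?_, ?_, ?_⟩, ?_, ?_, ?_⟩⟩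
  · have h1 : {w ∈ ns | Function.update U o 0 w ≠ 0} = {w ∈ ns | U w ≠ 0}.erase o := by
      ext w
      by_cases hwo : w = o <;> simp [hwo, Function.update_of_ne]
    have h2 : o ∈ {w ∈ ns | U w ≠ 0} := Finset.mem_filter.2 ⟨hon, hoU⟩
    have h3 := h.state.card_eq
    have h4 := Finset.card_pos.2 ⟨o, h2⟩
    rw [h1, Finset.card_erase_of_mem h2]
    omega
  · rw [← add_assoc, onesBelow_succ, hones _ le_rfl, h.state.ones_eq]
    simp [← hpos]
  · intro p hp
    rw [Function.update_of_ne (by omega)]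
    exact h.state.bm_eq_zero p (by omega)
  · intro w hw hU
    by_cases hwo : w = o
    · simp [hwo]
    · rw [Function.update_of_ne hwo] at hU ⊢
      exact (h.state.slot_lt w hw hU).trans (by omega)
  · intro w hw hU
    by_cases hwo : w = o
    · subst hwo
      refine ⟨j, by omega, ⟨?_, fun i hi => hlevel _ i hi (h.state.miss o hw hoU i hi)⟩, ?_⟩
      · rw [hopos]; simp
      · rw [hopos, hones _ le_rfl, h.state.ones_eq]; simp
    · rw [Function.update_of_ne hwo] at hU ⊢
      obtain ⟨i, hi, h1, h2⟩ := h.state.hit w hw hU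
      refine ⟨i, hi, ⟨hbm _ h1.1, fun i' hi' => hlevel _ i' (by omega) (h1.2 i' hi')⟩, ?_⟩
      rw [hones _ (hlt _ h1.1).le, h2]
  · intro w hw w' hw' hU hU' hs
    by_cases hwo : w = o <;> by_cases hwo' : w' = o
    · rw [hwo, hwo']
    · rw [Function.update_of_ne hwo'] at hU' hs
      have := h.state.slot_lt w' hw' hU'
      simp [hwo] at hs
      omega
    · rw [Function.update_of_ne hwo] at hU hs
      have := h.state.slot_lt w hw hU
      simp [hwo'] at hs
      omega
    · rw [Function.update_of_ne hwo] at hU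
      rw [Function.update_of_ne hwo'] at hU'
      rw [Function.update_of_ne hwo, Function.update_of_ne hwo'] at hs
      exact h.state.slot_inj w hw w' hw' hU hU' hs
  · intro w hw hU i hi
    exact hlevel _ i hi (h.state.miss w hw (hUne w hU).2 i hi)
  · intro w hw hU hlt'
    obtain ⟨h1, h2⟩ := hUne w hU
    rcases Nat.lt_succ_iff_lt_or_eq.1 hlt' with h3 | h3
    · refine ⟨(h.done w hw h2 h3).1, ?_⟩
      rw [Function.update_of_ne (by simp only [hashPos]; omega)]
      exact (h.done w hw h2 h3).2
    · exact absurd (hmem w hw h2 h3) h1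
  · intro c' h1 h2
    rw [h.cnt_eq c' (by omega) h2]
    congr 1
    refine Finset.filter_congr fun w hw => ?_
    by_cases hwo : w = o
    · subst hwo
      simp only [hoh, Function.update_self]
      constructor <;> rintro ⟨h3, h4⟩ <;> omega
    · rw [Function.update_of_ne hwo]
  · intro c' h1 h2 w hw hU hh
    obtain ⟨h3, h4, h5⟩ := h.own_mem c' (by omega) h2 w hw (hUne w hU).2 hh
    refine ⟨h3, ?_, h5⟩
    rw [Function.update_of_ne]
    · exact h4
    · intro h6
      rw [h6, hoh] at h5
      omega

/-- The elements left over all lie in collisions, so the bound on collisions for the seed bounds the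
number of keys on the next level. -/
theorem LevelState.finish (h : LevelState d ns χ sm sa bm slot U cnt own j (4 * (d / 2 ^ j)) k)
    (hd : d / 2 ^ j ≠ 0) :
    HashState d ns χ sm sa bm slot U (j + 1) (j + 1) (levelStart d (j + 1)) k ∧
      ∀ w ∈ ns, U w ≠ 0 → 2 ≤ cnt (hashVal (sm j) (sa j) (d / 2 ^ j) (χ w)) := by
  have hlt : ∀ w, hashVal (sm j) (sa j) (d / 2 ^ j) (χ w) < 4 * (d / 2 ^ j) :=
    fun w => hashVal_lt (Nat.pos_of_ne_zero hd)
  refine ⟨{ h.state with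
    ones_eq := by rw [levelStart_succ]; exact h.state.ones_eq
    bm_eq_zero := by rw [levelStart_succ]; exact h.state.bm_eq_zero
    miss := fun w hw hU i hi => ?_ }, fun w hw hU => (h.done w hw hU (hlt w)).1⟩
  rcases Nat.lt_succ_iff_lt_or_eq.1 hi with h1 | rfl
  · exact h.state.miss w hw hU i h1
  · exact (h.done w hw hU (hlt w)).2

end

/-! ## The arrays and variables of the encoding algorithm -/

namespace Ram

/-- halves of the numbers up to `rBound` -/
scoped notation "rHalf" => (4 : ℕ)
/-- colours of the vertices -/
scoped notation "rColor" => (5 : ℕ)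
/-- forbidden colours -/
scoped notation "rForb" => (6 : ℕ)
/-- first components of the seeds -/
scoped notation "rSeedM" => (7 : ℕ)
/-- second components of the seeds -/
scoped notation "rSeedA" => (8 : ℕ)
/-- hash tables -/
scoped notation "rTable" => (9 : ℕ)
/-- slots of the neighbours -/
scoped notation "rSlot" => (10 : ℕ)
/-- the neighbours without a slot -/
scoped notation "rLive" => (11 : ℕ)
/-- current hash values -/
scoped notation "rHash" => (12 : ℕ)
/-- numbers of elements with a given hash value -/
scoped notation "rCount" => (13 : ℕ)
/-- some element with a given hash value -/
scoped notation "rOwner" => (14 : ℕ)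
/-- bound for the colours and the seeds -/
scoped notation "rBound" => (20 : ℕ)
/-- a quarter of the size of the current table -/
scoped notation "rWidth" => (21 : ℕ)
/-- whether a seed has been found -/
scoped notation "rFound" => (22 : ℕ)
/-- first component of the current seed -/
scoped notation "rM" => (23 : ℕ)
/-- second component of the current seed -/
scoped notation "rA" => (24 : ℕ)
/-- number of elements in collisions -/
scoped notation "rBad" => (25 : ℕ)
/-- auxiliary value -/
scoped notation "rY" => (26 : ℕ)
/-- next slot -/
scoped notation "rNext" => (27 : ℕ)
/-- current position in the tables -/
scoped notation "rPos" => (28 : ℕ)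
/-- current level -/
scoped notation "rLevel" => (29 : ℕ)
/-- current position in the input or output -/
scoped notation "rPtr" => (30 : ℕ)
/-- length of numbers in the output -/
scoped notation "rLen" => (31 : ℕ)
/-- number of levels -/
scoped notation "rLevels" => (32 : ℕ)

/-- The number of vertices. -/
def Term.order : Term := .var 0

/-- The bound for the degrees. -/
def Term.deg : Term := .cell 0 (.lit 0) (.lit 1)

/-- The multiple `c * e`. -/
def Term.nmul : ℕ → Term → Term
  | 0, _ => .lit 0
  | c + 1, e => .add (nmul c e) e

@[simp] theorem Term.eval_lit (σ : Store) (k : ℕ) : (Term.lit k).eval σ = k := rfl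
@[simp] theorem Term.eval_var (σ : Store) (a : ℕ) : (Term.var a).eval σ = σ a 0 0 := rfl
@[simp] theorem Term.eval_arr (σ : Store) (a : ℕ) (e : Term) :
    (Term.arr a e).eval σ = σ a 0 (e.eval σ) := rfl
@[simp] theorem Term.eval_cell (σ : Store) (a : ℕ) (i j : Term) :
    (Term.cell a i j).eval σ = σ a (i.eval σ) (j.eval σ) := rfl
@[simp] theorem Term.eval_add (σ : Store) (e f : Term) :
    (Term.add e f).eval σ = e.eval σ + f.eval σ := rfl
@[simp] theorem Term.eval_sub (σ : Store) (e f : Term) :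
    (Term.sub e f).eval σ = e.eval σ - f.eval σ := rfl
@[simp] theorem Term.eval_order (σ : Store) : Term.order.eval σ = σ 0 0 0 := rfl
@[simp] theorem Term.eval_deg (σ : Store) : Term.deg.eval σ = σ 0 0 1 := rfl
@[simp] theorem Term.eval_nmul (σ : Store) (c : ℕ) (e : Term) :
    (Term.nmul c e).eval σ = c * e.eval σ := by
  induction c with
  | zero => simp [nmul]
  | succ c ih => simp [nmul, ih, Nat.succ_mul]

theorem Term.eval_write {e : Term} {a : ℕ} (h : e.reads a = false) (σ : Store) (i j x : ℕ) :
    e.eval (σ.write a i j x) = e.eval σ := by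
  have : σ.write a i j x = Function.update σ a (σ.write a i j x a) := by
    funext a'
    by_cases ha : a' = a
    · subst ha; simp
    · rw [Function.update_of_ne ha, Store.write_of_ne _ _ _ _ ha]
  rw [this, Term.eval_update h]

theorem Store.write_write (σ : Store) (a i j x y : ℕ) :
    (σ.write a i j x).write a i j y = σ.write a i j y := by
  funext a' i' j'
  by_cases h : a' = a ∧ i' = i ∧ j' = j <;> simp [Store.write, h]

theorem Store.write_eq_self (σ : Store) (a i j : ℕ) : σ.write a i j (σ a i j) = σ := by
  funext a' i' j'
  by_cases h : a' = a ∧ i' = i ∧ j' = j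
  · obtain ⟨rfl, rfl, rfl⟩ := h; simp [Store.write]
  · simp [Store.write, h]

variable {B : ℕ} {σ : Store}

/-! ## Arithmetic -/

/-- Reduce the variable `y` modulo `e`. -/
def modProg (y : ℕ) (e : Term) : Program :=
  .loop (.sub (.add (.var y) (.lit 1)) e) (.set y (.sub (.var y) e))

theorem runs_modProg {y : ℕ} {e : Term} (hy : e.reads y = false) (he : 0 < e.eval σ)
    (hB : σ y 0 0 ≤ B) :
    Runs B (modProg y e) σ fun τ => τ = σ.write y 0 0 (σ y 0 0 % e.eval σ) := by
  -- The test `y + 1 - e` is nonzero exactly when `e ≤ y`. Each round lowers `y` by at least one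
  -- because `e` is positive, hence the invariant `i + v ≤ σ y 0 0`.
  refine Runs.loop (fun i τ => ∃ v, i + v ≤ σ y 0 0 ∧ v % e.eval σ = σ y 0 0 % e.eval σ ∧
    τ = σ.write y 0 0 v) _ hB ⟨σ y 0 0, by omega, rfl, (Store.write_eq_self _ _ _ _).symm⟩ ?_ ?_
  · rintro i τ ⟨v, hv, hmod, rfl⟩ hne
    have hval : (σ.write y 0 0 v) y 0 0 = v := by simp [Store.write]
    simp only [Term.eval_sub, Term.eval_add, Term.eval_var, Term.eval_lit, hval,
      Term.eval_write hy] at hne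
    refine ⟨by omega, .set ⟨v - e.eval σ, by omega, ?_, ?_⟩⟩
    · rw [← hmod, ← Nat.mod_eq_sub_mod (by omega)]
    · simp only [Term.eval_sub, Term.eval_var, hval, Term.eval_write hy, Store.write_write]
  · rintro i τ ⟨v, hv, hmod, rfl⟩ h0
    have hval : (σ.write y 0 0 v) y 0 0 = v := by simp [Store.write]
    simp only [Term.eval_sub, Term.eval_add, Term.eval_var, Term.eval_lit, hval,
      Term.eval_write hy] at h0
    rw [← hmod, Nat.mod_eq_of_lt (by omega)]

/-- Compute the bound `2 * (d * d + 1)` for colours and seeds. -/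
def boundProg : Program :=
  .seq (.set rBound (.lit 2))
    (.forLoop 40 .deg (.set rBound (.add (.var rBound) (.add .deg .deg))))

theorem runs_boundProg (hB : σ 0 0 1 ≤ B) :
    Runs B boundProg σ fun τ => τ rBound 0 0 = 2 * (σ 0 0 1 * σ 0 0 1 + 1) := by
  refine .seq (.set ?_)
  refine Runs.forLoop (fun i τ => τ rBound 0 0 = 2 * (i * σ 0 0 1 + 1)) (σ 0 0 1) hB rfl
    (by simp [Store.write_apply]) (fun i τ hf _ => ?_) (fun i hi τ hf hv hI => .set ?_)
    (fun τ hf hI => hI)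
  · simp [hf 0 rfl, Store.write_apply]
  · simp [Store.write_apply, hf 0 rfl, hI]
    ring

/-- Tabulate the halves of numbers. -/
def halfProg : Program :=
  -- Division is not an operation of the machine; the table follows the recursion `(i + 2) / 2 = i /
  -- 2 + 1`, and the entries for `0` and `1` are correct because the memory is initially zero.
  .forLoop 40 (.var rBound)
    (.setArr rHalf (.add (.var 40) (.lit 2)) (.add (.arr rHalf (.var 40)) (.lit 1)))

theorem runs_halfProg (hB : σ rBound 0 0 ≤ B) (h0 : σ rHalf = 0) :
    Runs B halfProg σ fun τ => ∀ y < σ rBound 0 0 + 2, τ rHalf 0 y = y / 2 := by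
  refine Runs.forLoop (fun i τ => ∀ y < i + 2, τ rHalf 0 y = y / 2) _ hB rfl
    ?_ (fun i τ hf _ => ?_) (fun i hi τ hf hv hI => .setArr ?_) (fun τ hf hI => hI)
  · intro y hy
    simp only [Store.write_apply, h0]
    simp
    omega
  · simp [hf 20 rfl]
  · intro y hy
    by_cases h : y = i + 2
    · subst h
      simp [Store.write_apply, hv, hI i (by omega)]
    · simp [Store.write_apply, hv, h]
      exact hI y (by omega)

/-- Compute the length of the binary expansion of `e` in the variable `t`. -/
def sizeProg (t : ℕ) (e : Term) : Program :=
  .seq (.set t (.lit 0)) (.seq (.set rY e)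
    (.loop (.var rY) (.seq (.set rY (.arr rHalf (.var rY)))
      (.set t (.add (.var t) (.lit 1))))))

/-- The binary length counts the halvings until zero is reached. It is therefore also the number of
nonempty levels of the hash tables. -/
theorem div_two_pow_ne_zero_iff {x i : ℕ} : x / 2 ^ i ≠ 0 ↔ i < Nat.size x := by
  rw [Nat.lt_size, Nat.div_ne_zero_iff]
  simp

theorem runs_sizeProg {t : ℕ} {e : Term} {x : ℕ} (ht : t ≠ rY) (ht' : t ≠ rHalf)
    (het : e.reads t = false) (hx : e.eval σ = x) (hB : x ≤ B)
    (hh : ∀ y ≤ x, σ rHalf 0 y = y / 2) :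
    Runs B (sizeProg t e) σ fun τ => τ t 0 0 = Nat.size x := by
  refine .seq (.set (.seq (.set ?_)))
  refine Runs.loop (fun i τ => τ rY 0 0 = x / 2 ^ i ∧ τ t 0 0 = i ∧ τ rHalf = σ rHalf ∧
    i ≤ Nat.size x)
    (Nat.size x) (le_trans ?_ hB) ?_ ?_ ?_
  · rw [Nat.size_le]; exact Nat.lt_two_pow_self
  · simp [Store.write_apply, Store.write_of_ne _ _ _ _ ht'.symm, Store.write_of_ne, ht, ht.symm,
      Term.eval_write het, hx]
  · rintro i τ ⟨h1, h2, h3, h4⟩ hne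
    rw [Term.eval_var, h1, div_two_pow_ne_zero_iff] at hne
    refine ⟨hne, .seq (.set (.set ?_))⟩
    simp [Store.write_apply, Store.write_of_ne _ _ _ _ ht'.symm, Store.write_of_ne, ht, ht.symm,
      h1, h2, h3]
    rw [hh _ (Nat.div_le_self _ _), pow_succ, Nat.div_div_eq_div_mul]
    exact ⟨rfl, hne⟩
  · rintro i τ ⟨h1, h2, h3, h4⟩ h0
    rw [Term.eval_var, h1] at h0
    have := mt (div_two_pow_ne_zero_iff (x := x) (i := i)).2 (by simpa using h0)
    rw [h2]; omega

end Ram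

namespace Ram

/-! ## Colouring the vertices -/

variable {B : ℕ} {σ : Store}

/-- The memory holds a graph with `n` vertices and degrees at most `d`. -/
structure GraphStore (σ : Store) (n d : ℕ) : Prop where
  order_eq : σ 0 0 0 = n
  deg_eq : σ 0 0 1 = d
  lt : ∀ i j, σ 1 i j ≠ 0 → j < n
  symm : ∀ i j, σ 1 i j ≠ 0 → σ 1 j i ≠ 0
  degree_le : ∀ i, #{j ∈ Finset.range n | σ 1 i j ≠ 0} ≤ d

theorem GraphStore.congr {n d : ℕ} {τ : Store} (h : GraphStore σ n d) (h0 : τ 0 = σ 0)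
    (h1 : τ 1 = σ 1) : GraphStore τ n d := by
  obtain ⟨a, b, c, e, f⟩ := h
  constructor <;> simpa only [h0, h1]

/-- Colour the vertices one by one with the least colour not yet used at distance two. -/
def colorProg : Program :=
  .forLoop 40 .order <|
    .seq (.forLoop 41 .order <|
      .ite (.cell 1 (.var 41) (.var 40))
        (.forLoop 42 (.var 40) <|
          .ite (.cell 1 (.var 41) (.var 42))
            (.assign rForb (.var 40) (.arr rColor (.var 42)) (.lit 1)) .skip)
        .skip) <|
    .seq (.set rY (.lit 0)) <|
    .seq (.loop (.cell rForb (.var 40) (.var rY)) (.set rY (.add (.var rY) (.lit 1)))) <|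
    .setArr rColor (.var 40) (.var rY)

/-- A vertex has at most `d` neighbours with at most `d` neighbours each, so at most `d * d` colours
can be forbidden. This bounds both the colours and the search for a free one. -/
theorem forbidden_lt {n d v y : ℕ} (hG : GraphStore σ n d) {c : ℕ → ℕ}
    (h : ∀ x < y, ∃ u w, σ 1 u v ≠ 0 ∧ σ 1 u w ≠ 0 ∧ c w = x) : y ≤ d * d := by
  have hsub : Finset.range y ⊆ ({u ∈ Finset.range n | σ 1 v u ≠ 0}.biUnion fun u =>
      {w ∈ Finset.range n | σ 1 u w ≠ 0}).image c := by
    intro x hx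
    obtain ⟨u, w, h1, h2, h3⟩ := h x (Finset.mem_range.1 hx)
    simp only [Finset.mem_image, Finset.mem_biUnion, Finset.mem_filter, Finset.mem_range]
    exact ⟨w, ⟨u, ⟨hG.lt _ _ (hG.symm _ _ h1), hG.symm _ _ h1⟩, hG.lt _ _ h2, h2⟩, h3⟩
  calc y = #(Finset.range y) := by simp
    _ ≤ _ := Finset.card_le_card hsub
    _ ≤ _ := Finset.card_image_le
    _ ≤ #{u ∈ Finset.range n | σ 1 v u ≠ 0} * d :=
        Finset.card_biUnion_le_card_mul _ _ _ fun u _ => hG.degree_le u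
    _ ≤ d * d := Nat.mul_le_mul_right _ (hG.degree_le v)

theorem runs_colorProg {n d : ℕ} (hG : GraphStore σ n d) (hn : n ≤ B) (hd : d * d ≤ B)
    (h0 : σ rForb = 0) :
    Runs B colorProg σ fun τ => (∀ v < n, τ rColor 0 v ≤ d * d) ∧
      ∀ u v w, v ≠ w → σ 1 u v ≠ 0 → σ 1 u w ≠ 0 → τ rColor 0 v ≠ τ rColor 0 w := by
  refine Runs.forLoop (fun v τ => (∀ v' < v, τ rColor 0 v' ≤ d * d) ∧
    (∀ v' < v, ∀ w < v, v' ≠ w → ∀ u, σ 1 u v' ≠ 0 → σ 1 u w ≠ 0 →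
      τ rColor 0 v' ≠ τ rColor 0 w) ∧ ∀ v', v ≤ v' → ∀ x, τ rForb v' x = 0) n hn rfl
    ?_ (fun i τ hf _ => by simp [hf 0 rfl, hG.order_eq]) ?_ ?_
  · simp [Store.write_apply, h0]
  · rintro v hv τ hf hv40 ⟨hle, hne, hfr⟩
    have e0 : τ 0 = σ 0 := hf 0 rfl
    have e1 : τ 1 = σ 1 := hf 1 rfl
    clear hf
    -- Row `v` of the array of forbidden colours marks precisely the colours of earlier vertices
    -- that share a neighbour with `v`. Every vertex has its own row, so nothing has to be cleared.
    refine .seq (Runs.mono (Q := fun τ' => (∀ x, τ' rForb v x ≠ 0 ↔ ∃ u < n, ∃ w < v,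
      σ 1 u v ≠ 0 ∧ σ 1 u w ≠ 0 ∧ τ rColor 0 w = x) ∧ (∀ v', v < v' → ∀ x, τ' rForb v' x = 0) ∧
      τ' rColor = τ rColor ∧ τ' 40 = τ 40) ?_ ?_)
    · refine Runs.forLoop (fun u τ' => (∀ x, τ' rForb v x ≠ 0 ↔ ∃ u' < u, ∃ w < v,
        σ 1 u' v ≠ 0 ∧ σ 1 u' w ≠ 0 ∧ τ rColor 0 w = x) ∧ ∀ v', v < v' → ∀ x, τ' rForb v' x = 0)
        n hn rfl ?_ (fun i τ hf _ => by simp [hf 0 rfl, e0, hG.order_eq]) ?_ ?_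
      · simp [Store.write_apply]
        exact ⟨hfr v le_rfl, fun v' hv' => hfr v' hv'.le⟩
      · rintro u hu τ₁ hf₁ hu41 ⟨h1, h2⟩
        have e40 : τ₁ 40 0 0 = v := by rw [hf₁ 40 rfl, hv40]
        have e11 : τ₁ 1 = σ 1 := by rw [hf₁ 1 rfl, e1]
        have e5 : τ₁ rColor = τ rColor := hf₁ 5 rfl
        clear hf₁
        refine .ite (fun ha => ?_) (fun ha => .skip ?_)
        · simp only [Term.eval_cell, Term.eval_var, e40, hu41, e11] at ha
          refine Runs.forLoop (fun w τ' => (∀ x, τ' rForb v x ≠ 0 ↔ (∃ u' < u, ∃ w < v,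
            σ 1 u' v ≠ 0 ∧ σ 1 u' w ≠ 0 ∧ τ rColor 0 w = x) ∨
            ∃ w' < w, σ 1 u w' ≠ 0 ∧ τ rColor 0 w' = x) ∧ ∀ v', v < v' → ∀ x, τ' rForb v' x = 0)
            v (hv.le.trans hn) rfl ?_ (fun i τ hf _ => by simp [hf 40 rfl, e40]) ?_ ?_
          · simp [Store.write_apply]
            exact ⟨fun x => by simpa using h1 x, h2⟩
          · rintro w hw τ₂ hf₂ hw42 ⟨h3, h4⟩
            have e40' : τ₂ 40 0 0 = v := by rw [hf₂ 40 rfl, e40]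
            have e41' : τ₂ 41 0 0 = u := by rw [hf₂ 41 rfl, hu41]
            have e11' : τ₂ 1 = σ 1 := by rw [hf₂ 1 rfl, e11]
            have e5' : τ₂ rColor = τ rColor := by rw [hf₂ 5 rfl, e5]
            clear hf₂
            have hsucc : ∀ x, (∃ w' < w + 1, σ 1 u w' ≠ 0 ∧ τ rColor 0 w' = x) ↔
                (∃ w' < w, σ 1 u w' ≠ 0 ∧ τ rColor 0 w' = x) ∨
                  (σ 1 u w ≠ 0 ∧ τ rColor 0 w = x) := by
              intro x
              constructor
              · rintro ⟨w', h5, h6⟩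
                rcases Nat.lt_succ_iff_lt_or_eq.1 h5 with h | rfl
                · exact .inl ⟨w', h, h6⟩
                · exact .inr h6
              · rintro (⟨w', h5, h6⟩ | h6)
                · exact ⟨w', by omega, h6⟩
                · exact ⟨w, by omega, h6⟩
            refine .ite (fun hb => .assign ?_) (fun hb => .skip ?_)
            · simp only [Term.eval_cell, Term.eval_var, e41', hw42, e11'] at hb
              simp only [Term.eval_arr, Term.eval_var, Term.eval_lit, e40', hw42, e5']
              refine ⟨fun x => ?_, fun v' hv' x => ?_⟩
              · rw [hsucc, ← or_assoc, ← h3]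
                by_cases hx : x = τ rColor 0 w
                · simp [Store.write_apply, hx, hb]
                · simp [Store.write_apply, hx, Ne.symm hx]
              · simp [Store.write_apply, hv'.ne', h4 v' hv' x]
            · simp only [Term.eval_cell, Term.eval_var, e41', hw42, e11'] at hb
              refine ⟨fun x => ?_, fun v' hv' x => by simp [Store.write_apply, h4 v' hv' x]⟩
              rw [hsucc, ← or_assoc, ← h3]
              simp [Store.write_apply, hb]
          · rintro τ₂ hf₂ ⟨h3, h4⟩
            refine ⟨fun x => ?_, fun v' hv' x => by simp [Store.write_apply, h4 v' hv' x]⟩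
            have : (τ₂.write 41 0 0 (u + 1)) rForb v x = τ₂ rForb v x := by
              simp [Store.write_apply]
            rw [this, h3]
            constructor
            · rintro (⟨u', h5, h6⟩ | ⟨w, h5, h6⟩)
              · exact ⟨u', by omega, h6⟩
              · exact ⟨u, by omega, w, h5, ha, h6⟩
            · rintro ⟨u', h5, w, h6, h7, h8⟩
              rcases Nat.lt_succ_iff_lt_or_eq.1 h5 with h | rfl
              · exact .inl ⟨u', h, w, h6, h7, h8⟩
              · exact .inr ⟨w, h6, h8⟩
        · simp only [Term.eval_cell, Term.eval_var, e40, hu41, e11] at ha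
          refine ⟨fun x => ?_, fun v' hv' x => by simp [Store.write_apply, h2 v' hv' x]⟩
          have : (τ₁.write 41 0 0 (u + 1)) rForb v x = τ₁ rForb v x := by
            simp [Store.write_apply]
          rw [this, h1]
          constructor
          · rintro ⟨u', h5, h6⟩
            exact ⟨u', by omega, h6⟩
          · rintro ⟨u', h5, w, h6, h7, h8⟩
            rcases Nat.lt_succ_iff_lt_or_eq.1 h5 with h | rfl
            · exact ⟨u', h, w, h6, h7, h8⟩
            · exact absurd ha h7
      · rintro τ₁ hf₁ ⟨h1, h2⟩
        exact ⟨h1, h2, hf₁ 5 rfl, hf₁ 40 rfl⟩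
    · rintro τ₁ ⟨h1, h2, e5, e40⟩
      have hv40' : τ₁ 40 0 0 = v := by rw [e40, hv40]
      have hbound : ∀ y, (∀ x < y, τ₁ rForb v x ≠ 0) → y ≤ d * d := by
        intro y hy
        refine forbidden_lt hG (v := v) (c := fun w => τ rColor 0 w) fun x hx => ?_
        obtain ⟨u, -, w, -, h3⟩ := (h1 x).1 (hy x hx)
        exact ⟨u, w, h3⟩
      refine .seq (.set (.seq (Runs.mono (Q := fun τ' => ∃ y ≤ d * d, τ₁ rForb v y = 0 ∧
        τ' = τ₁.write rY 0 0 y) ?_ ?_)))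
      · refine Runs.loop (fun i τ' => (∀ x < i, τ₁ rForb v x ≠ 0) ∧ τ' = τ₁.write rY 0 0 i)
          (d * d) hd (by simp) ?_ ?_
        · rintro i τ' ⟨h3, rfl⟩ hne
          simp [Store.write_apply, hv40'] at hne
          have h4 : ∀ x < i + 1, τ₁ rForb v x ≠ 0 := by
            intro x hx
            rcases Nat.lt_succ_iff_lt_or_eq.1 hx with h | rfl
            · exact h3 x h
            · exact hne
          refine ⟨hbound _ h4, .set ⟨h4, ?_⟩⟩
          rw [Store.write_write]
          simp [Store.write_apply]
        · rintro i τ' ⟨h3, rfl⟩ hne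
          simp [Store.write_apply, hv40'] at hne
          exact ⟨i, hbound _ h3, hne, rfl⟩
      · rintro _ ⟨y, hy, hy0, rfl⟩
        refine .setArr ?_
        have key : ∀ w < v, ∀ u, σ 1 u v ≠ 0 → σ 1 u w ≠ 0 → y ≠ τ rColor 0 w := by
          rintro w hw u h3 h4 rfl
          exact absurd hy0 ((h1 _).2 ⟨u, hG.lt _ _ (hG.symm _ _ h3), w, hw, h3, h4, rfl⟩)
        simp only [Term.eval_var]
        simp [Store.write_apply, hv40', e5]
        refine ⟨fun v' hv' => ?_, fun v' hv' w hw hvw u ha hb => ?_, fun v' hv' x => h2 v' hv' x⟩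
        · by_cases h : v' = v
          · simp [h, hy]
          · rw [Function.update_of_ne h]
            exact hle v' (by omega)
        · by_cases h : v' = v <;> by_cases h' : w = v
          · omega
          · subst h
            rw [Function.update_self, Function.update_of_ne h']
            exact key w (by omega) u ha hb
          · subst h'
            rw [Function.update_self, Function.update_of_ne h]
            exact (key v' (by omega) u hb ha).symm
          · rw [Function.update_of_ne h, Function.update_of_ne h']
            exact hne v' (by omega) w (by omega) hvw u ha hb
  · rintro τ hf ⟨h1, h2, h3⟩
    exact ⟨h1, fun u v w hvw ha hb => h2 v (hG.lt _ _ ha) w (hG.lt _ _ hb) hvw u ha hb⟩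

end Ram

namespace Ram

/-! ## Evaluating a seed -/

variable {B : ℕ} {σ : Store}

/-- Compute the hash values of all vertices. -/
def hashProg : Program :=
  .forLoop 43 .order <|
    .seq (.set rY (.lit 0)) <|
    .seq (.forLoop 44 (.arr rColor (.var 43)) (.set rY (.add (.var rY) (.var rA)))) <|
    .seq (modProg rY (.add (.var rM) (.lit 1))) <|
    .seq (modProg rY (.nmul 4 (.var rWidth))) <|
    .setArr rHash (.var 43) (.var rY)

/-- Products are formed by repeated addition and residues by repeated subtraction, so the number of
rounds depends on the size of `a * x`; this is the reason for the hypothesis `haχ`. -/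
theorem runs_hashProg {n m a D : ℕ} (hn : σ 0 0 0 = n) (hm : σ rM 0 0 = m) (ha : σ rA 0 0 = a)
    (hD : σ rWidth 0 0 = D) (hD0 : 0 < D) (hnB : n ≤ B) (hχ : ∀ w < n, σ rColor 0 w ≤ B)
    (haχ : ∀ w < n, a * σ rColor 0 w ≤ B) :
    Runs B hashProg σ fun τ => ∀ w < n, τ rHash 0 w = hashVal m a D (σ rColor 0 w) := by
  refine Runs.forLoop (fun i τ => ∀ w < i, τ rHash 0 w = hashVal m a D (σ rColor 0 w)) n hnB rfl
    (by simp) (fun i τ hf _ => by simp [hf 0 rfl, hn]) ?_ (fun τ hf hI => hI)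
  rintro w hw τ hf hw43 hI
  have e5 : τ rColor = σ rColor := hf 5 rfl
  have eM : τ rM 0 0 = m := by rw [hf 23 rfl, hm]
  have eA : τ rA 0 0 = a := by rw [hf 24 rfl, ha]
  have eD : τ rWidth 0 0 = D := by rw [hf 21 rfl, hD]
  clear hf
  refine .seq (.set (.seq (Runs.mono (Q := fun τ' => τ' rY 0 0 = a * σ rColor 0 w ∧
    τ' 43 0 0 = w ∧ τ' rHash = τ rHash ∧ τ' rM 0 0 = m ∧ τ' rWidth 0 0 = D) ?_ ?_)))
  · refine Runs.forLoop (fun i τ' => τ' rY 0 0 = i * a) (σ rColor 0 w) (hχ w hw) rfl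
      (by simp [Store.write_apply]) (fun i τ' hf' _ => ?_) ?_ ?_
    · simp [hf' 5 rfl, hf' 43 rfl, Store.write_apply, hw43, e5]
    · rintro i hi τ' hf' hi44 hI'
      refine .set ?_
      simp [Store.write_apply, hI', hf' 24 rfl, eA]
      ring
    · rintro τ' hf' hI'
      refine ⟨by rw [hI', mul_comm], ?_, ?_, ?_, ?_⟩
      · simp [hf' 43 rfl, Store.write_apply, hw43]
      · rw [hf' 12 rfl, Store.write_of_ne _ _ _ _ (by decide)]
      · simp [hf' 23 rfl, Store.write_apply, eM]
      · simp [hf' 21 rfl, Store.write_apply, eD]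
  · rintro τ' ⟨h1, h2, h3, h4, h5⟩
    refine .seq ((runs_modProg rfl (by simp) (by rw [h1]; exact haχ w hw)).mono ?_)
    rintro _ rfl
    have e1 : (Term.add (.var rM) (.lit 1)).eval τ' = m + 1 := by simp [h4]
    rw [e1, h1]
    refine .seq ((runs_modProg rfl (by simp [Store.write_apply, h5, hD0]) ?_).mono ?_)
    · simp only [Store.write_apply]
      simp
      exact (Nat.mod_le _ _).trans (haχ w hw)
    rintro _ rfl
    refine .setArr ?_
    rintro w' hw'
    rcases Nat.lt_succ_iff_lt_or_eq.1 hw' with h | rfl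
    · simp [Store.write_apply, h2, h3, h.ne, hI w' h]
    · simp [Store.write_apply, h2, h5, hashVal]

/-- Count the live elements with given hash values. -/
def countProg : Program :=
  .seq (.forLoop 43 (.nmul 4 (.var rWidth)) (.setArr rCount (.var 43) (.lit 0))) <|
  .forLoop 43 .order <|
    .ite (.arr rLive (.var 43))
      (.seq (.setArr rCount (.arr rHash (.var 43))
          (.add (.arr rCount (.arr rHash (.var 43))) (.lit 1)))
        (.setArr rOwner (.arr rHash (.var 43)) (.var 43)))
      .skip

/-- The owner of a hash value is the last live element with this value. It is meaningful only if
there is one, and it is the only one when the count is one. -/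
theorem runs_countProg {n D : ℕ} (hn : σ 0 0 0 = n)
    (hD : σ rWidth 0 0 = D) (hnB : n ≤ B) (hDB : 4 * D ≤ B) :
    Runs B countProg σ fun τ =>
      (∀ c < 4 * D, τ rCount 0 c = #{w ∈ Finset.range n | σ rLive 0 w ≠ 0 ∧ σ rHash 0 w = c}) ∧
      ∀ c, ∀ w < n, σ rLive 0 w ≠ 0 → σ rHash 0 w = c →
        τ rOwner 0 c < n ∧ σ rLive 0 (τ rOwner 0 c) ≠ 0 ∧ σ rHash 0 (τ rOwner 0 c) = c := by
  refine .seq ((Runs.forLoop (fun i τ => ∀ c < i, τ rCount 0 c = 0) (4 * D) hDB rfl (by simp)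
    (fun i τ hf _ => by simp [hf 21 rfl, hD]) (fun i hi τ hf hi43 hI => .setArr ?_)
    (Q := fun τ => ∀ c < 4 * D, τ rCount 0 c = 0) (fun τ hf hI => hI)).frame.mono ?_)
  · intro c hc
    rcases Nat.lt_succ_iff_lt_or_eq.1 hc with h | rfl
    · simp [Store.write_apply, hi43, h.ne, hI c h]
    · simp [Store.write_apply, hi43]
  rintro τ ⟨h0, hf⟩
  have e0 : τ 0 = σ 0 := hf 0 rfl
  have e11 : τ rLive = σ rLive := hf 11 rfl
  have e12 : τ rHash = σ rHash := hf 12 rfl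
  clear hf
  refine Runs.forLoop (fun i τ => (∀ c < 4 * D, τ rCount 0 c =
      #{w ∈ Finset.range i | σ rLive 0 w ≠ 0 ∧ σ rHash 0 w = c}) ∧
      ∀ c, ∀ w < i, σ rLive 0 w ≠ 0 → σ rHash 0 w = c →
        τ rOwner 0 c < i ∧ σ rLive 0 (τ rOwner 0 c) ≠ 0 ∧ σ rHash 0 (τ rOwner 0 c) = c)
    n hnB rfl ?_ (fun i τ hf _ => by simp [hf 0 rfl, e0, hn]) ?_ (fun τ hf hI => hI)
  · simpa [Store.write_apply] using h0
  · rintro w hw τ' hf' hw43 ⟨h1, h2⟩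
    have e11' : τ' rLive = σ rLive := by rw [hf' 11 rfl, e11]
    have e12' : τ' rHash = σ rHash := by rw [hf' 12 rfl, e12]
    clear hf'
    simp only [Finset.range_add_one, Finset.filter_insert]
    refine .ite (fun hl => .seq (.setArr (.setArr ?_))) (fun hl => .skip ?_)
    · simp only [Term.eval_arr, Term.eval_var, hw43, e11'] at hl
      simp only [Term.eval_arr, Term.eval_var, Term.eval_add, Term.eval_lit]
      simp only [Store.write_apply, hw43, e12']
      simp [hw43]
      refine ⟨fun c hc => ?_, fun c w' hw' hl' hh => ?_⟩
      · by_cases hcw : c = σ rHash 0 w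
        · rw [if_pos ⟨hl, hcw.symm⟩, Finset.card_insert_of_notMem (by simp), hcw,
            Function.update_self, h1 _ (hcw ▸ hc)]
        · rw [if_neg fun h => hcw h.2.symm, Function.update_of_ne hcw, h1 c hc]
      · by_cases hcw : c = σ rHash 0 w
        · subst hcw; simp [hl]
        · rw [Function.update_of_ne hcw]
          rcases Nat.lt_succ_iff_lt_or_eq.1 (Nat.lt_succ_of_le hw') with h | rfl
          · obtain ⟨h3, h4, h5⟩ := h2 c w' h hl' hh
            exact ⟨by omega, h4, h5⟩
          · exact absurd hh.symm hcw
    · simp only [Term.eval_arr, Term.eval_var, hw43, e11'] at hl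
      simp only [hl]
      refine ⟨fun c hc => by simpa [Store.write_apply] using h1 c hc, fun c w' hw' hl' hh => ?_⟩
      rcases Nat.lt_succ_iff_lt_or_eq.1 hw' with h | rfl
      · obtain ⟨h3, h4, h5⟩ := h2 c w' h hl' hh
        simp only [Store.write_apply]
        exact ⟨by simp; omega, h4, h5⟩
      · exact absurd hl hl'

/-- Count the live elements in collisions. -/
def badProg : Program :=
  .seq (.set rBad (.lit 0)) <|
  .forLoop 43 .order <|
    .ite (.arr rLive (.var 43))
      (.ite (.sub (.arr rCount (.arr rHash (.var 43))) (.lit 1))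
        (.set rBad (.add (.var rBad) (.lit 1))) .skip)
      .skip

theorem runs_badProg {n : ℕ} (hn : σ 0 0 0 = n) (hnB : n ≤ B) :
    Runs B badProg σ fun τ => τ rBad 0 0 =
      #{w ∈ Finset.range n | σ rLive 0 w ≠ 0 ∧ 2 ≤ σ rCount 0 (σ rHash 0 w)} := by
  refine .seq (.set ?_)
  refine Runs.forLoop (fun i τ => τ rBad 0 0 =
      #{w ∈ Finset.range i | σ rLive 0 w ≠ 0 ∧ 2 ≤ σ rCount 0 (σ rHash 0 w)})
    n hnB rfl (by simp [Store.write_apply])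
    (fun i τ hf _ => by simp [hf 0 rfl, hn, Store.write_apply]) ?_ (fun τ hf hI => hI)
  rintro w hw τ hf hw43 hI
  have e11 : τ rLive = σ rLive := by rw [hf 11 rfl, Store.write_of_ne _ _ _ _ (by decide)]
  have e12 : τ rHash = σ rHash := by rw [hf 12 rfl, Store.write_of_ne _ _ _ _ (by decide)]
  have e13 : τ rCount = σ rCount := by rw [hf 13 rfl, Store.write_of_ne _ _ _ _ (by decide)]
  clear hf
  simp only [Finset.range_add_one, Finset.filter_insert]
  refine .ite (fun hl => .ite (fun hc => .set ?_) (fun hc => .skip ?_)) (fun hl => .skip ?_) <;>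
    simp only [Term.eval_arr, Term.eval_var, Term.eval_sub, Term.eval_lit, hw43, e11, e12,
      e13] at *
  · rw [if_pos ⟨hl, by omega⟩, Finset.card_insert_of_notMem (by simp)]
    simp [Store.write_apply, hI]
  · rw [if_neg (fun h => by omega)]
    simpa [Store.write_apply] using hI
  · rw [if_neg (fun h => h.1 hl)]
    simpa [Store.write_apply] using hI

/-- Compute the hash values for the current seed, and the number of elements in collisions. -/
def evalProg : Program := .seq hashProg (.seq countProg badProg)

/-- The outcome of the evaluation of the seed `(m, a)`. -/
structure Evaluated (n : ℕ) (χ U : ℕ → ℕ) (D m a : ℕ) (cnt own : ℕ → ℕ) (bad : ℕ) : Prop where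
  cnt_eq : ∀ c < 4 * D, cnt c =
    #{w ∈ Finset.range n | U w ≠ 0 ∧ hashVal m a D (χ w) = c}
  own_mem : ∀ c, ∀ w < n, U w ≠ 0 → hashVal m a D (χ w) = c →
    own c < n ∧ U (own c) ≠ 0 ∧ hashVal m a D (χ (own c)) = c
  bad_eq : bad = #{w ∈ Finset.range n | U w ≠ 0 ∧ 2 ≤ cnt (hashVal m a D (χ w))}

theorem runs_evalProg {n m a D : ℕ} (hn : σ 0 0 0 = n) (hm : σ rM 0 0 = m) (ha : σ rA 0 0 = a)
    (hD : σ rWidth 0 0 = D) (hD0 : 0 < D) (hnB : n ≤ B) (hDB : 4 * D ≤ B)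
    (hχ : ∀ w < n, σ rColor 0 w ≤ B) (haχ : ∀ w < n, a * σ rColor 0 w ≤ B) :
    Runs B evalProg σ fun τ => Evaluated n (σ rColor 0) (σ rLive 0) D m a (τ rCount 0)
      (τ rOwner 0) (τ rBad 0 0) := by
  refine .seq ((runs_hashProg hn hm ha hD hD0 hnB hχ haχ).frame.mono ?_)
  rintro τ₁ ⟨h1, hf1⟩
  refine .seq ((runs_countProg (n := n) (D := D) (by rw [hf1 0 rfl, hn]) (by rw [hf1 21 rfl, hD])
    hnB hDB).frame.mono ?_)
  rintro τ₂ ⟨⟨h2, h3⟩, hf2⟩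
  refine (runs_badProg (n := n) (by rw [hf2 0 rfl, hf1 0 rfl, hn]) hnB).frame.mono ?_
  rintro τ₃ ⟨h4, hf3⟩
  rw [hf1 11 rfl] at h2 h3
  have e13 : τ₃ rCount = τ₂ rCount := hf3 13 rfl
  have e14 : τ₃ rOwner = τ₂ rOwner := hf3 14 rfl
  rw [hf2 11 rfl, hf1 11 rfl, hf2 12 rfl] at h4
  rw [e13, e14]
  refine ⟨fun c hc => ?_, fun c w hw hl hh => ?_, ?_⟩
  · rw [h2 c hc]
    congr 1
    refine Finset.filter_congr fun w hw => ?_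
    rw [h1 w (Finset.mem_range.1 hw)]
  · obtain ⟨h5, h6, h7⟩ := h3 c w hw hl (by rw [h1 w hw, hh])
    exact ⟨h5, h6, by rw [← h1 _ h5, h7]⟩
  · rw [h4]
    congr 1
    refine Finset.filter_congr fun w hw => ?_
    rw [h1 w (Finset.mem_range.1 hw)]

end Ram

namespace Ram

/-! ## Searching for seeds -/

variable {B : ℕ} {σ : Store}

/-- Search for a seed that separates at least half of the live elements. -/
def searchProg : Program :=
  .seq (.set rFound (.lit 0)) <|
  .forLoop 41 (.var rBound) <| .forLoop 42 (.var rBound) <|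
    .ite (.var rFound) .skip <|
      .seq (.set rM (.var 41)) <| .seq (.set rA (.var 42)) <| .seq evalProg <|
        .ite (.sub (.add (.var rBad) (.var rBad)) (.var rWidth)) .skip (.set rFound (.lit 1))

/-- The seed `(m, a)` separates at least half of the elements. -/
def GoodSeed (n : ℕ) (χ U : ℕ → ℕ) (D m a : ℕ) : Prop :=
  2 * #{w ∈ Finset.range n | U w ≠ 0 ∧ 2 ≤ #{w' ∈ Finset.range n | U w' ≠ 0 ∧
    hashVal m a D (χ w') = hashVal m a D (χ w)}} ≤ D

theorem Evaluated.goodSeed_iff {n D m a bad : ℕ} {χ U cnt own : ℕ → ℕ}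
    (h : Evaluated n χ U D m a cnt own bad) (hD : 0 < D) :
    GoodSeed n χ U D m a ↔ 2 * bad ≤ D := by
  rw [GoodSeed, h.bad_eq]
  have : ∀ w, cnt (hashVal m a D (χ w)) = #{w' ∈ Finset.range n | U w' ≠ 0 ∧
    hashVal m a D (χ w') = hashVal m a D (χ w)} := fun w => h.cnt_eq _ (hashVal_lt hD)
  simp only [this]

/-- A good seed is the current one. -/
def SeedFound (n X : ℕ) (χ U : ℕ → ℕ) (D : ℕ) (τ : Store) : Prop :=
  τ rM 0 0 < X ∧ τ rA 0 0 < X ∧ 2 * τ rBad 0 0 ≤ D ∧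
    Evaluated n χ U D (τ rM 0 0) (τ rA 0 0) (τ rCount 0) (τ rOwner 0) (τ rBad 0 0)

theorem runs_searchProg {n X D : ℕ} (hn : σ 0 0 0 = n) (hX : σ rBound 0 0 = X)
    (hD : σ rWidth 0 0 = D) (hD0 : 0 < D) (hnB : n ≤ B) (hXB : X * X ≤ B) (hDB : 4 * D ≤ B)
    (hχ : ∀ w < n, σ rColor 0 w < X)
    (hex : ∃ m < X, ∃ a < X, GoodSeed n (σ rColor 0) (σ rLive 0) D m a) :
    Runs B searchProg σ (SeedFound n X (σ rColor 0) (σ rLive 0) D) := by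
  have hXB' : X ≤ B := (Nat.le_mul_self X).trans hXB
  refine .seq (.set ?_)
  -- Exhaustive search over all pairs. Either a good seed has been found, and its counts and owners
  -- are still in memory because nothing is evaluated afterwards, or all pairs tried so far are bad.
  -- At the end the second case contradicts `hex`.
  refine Runs.forLoop (fun m τ => (τ rFound 0 0 ≠ 0 ∧
      SeedFound n X (σ rColor 0) (σ rLive 0) D τ) ∨
    (τ rFound 0 0 = 0 ∧ ∀ m' < m, ∀ a < X, ¬ GoodSeed n (σ rColor 0) (σ rLive 0) D m' a)) X hXB'
    rfl (.inr (by simp [Store.write_apply]))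
    (fun i τ hf _ => by simp [hf 20 rfl, Store.write_apply, hX]) ?_ ?_
  · rintro m hm τ hf hm41 hI
    have e0 : τ 0 = σ 0 := by rw [hf 0 rfl, Store.write_of_ne _ _ _ _ (by decide)]
    have e20 : τ rBound = σ rBound := by rw [hf 20 rfl, Store.write_of_ne _ _ _ _ (by decide)]
    have e21 : τ rWidth = σ rWidth := by rw [hf 21 rfl, Store.write_of_ne _ _ _ _ (by decide)]
    have e5 : τ rColor = σ rColor := by rw [hf 5 rfl, Store.write_of_ne _ _ _ _ (by decide)]
    have e11 : τ rLive = σ rLive := by rw [hf 11 rfl, Store.write_of_ne _ _ _ _ (by decide)]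
    clear hf
    refine Runs.forLoop (fun a τ => (τ rFound 0 0 ≠ 0 ∧
        SeedFound n X (σ rColor 0) (σ rLive 0) D τ) ∨
      (τ rFound 0 0 = 0 ∧ (∀ m' < m, ∀ a < X, ¬ GoodSeed n (σ rColor 0) (σ rLive 0) D m' a) ∧
        ∀ a' < a, ¬ GoodSeed n (σ rColor 0) (σ rLive 0) D m a')) X hXB'
      rfl ?_ (fun i τ hf _ => by simp [hf 20 rfl, e20, hX]) ?_ ?_
    · simpa [Store.write_apply, SeedFound] using hI
    · rintro a ha τ₁ hf₁ ha42 hI₁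
      have e41 : τ₁ 41 0 0 = m := by rw [hf₁ 41 rfl, hm41]
      have f0 : τ₁ 0 = σ 0 := by rw [hf₁ 0 rfl, e0]
      have f21 : τ₁ rWidth = σ rWidth := by rw [hf₁ 21 rfl, e21]
      have f5 : τ₁ rColor = σ rColor := by rw [hf₁ 5 rfl, e5]
      have f11 : τ₁ rLive = σ rLive := by rw [hf₁ 11 rfl, e11]
      clear hf₁
      refine .ite (fun hfd => .skip ?_) (fun hfd => ?_)
      · rcases hI₁ with h | h
        · left
          simpa [Store.write_apply, SeedFound] using h
        · exact absurd h.1 hfd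
      · replace hI₁ := hI₁.resolve_left fun h => h.1 hfd
        obtain ⟨-, h1, h2⟩ := hI₁
        refine .seq (.set (.seq (.set (.seq ((runs_evalProg (n := n) (m := m) (a := a) (D := D)
          ?_ ?_ ?_ ?_ hD0 hnB hDB ?_ ?_).frame.mono ?_)))))
        · simp [Store.write_apply, f0, hn]
        · simp [Store.write_apply, e41]
        · simp [Store.write_apply, ha42]
        · simp [Store.write_apply, f21, hD]
        · intro w hw
          simp only [Store.write_apply]
          simpa [f5] using (hχ w hw).le.trans hXB'
        · intro w hw
          simp only [Store.write_apply]
          simpa [f5] using (Nat.mul_le_mul ha.le (hχ w hw).le).trans hXB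
        · rintro τ₂ ⟨h3, hf₂⟩
          simp [Store.write_apply, f5, f11] at h3
          have g23 : τ₂ rM 0 0 = m := by
            rw [hf₂ 23 rfl]; simp [Store.write_apply, e41]
          have g24 : τ₂ rA 0 0 = a := by
            rw [hf₂ 24 rfl]; simp [Store.write_apply, ha42]
          have g21 : τ₂ rWidth 0 0 = D := by
            rw [hf₂ 21 rfl]; simp [Store.write_apply, f21, hD]
          have g22 : τ₂ rFound 0 0 = 0 := by
            rw [hf₂ 22 rfl]; simpa [Store.write_apply] using hfd
          refine .ite (fun hb => .skip (.inr ⟨?_, h1, fun a' ha' => ?_⟩))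
            (fun hb => .set (.inl ⟨?_, ?_⟩))
          · simpa [Store.write_apply] using g22
          · rcases Nat.lt_succ_iff_lt_or_eq.1 ha' with h | rfl
            · exact h2 a' h
            · rw [h3.goodSeed_iff hD0]
              simp [g21] at hb
              omega
          · simp [Store.write_apply]
          · simp [g21] at hb
            simp only [SeedFound, Store.write_apply]
            simp [g23, g24]
            exact ⟨hm, ha, by omega, h3⟩
    · rintro τ₁ hf₁ (h | ⟨h1, h2, h3⟩)
      · left
        simpa [Store.write_apply, SeedFound] using h
      · right
        refine ⟨by simpa [Store.write_apply] using h1, fun m' hm' => ?_⟩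
        rcases Nat.lt_succ_iff_lt_or_eq.1 hm' with h | rfl
        · exact h2 m' h
        · exact h3
  · rintro τ hf (h | ⟨h1, h2⟩)
    · exact h.2
    · obtain ⟨m, hm, a, ha, hg⟩ := hex
      exact absurd hg (h2 m hm a ha)

/-! ## One level of the hash tables -/

/-- Record the elements that are alone at their positions. -/
def recordProg : Program :=
  .forLoop 43 (.nmul 4 (.var rWidth)) <|
    .seq (.ite (.arr rCount (.var 43))
      (.ite (.sub (.arr rCount (.var 43)) (.lit 1)) .skip
        (.seq (.assign rTable (.var 40) (.var rPos) (.lit 1)) <|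
         .seq (.assign rSlot (.var 40) (.arr rOwner (.var 43)) (.var rNext)) <|
         .seq (.setArr rLive (.arr rOwner (.var 43)) (.lit 0)) <|
         .set rNext (.add (.var rNext) (.lit 1))))
      .skip) <|
    .set rPos (.add (.var rPos) (.lit 1))

/-- The memories agree on the tables of all vertices other than `u`. -/
def AgreeOff (u : ℕ) (τ σ : Store) : Prop :=
  ∀ u', u' ≠ u → τ rSeedM u' = σ rSeedM u' ∧ τ rSeedA u' = σ rSeedA u' ∧
    τ rTable u' = σ rTable u' ∧ τ rSlot u' = σ rSlot u'

theorem AgreeOff.trans {u : ℕ} {τ₁ τ₂ τ₃ : Store} (h : AgreeOff u τ₁ τ₂) (h' : AgreeOff u τ₂ τ₃) :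
    AgreeOff u τ₁ τ₃ := fun u' hu' => by
  obtain ⟨a, b, c, d⟩ := h u' hu'
  obtain ⟨a', b', c', d'⟩ := h' u' hu'
  exact ⟨a.trans a', b.trans b', c.trans c', d.trans d'⟩

theorem runs_recordProg {d u j : ℕ} {ns : Finset ℕ} {χ : ℕ → ℕ} (hu : σ 40 0 0 = u)
    (hD : σ rWidth 0 0 = d / 2 ^ j) (hDB : 4 * (d / 2 ^ j) ≤ B)
    (hp : σ rPos 0 0 = levelStart d j)
    (h : LevelState d ns χ (σ rSeedM u) (σ rSeedA u) (σ rTable u) (σ rSlot u) (σ rLive 0)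
      (σ rCount 0) (σ rOwner 0) j 0 (σ rNext 0 0)) :
    Runs B recordProg σ fun τ =>
      LevelState d ns χ (τ rSeedM u) (τ rSeedA u) (τ rTable u) (τ rSlot u) (τ rLive 0)
        (τ rCount 0) (τ rOwner 0) j (4 * (d / 2 ^ j)) (τ rNext 0 0) ∧
      τ rPos 0 0 = levelStart d (j + 1) ∧ (∀ w, τ rLive 0 w ≠ 0 → σ rLive 0 w ≠ 0) ∧
      AgreeOff u τ σ := by
  refine Runs.forLoop (fun c τ => LevelState d ns χ (τ rSeedM u) (τ rSeedA u) (τ rTable u)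
      (τ rSlot u) (τ rLive 0) (τ rCount 0) (τ rOwner 0) j c (τ rNext 0 0) ∧
      τ rPos 0 0 = levelStart d j + c ∧ (∀ w, τ rLive 0 w ≠ 0 → σ rLive 0 w ≠ 0) ∧
      AgreeOff u τ σ) _ hDB rfl ?_ (fun i τ hf _ => by simp [hf 21 rfl, hD]) ?_ ?_
  · simp [Store.write_apply, AgreeOff, hp]
    exact h
  · rintro c hc τ hf hc43 ⟨h1, h2, h3, h4⟩
    have e40 : τ 40 0 0 = u := by rw [hf 40 rfl, hu]
    clear hf
    -- Common treatment of the two branches, count zero and count at least two, that record nothing.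
    have skip : τ rCount 0 c ≠ 1 → Runs B (.set rPos (.add (.var rPos) (.lit 1))) τ fun τ' =>
        (fun c τ => LevelState d ns χ (τ rSeedM u) (τ rSeedA u) (τ rTable u)
        (τ rSlot u) (τ rLive 0) (τ rCount 0) (τ rOwner 0) j c (τ rNext 0 0) ∧
        τ rPos 0 0 = levelStart d j + c ∧ (∀ w, τ rLive 0 w ≠ 0 → σ rLive 0 w ≠ 0) ∧
        AgreeOff u τ σ) (c + 1) (τ'.write 43 0 0 (c + 1)) := by
      refine fun hne => .set ?_
      simp only [Store.write_apply, AgreeOff]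
      simp [h2]
      exact ⟨h1.step_of_ne hc hne, by omega, h3, h4⟩
    refine .seq (.ite (fun ha => .ite (fun hb => .skip (skip ?_)) fun hb => ?_)
      fun ha => .skip (skip ?_))
    · simp [hc43] at hb
      omega
    · simp [hc43] at ha hb
      have heq : τ rCount 0 c = 1 := by omega
      obtain ⟨-, h5⟩ := h1.step_of_eq hc heq
      refine .seq (.assign (.seq (.assign (.seq (.setArr (.set (.set ?_)))))))
      simp only [Store.write_apply, AgreeOff]
      simp [Store.write_apply, h2, e40, hc43]
      refine ⟨h5, by omega, fun w hw => h3 w ?_, fun u' hu' => ?_⟩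
      · by_cases hwo : w = τ rOwner 0 c
        · simp [hwo] at hw
        · rwa [Function.update_of_ne hwo] at hw
      · simpa [hu'] using h4 u' hu'
    · simp [hc43] at ha
      omega
  · rintro τ hf ⟨h1, h2, h3, h4⟩
    exact ⟨h1, by rw [h2, levelStart_succ], h3, h4⟩

/-- Construct one level of the hash tables of the vertex `40`. -/
def levelProg : Program :=
  .seq searchProg <|
  .seq (.assign rSeedM (.var 40) (.var rLevel) (.var rM)) <|
  .seq (.assign rSeedA (.var 40) (.var rLevel) (.var rA)) <|
  .seq recordProg <|
  .seq (.set rWidth (.arr rHalf (.var rWidth))) <|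
  .set rLevel (.add (.var rLevel) (.lit 1))

/-- The invariant of the construction of the tables of the vertex `u`. -/
structure VertexState (n d X : ℕ) (ns : Finset ℕ) (χ : ℕ → ℕ) (u j : ℕ) (τ : Store) : Prop where
  state : HashState d ns χ (τ rSeedM u) (τ rSeedA u) (τ rTable u) (τ rSlot u) (τ rLive 0) j j
    (levelStart d j) (τ rNext 0 0)
  pos_eq : τ rPos 0 0 = levelStart d j
  level_eq : τ rLevel 0 0 = j
  width_eq : τ rWidth 0 0 = d / 2 ^ j
  live_mem : ∀ w < n, τ rLive 0 w ≠ 0 → w ∈ ns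
  card_le : #{w ∈ ns | τ rLive 0 w ≠ 0} ≤ d / 2 ^ j
  seed_lt : ∀ i < j, τ rSeedM u i < X ∧ τ rSeedA u i < X

theorem runs_levelProg {n d N u j : ℕ} {ns : Finset ℕ} (hn : σ 0 0 0 = n)
    (hX : σ rBound 0 0 = 2 * N) (hN : 0 < N) (hnB : n ≤ B) (hXB : 2 * N * (2 * N) ≤ B) (hdB : 4 * d ≤ B)
    (hχ : ∀ w < n, σ rColor 0 w < N) (hns : ns ⊆ Finset.range n)
    (hinj : Set.InjOn (σ rColor 0) ns) (hu : σ 40 0 0 = u)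
    (hh : σ rHalf 0 (d / 2 ^ j) = d / 2 ^ j / 2)
    (hj : d / 2 ^ j ≠ 0) (h : VertexState n d (2 * N) ns (σ rColor 0) u j σ) :
    Runs B levelProg σ fun τ => VertexState n d (2 * N) ns (σ rColor 0) u (j + 1) τ ∧
      AgreeOff u τ σ := by
  have hD0 := Nat.pos_of_ne_zero hj
  have hDd : d / 2 ^ j ≤ d := Nat.div_le_self _ _
  have hfilter : ∀ (p : ℕ → Prop) [DecidablePred p],
      {w ∈ Finset.range n | σ rLive 0 w ≠ 0 ∧ p w} = {w ∈ ns | σ rLive 0 w ≠ 0 ∧ p w} := by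
    intro p _
    ext w
    simp only [Finset.mem_filter, Finset.mem_range]
    exact ⟨fun hw => ⟨h.live_mem w hw.1 hw.2.1, hw.2⟩,
      fun hw => ⟨Finset.mem_range.1 (hns hw.1), hw.2⟩⟩
  refine .seq ((runs_searchProg hn hX h.width_eq hD0 hnB hXB (by omega)
    (fun w hw => (hχ w hw).trans_le (by omega)) ?_).frame.mono ?_)
  · obtain ⟨m, hm, a, ha, hg⟩ := exists_seed {w ∈ ns | σ rLive 0 w ≠ 0} (σ rColor 0) hN
      (fun i hi => hχ i (Finset.mem_range.1 (hns (Finset.mem_filter.1 hi).1)))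
      (hinj.mono (Finset.coe_subset.2 (Finset.filter_subset _ _))) h.card_le
    refine ⟨m, hm, a, ha, ?_⟩
    rw [GoodSeed, hfilter]
    simp only [hfilter]
    simpa only [Finset.filter_filter] using hg
  rintro τ₁ ⟨⟨h1, h2, h3, h4⟩, hf₁⟩
  have e7 : τ₁ rSeedM = σ rSeedM := hf₁ 7 rfl
  have e8 : τ₁ rSeedA = σ rSeedA := hf₁ 8 rfl
  have e9 : τ₁ rTable = σ rTable := hf₁ 9 rfl
  have e10 : τ₁ rSlot = σ rSlot := hf₁ 10 rfl
  have e11 : τ₁ rLive = σ rLive := hf₁ 11 rfl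
  have e27 : τ₁ rNext = σ rNext := hf₁ 27 rfl
  have e40 : τ₁ 40 0 0 = u := by rw [hf₁ 40 rfl, hu]
  have e29 : τ₁ rLevel 0 0 = j := by rw [hf₁ 29 rfl, h.level_eq]
  have e28 : τ₁ rPos 0 0 = levelStart d j := by rw [hf₁ 28 rfl, h.pos_eq]
  have e21 : τ₁ rWidth 0 0 = d / 2 ^ j := by rw [hf₁ 21 rfl, h.width_eq]
  have e4 : τ₁ rHalf = σ rHalf := hf₁ 4 rfl
  have hlev : LevelState d ns (σ rColor 0) (Function.update (σ rSeedM u) j (τ₁ rM 0 0))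
      (Function.update (σ rSeedA u) j (τ₁ rA 0 0)) (σ rTable u) (σ rSlot u) (σ rLive 0)
      (τ₁ rCount 0) (τ₁ rOwner 0) j 0 (σ rNext 0 0) := by
    refine h.state.levelState (fun c hc => ?_) (fun c hc w hw hl hhw => ?_)
    · rw [h4.cnt_eq c hc, hfilter]
    · obtain ⟨h5, h6, h7⟩ := h4.own_mem c w (Finset.mem_range.1 (hns hw)) hl hhw
      exact ⟨h.live_mem _ h5 h6, h6, h7⟩
  refine .seq (.assign (.seq (.assign (.seq ((runs_recordProg (d := d) (u := u) (j := j) (ns := ns)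
    (χ := σ rColor 0) ?_ ?_ (by omega) ?_ ?_).frame.mono ?_)))))
  · simp [Store.write_apply, e40]
  · simp [Store.write_apply, e21]
  · simp [Store.write_apply, e28]
  · simp [Store.write_apply, e40, e29, e7, e8, e9, e10, e11, e27]
    exact hlev
  rintro τ₂ ⟨⟨h5, h6, h7, h8⟩, hf₂⟩
  obtain ⟨h9, h10⟩ := h5.finish hj
  refine .seq (.set (.set ?_))
  have g21 : τ₂ rWidth 0 0 = d / 2 ^ j := by
    rw [hf₂ 21 rfl]; simp [Store.write_apply, e21]
  have g29 : τ₂ rLevel 0 0 = j := by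
    rw [hf₂ 29 rfl]; simp [Store.write_apply, e29]
  have g4 : τ₂ rHalf = σ rHalf := by
    rw [hf₂ 4 rfl]; simp [Store.write_of_ne, e4]
  have g7 : τ₂ rSeedM u = Function.update (σ rSeedM u) j (τ₁ rM 0 0) := by
    rw [hf₂ 7 rfl]; simp [Store.write_apply, e40, e29, e7]
  have g8 : τ₂ rSeedA u = Function.update (σ rSeedA u) j (τ₁ rA 0 0) := by
    rw [hf₂ 8 rfl]; simp [Store.write_apply, e40, e29, e8]
  have g13 : τ₂ rCount = τ₁ rCount := by
    rw [hf₂ 13 rfl]; simp [Store.write_of_ne]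
  have hlive : ∀ w, τ₂ rLive 0 w ≠ 0 → σ rLive 0 w ≠ 0 := by
    intro w hw
    have := h7 w hw
    simpa [Store.write_apply, e11] using this
  refine ⟨⟨?_, ?_, ?_, ?_, ?_, ?_, ?_⟩, ?_⟩
  · simp only [Store.write_apply]
    simpa using h9
  · simpa [Store.write_apply] using h6
  · simp [Store.write_apply, g29]
  · simp [Store.write_apply, g21, g4, hh]
    rw [pow_succ, Nat.div_div_eq_div_mul]
  · intro w hw hl
    simp [Store.write_apply] at hl
    exact h.live_mem w hw (hlive w hl)
  · rw [pow_succ, ← Nat.div_div_eq_div_mul, Nat.le_div_iff_mul_le (by norm_num), mul_comm]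
    refine le_trans (Nat.mul_le_mul_left 2 ?_) h3
    rw [h4.bad_eq, hfilter]
    refine Finset.card_le_card fun w hw => ?_
    simp only [Finset.mem_filter, Store.write_apply] at hw ⊢
    simp at hw
    refine ⟨hw.1, hlive w hw.2, ?_⟩
    have := h10 w hw.1 hw.2
    rwa [g7, g8, g13, Function.update_self, Function.update_self] at this
  · intro i hi
    simp [Store.write_apply, g7, g8]
    rcases Nat.lt_succ_iff_lt_or_eq.1 hi with hi | rfl
    · rw [Function.update_of_ne hi.ne, Function.update_of_ne hi.ne]
      exact h.seed_lt i hi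
    · simp [h1, h2]
  · intro u' hu'
    obtain ⟨a, b, c, e⟩ := h8 u' hu'
    simp [Store.write_apply, e40, hu', e7, e8, e9, e10] at a b c e
    simp [Store.write_apply, a, b, c, e]

end Ram

namespace Ram

/-! ## The hash tables of all vertices -/

variable {B : ℕ} {σ : Store}

/-- Construct the hash tables of the vertex `40`. -/
def vertexProg : Program :=
  .seq (.forLoop 41 .order (.setArr rLive (.var 41) (.cell 1 (.var 40) (.var 41)))) <|
  .seq (.set rWidth .deg) <| .seq (.set rLevel (.lit 0)) <| .seq (.set rPos (.lit 0)) <|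
  .seq (.set rNext (.lit 0)) <| .loop (.var rWidth) levelProg

/-- The tables `bm` for the seeds `sm`, `sa` give distinct slots below `d` to the elements
`ns`. -/
structure Hashed (d X : ℕ) (ns : Finset ℕ) (χ sm sa bm slot : ℕ → ℕ) : Prop where
  seed_lt : ∀ i < Nat.size d, sm i < X ∧ sa i < X
  slot_lt : ∀ w ∈ ns, slot w < d
  slot_inj : Set.InjOn slot ns
  hit : ∀ w ∈ ns, ∃ i < Nat.size d, HitAt d sm sa bm (χ w) i ∧
    slot w = onesBelow bm (hashPos d sm sa (χ w) i)

theorem runs_vertexProg {n d N u : ℕ} (hG : GraphStore σ n d)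
    (hX : σ rBound 0 0 = 2 * N) (hN : 0 < N) (hnB : n ≤ B) (hXB : 2 * N * (2 * N) ≤ B)
    (hdB : 4 * d ≤ B) (hχ : ∀ w < n, σ rColor 0 w < N)
    (hinj : ∀ v w, v ≠ w → σ 1 u v ≠ 0 → σ 1 u w ≠ 0 → σ rColor 0 v ≠ σ rColor 0 w)
    (hu : σ 40 0 0 = u) (hh : ∀ y ≤ d, σ rHalf 0 y = y / 2) (h0 : ∀ p, σ rTable u p = 0) :
    Runs B vertexProg σ fun τ => Hashed d (2 * N) {w ∈ Finset.range n | σ 1 u w ≠ 0} (σ rColor 0)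
      (τ rSeedM u) (τ rSeedA u) (τ rTable u) (τ rSlot u) ∧ AgreeOff u τ σ := by
  set ns := {w ∈ Finset.range n | σ 1 u w ≠ 0} with hns
  have hsize : Nat.size d ≤ B := by
    have h1 : Nat.size d ≤ d := Nat.size_le.2 Nat.lt_two_pow_self
    omega
  refine .seq ((Runs.forLoop (fun i τ => ∀ w < i, τ rLive 0 w = σ 1 u w) n hnB rfl (by simp)
    (fun i τ hf _ => by simp [hf 0 rfl, hG.order_eq]) (fun i hi τ hf h41 hI => .setArr ?_)
    (Q := fun τ => ∀ w < n, τ rLive 0 w = σ 1 u w) (fun τ hf hI => hI)).frame.mono ?_)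
  · intro w hw
    rcases Nat.lt_succ_iff_lt_or_eq.1 hw with hw | rfl
    · simp [Store.write_apply, h41, hw.ne, hI w hw]
    · simp [Store.write_apply, h41, hf 40 rfl, hf 1 rfl, hu]
  rintro τ ⟨hl, hf⟩
  have hl' : ∀ w ∈ ns, τ rLive 0 w ≠ 0 := by
    intro w hw
    rw [hns, Finset.mem_filter, Finset.mem_range] at hw
    rw [hl w hw.1]
    exact hw.2
  refine .seq (.set (.seq (.set (.seq (.set (.seq (.set ?_)))))))
  -- One round per level; the width `d / 2 ^ j` vanishes after `Nat.size d` rounds.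
  refine Runs.loop (fun j τ => VertexState n d (2 * N) ns (σ rColor 0) u j τ ∧ AgreeOff u τ σ ∧
    j ≤ Nat.size d ∧ ∀ a, vertexProg.writes a = false → τ a = σ a) (Nat.size d) hsize ?_ ?_ ?_
  · have hw : ∀ a, vertexProg.writes a = false → a ≠ 27 ∧ a ≠ 28 ∧ a ≠ 29 ∧ a ≠ 21 ∧
        (Program.forLoop 41 .order
          (.setArr rLive (.var 41) (.cell 1 (.var 40) (.var 41)))).writes a = false := by
      intro a ha
      simp only [vertexProg, Program.writes, Program.set, Bool.or_eq_false_iff,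
        beq_eq_false_iff_ne] at ha
      tauto
    refine ⟨⟨?_, ?_, ?_, ?_, ?_, ?_, ?_⟩, ?_, by omega, fun a ha => ?_⟩
    · have e9 : τ rTable = σ rTable := hf 9 rfl
      have := HashState.init d (χ := σ rColor 0) (sm := τ rSeedM u) (sa := τ rSeedA u)
        (bm := τ rTable u) (slot := τ rSlot u) hl' (by rw [e9]; exact h0)
      simp [Store.write_apply]
      exact this
    · simp [Store.write_apply, levelStart]
    · simp [Store.write_apply]
    · simp [Store.write_apply, hf 0 rfl, hG.deg_eq]
    · intro w hw hlw
      simp [Store.write_apply, hl w hw] at hlw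
      simp [hns, hw, hlw]
    · refine (Finset.card_filter_le _ _).trans ?_
      simpa using hG.degree_le u
    · intro i hi
      omega
    · intro u' hu'
      simp [Store.write_apply, hf 7 rfl, hf 8 rfl, hf 9 rfl, hf 10 rfl]
    · obtain ⟨a1, a2, a3, a4, a5⟩ := hw a ha
      rw [Store.write_of_ne _ _ _ _ a1, Store.write_of_ne _ _ _ _ a2,
        Store.write_of_ne _ _ _ _ a3, Store.write_of_ne _ _ _ _ a4, hf a a5]
  · rintro j τ' ⟨h1, h2, h3, hf'⟩ hne
    rw [Term.eval_var, h1.width_eq] at hne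
    have e5 : τ' rColor = σ rColor := hf' 5 rfl
    refine ⟨div_two_pow_ne_zero_iff.1 hne, ((runs_levelProg (n := n) (d := d) (N := N) (u := u)
      (j := j) (ns := ns) ?_ ?_ hN hnB hXB hdB ?_ (Finset.filter_subset _ _) ?_ ?_ ?_ hne
      ?_).frame.mono ?_)⟩
    · rw [hf' 0 rfl, hG.order_eq]
    · rw [hf' 20 rfl, hX]
    · rw [e5]; exact hχ
    · rw [e5]
      intro v hv w hw hvw
      by_contra hne'
      rw [hns, Finset.coe_filter] at hv hw
      exact hinj v w hne' hv.2 hw.2 hvw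
    · rw [hf' 40 rfl, hu]
    · rw [hf' 4 rfl]
      exact hh _ (Nat.div_le_self _ _)
    · rw [e5]; exact h1
    · rintro τ₂ ⟨⟨h4, h5⟩, hf₂⟩
      refine ⟨by rw [← e5]; exact h4, h5.trans h2, div_two_pow_ne_zero_iff.1 hne, fun a ha => ?_⟩
      rw [hf₂ a ?_, hf' a ha]
      simp only [vertexProg, Program.writes, Bool.or_eq_false_iff] at ha
      exact ha.2.2.2.2.2
  · rintro j τ' ⟨h1, h2, h3, hf'⟩ hz
    rw [Term.eval_var, h1.width_eq] at hz
    -- At width zero no neighbour is left without a slot, since the number of live ones is at most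
    -- `d / 2 ^ j`.
    have hzero : ∀ w ∈ ns, τ' rLive 0 w = 0 := by
      intro w hw
      by_contra hne
      have := h1.card_le
      rw [hz, Nat.le_zero, Finset.card_eq_zero, Finset.filter_eq_empty_iff] at this
      exact this hw hne
    have hj : j = Nat.size d := by
      have := mt (div_two_pow_ne_zero_iff (x := d) (i := j)).2 (by simpa using hz)
      omega
    subst hj
    refine ⟨⟨h1.seed_lt, fun w hw => ?_, fun w hw w' hw' hs => ?_, fun w hw => ?_⟩, h2⟩
    · have h4 := h1.state.slot_lt w hw (hzero w hw)
      have h5 := h1.state.card_eq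
      have h6 := hG.degree_le u
      rw [← hns] at h6
      omega
    · exact h1.state.slot_inj w hw w' hw' (hzero w hw) (hzero w' hw') hs
    · exact h1.state.hit w hw (hzero w hw)

/-- Construct the hash tables of all vertices. -/
def tablesProg : Program := .forLoop 40 .order vertexProg

theorem runs_tablesProg {n d N : ℕ} (hG : GraphStore σ n d)
    (hX : σ rBound 0 0 = 2 * N) (hN : 0 < N) (hnB : n ≤ B) (hXB : 2 * N * (2 * N) ≤ B)
    (hdB : 4 * d ≤ B) (hχ : ∀ w < n, σ rColor 0 w < N)
    (hinj : ∀ u v w, v ≠ w → σ 1 u v ≠ 0 → σ 1 u w ≠ 0 → σ rColor 0 v ≠ σ rColor 0 w)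
    (hh : ∀ y ≤ d, σ rHalf 0 y = y / 2) (h0 : σ rTable = 0) :
    Runs B tablesProg σ fun τ => ∀ u < n, Hashed d (2 * N) {w ∈ Finset.range n | σ 1 u w ≠ 0}
      (σ rColor 0) (τ rSeedM u) (τ rSeedA u) (τ rTable u) (τ rSlot u) := by
  refine Runs.forLoop (fun i τ => (∀ u < i, Hashed d (2 * N) {w ∈ Finset.range n | σ 1 u w ≠ 0}
      (σ rColor 0) (τ rSeedM u) (τ rSeedA u) (τ rTable u) (τ rSlot u)) ∧
      ∀ u, i ≤ u → ∀ p, τ rTable u p = 0) n hnB rfl ?_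
    (fun i τ hf _ => by simp [hf 0 rfl, hG.order_eq]) ?_ (fun τ hf hI => hI.1)
  · simp [Store.write_apply, h0]
  rintro u hu τ hf hu40 ⟨h1, h2⟩
  have e1 : τ 1 = σ 1 := hf 1 rfl
  have e5 : τ rColor = σ rColor := hf 5 rfl
  refine (runs_vertexProg (N := N) (hG.congr (hf 0 rfl) e1) (by rw [hf 20 rfl, hX]) hN hnB hXB hdB
    (by rw [e5]; exact hχ) (by rw [e1, e5]; exact hinj u) hu40 (by rw [hf 4 rfl]; exact hh)
    (h2 u le_rfl)).mono ?_
  rintro τ' ⟨h3, h4⟩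
  rw [e1, e5] at h3
  simp only [Store.write_apply]
  simp
  refine ⟨fun u' hu' => ?_, fun u' hu' p => ?_⟩
  · rcases Nat.lt_succ_iff_lt_or_eq.1 (Nat.lt_succ_of_le hu') with h | rfl
    · obtain ⟨a, b, c, e⟩ := h4 u' h.ne
      rw [a, b, c, e]
      simpa using h1 u' h
    · simpa using h3
  · rw [(h4 u' (by omega)).2.2.1]
    exact h2 u' (by omega) p

end Ram

namespace Ram

/-! ## Writing the labels -/

variable {B : ℕ} {σ : Store}

/-- Write the binary expansion of the variable `rY` to the output. -/
def writeNumProg : Program :=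
  .forLoop 42 (.var rLen) <|
    -- The parity of `y` is `y - y / 2 - y / 2`.
    .seq (.assign 3 (.var 40) (.var rPtr)
      (.sub (.sub (.var rY) (.arr rHalf (.var rY))) (.arr rHalf (.var rY)))) <|
    .seq (.set rY (.arr rHalf (.var rY))) <|
    .set rPtr (.add (.var rPtr) (.lit 1))

theorem runs_writeNumProg {u L p y : ℕ} (hu : σ 40 0 0 = u) (hL : σ rLen 0 0 = L)
    (hp : σ rPtr 0 0 = p) (hy : σ rY 0 0 = y) (hh : ∀ z ≤ y, σ rHalf 0 z = z / 2) (hB : L ≤ B) :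
    Runs B writeNumProg σ fun τ => τ rPtr 0 0 = p + L ∧
      (∀ b < L, τ 3 u (p + b) = y / 2 ^ b % 2) ∧ (∀ i < p, τ 3 u i = σ 3 u i) ∧
      ∀ u', u' ≠ u → τ 3 u' = σ 3 u' := by
  refine Runs.forLoop (fun l τ => τ rPtr 0 0 = p + l ∧ τ rY 0 0 = y / 2 ^ l ∧
      (∀ b < l, τ 3 u (p + b) = y / 2 ^ b % 2) ∧ (∀ i < p, τ 3 u i = σ 3 u i) ∧
      ∀ u', u' ≠ u → τ 3 u' = σ 3 u') L hB rfl (by simp [Store.write_apply, hp, hy])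
    (fun i τ hf _ => by simp [hf 31 rfl, hL]) ?_ (fun τ hf hI => ⟨hI.1, hI.2.2⟩)
  rintro l hl τ hf h42 ⟨h1, h2, h3, h4, h5⟩
  have e40 : τ 40 0 0 = u := by rw [hf 40 rfl, hu]
  have e4 : τ rHalf 0 (y / 2 ^ l) = y / 2 ^ l / 2 := by
    rw [hf 4 rfl]; exact hh _ (Nat.div_le_self _ _)
  refine .seq (.assign (.seq (.set (.set ?_))))
  simp only [Store.write_apply]
  simp [Store.write_apply, h1, h2, e40, e4]
  refine ⟨by omega, by rw [pow_succ, Nat.div_div_eq_div_mul], fun b hb => ?_, fun i hi => ?_,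
    fun u' hu' => by simp [hu', h5 u' hu']⟩
  · rcases Nat.lt_succ_iff_lt_or_eq.1 (Nat.lt_succ_of_le hb) with hb | rfl
    · rw [Function.update_of_ne (by omega), h3 b hb]
    · rw [Function.update_self]; omega
  · rw [Function.update_of_ne (by omega), h4 i hi]

/-- Write the colours, the seeds and the hash tables to the output, from position
`k₂ * d` on. -/
def extrasProg (k₂ : ℕ) : Program :=
  .forLoop 40 .order <|
    .seq (.set rPtr (.nmul k₂ .deg)) <|
    .seq (.set rY (.arr rColor (.var 40))) <|
    .seq writeNumProg <|
    .seq (.forLoop 41 (.var rLevels) <|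
      .seq (.set rY (.cell rSeedM (.var 40) (.var 41))) <|
      .seq writeNumProg <|
      .seq (.set rY (.cell rSeedA (.var 40) (.var 41)))
      writeNumProg) <|
    .forLoop 41 (.nmul 8 .deg) <|
      .seq (.assign 3 (.var 40) (.var rPtr) (.cell rTable (.var 40) (.var 41))) <|
      .set rPtr (.add (.var rPtr) (.lit 1))

/-- The sequence `f` consists of the colour `x`, the seeds and the table `bm`. -/
structure Encodes (d L J : ℕ) (f : ℕ → ℕ) (x : ℕ) (sm sa bm : ℕ → ℕ) : Prop where
  color : ∀ b < L, f b = x / 2 ^ b % 2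
  seedM : ∀ j < J, ∀ b < L, f (L * (1 + 2 * j) + b) = sm j / 2 ^ b % 2
  seedA : ∀ j < J, ∀ b < L, f (L * (2 + 2 * j) + b) = sa j / 2 ^ b % 2
  table : ∀ t < 8 * d, f (L * (1 + 2 * J) + t) = bm t

/-- All numbers are written with the same length `L`, so every block has a known offset: block `0`
is the colour, blocks `1 + 2 * j` and `2 + 2 * j` are the seed of level `j`, and the table starts at
block `1 + 2 * J`. -/
theorem runs_extrasProg (k₂ : ℕ) {n d L J X : ℕ} (hn : σ 0 0 0 = n) (hd : σ 0 0 1 = d)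
    (hL : σ rLen 0 0 = L) (hJ : σ rLevels 0 0 = J) (hnB : n ≤ B) (hLB : L ≤ B) (hJB : J ≤ B)
    (hdB : 8 * d ≤ B) (hh : ∀ z ≤ X, σ rHalf 0 z = z / 2) (hχ : ∀ u < n, σ rColor 0 u ≤ X)
    (hs : ∀ u < n, ∀ j < J, σ rSeedM u j ≤ X ∧ σ rSeedA u j ≤ X) :
    Runs B (extrasProg k₂) σ fun τ => ∀ u < n, Encodes d L J (fun i => τ 3 u (k₂ * d + i))
      (σ rColor 0 u) (σ rSeedM u) (σ rSeedA u) (σ rTable u) := by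
  refine Runs.forLoop (fun i τ => ∀ u < i, Encodes d L J (fun i => τ 3 u (k₂ * d + i))
      (σ rColor 0 u) (σ rSeedM u) (σ rSeedA u) (σ rTable u)) n hnB rfl (by simp)
    (fun i τ hf _ => by simp [hf 0 rfl, hn]) ?_ (fun τ hf hI => hI)
  rintro u hu τ hf hu40 hI
  have e0 : τ 0 = σ 0 := hf 0 rfl
  have e4 : τ rHalf = σ rHalf := hf 4 rfl
  have e5 : τ rColor = σ rColor := hf 5 rfl
  have e7 : τ rSeedM = σ rSeedM := hf 7 rfl
  have e8 : τ rSeedA = σ rSeedA := hf 8 rfl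
  have e9 : τ rTable = σ rTable := hf 9 rfl
  have eL : τ rLen 0 0 = L := by rw [hf 31 rfl, hL]
  have eJ : τ rLevels 0 0 = J := by rw [hf 32 rfl, hJ]
  clear hf
  set p := k₂ * d with hp
  refine .seq (.set (.seq (.set (.seq ((runs_writeNumProg (u := u) (L := L) (p := p)
    (y := σ rColor 0 u) ?_ ?_ ?_ ?_ ?_ hLB).frame.mono ?_)))))
  · simpa [Store.write_apply] using hu40
  · simpa [Store.write_apply] using eL
  · simp [Store.write_apply, e0, hd, hp]
  · simp [Store.write_apply, e5, hu40]
  · intro z hz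
    simpa [Store.write_apply, e4] using hh z (hz.trans (hχ u hu))
  rintro τ₁ ⟨⟨h1, h2, -, h3⟩, hf₁⟩
  have f0 : τ₁ 0 = σ 0 := by rw [hf₁ 0 rfl]; simp [Store.write_of_ne, e0]
  have f4 : τ₁ rHalf = σ rHalf := by rw [hf₁ 4 rfl]; simp [Store.write_of_ne, e4]
  have f7 : τ₁ rSeedM = σ rSeedM := by rw [hf₁ 7 rfl]; simp [Store.write_of_ne, e7]
  have f8 : τ₁ rSeedA = σ rSeedA := by rw [hf₁ 8 rfl]; simp [Store.write_of_ne, e8]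
  have f9 : τ₁ rTable = σ rTable := by rw [hf₁ 9 rfl]; simp [Store.write_of_ne, e9]
  have fL : τ₁ rLen 0 0 = L := by rw [hf₁ 31 rfl]; simpa [Store.write_apply] using eL
  have fJ : τ₁ rLevels 0 0 = J := by rw [hf₁ 32 rfl]; simpa [Store.write_apply] using eJ
  have f40 : τ₁ 40 0 0 = u := by rw [hf₁ 40 rfl]; simpa [Store.write_apply] using hu40
  have f3 : ∀ u', u' ≠ u → τ₁ 3 u' = τ 3 u' := fun u' hu' => by
    rw [h3 u' hu']; simp [Store.write_apply]
  clear hf₁ h3 e0 e4 e5 e7 e8 e9 eL eJ hu40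
  refine .seq ((Runs.forLoop (fun j τ' => τ' rPtr 0 0 = p + L * (1 + 2 * j) ∧
    (∀ b < L, τ' 3 u (p + b) = σ rColor 0 u / 2 ^ b % 2) ∧
    (∀ j' < j, ∀ b < L, τ' 3 u (p + (L * (1 + 2 * j') + b)) = σ rSeedM u j' / 2 ^ b % 2) ∧
    (∀ j' < j, ∀ b < L, τ' 3 u (p + (L * (2 + 2 * j') + b)) = σ rSeedA u j' / 2 ^ b % 2) ∧
    (∀ u', u' ≠ u → τ' 3 u' = τ 3 u')) J hJB rfl ?_
    (fun i τ' hf' _ => by simp [hf' 32 rfl, fJ]) ?_ (fun τ' hf' hI' => hI')).frame.mono ?_)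
  · simp [Store.write_apply, h1]
    exact ⟨h2, f3⟩
  · rintro j hj τ₂ hf₂ hj41 ⟨h4, h5, h6, h7, h8⟩
    have g4 : τ₂ rHalf = σ rHalf := by rw [hf₂ 4 rfl, f4]
    have g7 : τ₂ rSeedM = σ rSeedM := by rw [hf₂ 7 rfl, f7]
    have g8 : τ₂ rSeedA = σ rSeedA := by rw [hf₂ 8 rfl, f8]
    have gL : τ₂ rLen 0 0 = L := by rw [hf₂ 31 rfl, fL]
    have g40 : τ₂ 40 0 0 = u := by rw [hf₂ 40 rfl, f40]
    refine .seq (.set (.seq ((runs_writeNumProg (u := u) (L := L) (p := p + L * (1 + 2 * j))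
      (y := σ rSeedM u j) ?_ ?_ ?_ ?_ ?_ hLB).frame.mono ?_)))
    · simpa [Store.write_apply] using g40
    · simpa [Store.write_apply] using gL
    · simpa [Store.write_apply] using h4
    · simp [Store.write_apply, g40, hj41, g7]
    · intro z hz
      simpa [Store.write_apply, g4] using hh z (hz.trans (hs u hu j hj).1)
    rintro τ₃ ⟨⟨k1, k2, k3, k4⟩, hf₃⟩
    have i4 : τ₃ rHalf = σ rHalf := by rw [hf₃ 4 rfl]; simp [Store.write_of_ne, g4]
    have i8 : τ₃ rSeedA = σ rSeedA := by rw [hf₃ 8 rfl]; simp [Store.write_of_ne, g8]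
    have iL : τ₃ rLen 0 0 = L := by rw [hf₃ 31 rfl]; simpa [Store.write_apply] using gL
    have i40 : τ₃ 40 0 0 = u := by rw [hf₃ 40 rfl]; simpa [Store.write_apply] using g40
    have i41 : τ₃ 41 0 0 = j := by rw [hf₃ 41 rfl]; simpa [Store.write_apply] using hj41
    refine .seq (.set ((runs_writeNumProg (u := u) (L := L) (p := p + L * (1 + 2 * j) + L)
      (y := σ rSeedA u j) ?_ ?_ ?_ ?_ ?_ hLB).mono ?_))
    · simpa [Store.write_apply] using i40
    · simpa [Store.write_apply] using iL
    · simpa [Store.write_apply] using k1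
    · simp [Store.write_apply, i40, i41, i8]
    · intro z hz
      simpa [Store.write_apply, i4] using hh z (hz.trans (hs u hu j hj).2)
    rintro τ₄ ⟨l1, l2, l3, l4⟩
    simp [Store.write_apply] at k3 k4 l3 l4
    simp only [Store.write_apply]
    simp
    have hL' : ∀ j' ≤ j, ∀ b < L, L * (1 + 2 * j') + b < L * (1 + 2 * j) + L := by
      intro j' hj' b hb
      have : L * (1 + 2 * j') ≤ L * (1 + 2 * j) := Nat.mul_le_mul_left _ (by omega)
      omega
    have hL'' : ∀ j' < j, ∀ b < L, L * (2 + 2 * j') + b < L * (1 + 2 * j) := by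
      intro j' hj' b hb
      have : L * (2 + 2 * j') + L ≤ L * (1 + 2 * j) := by
        rw [← Nat.mul_succ]; exact Nat.mul_le_mul_left _ (by omega)
      omega
    refine ⟨by rw [l1]; ring, fun b hb => ?_, fun j' hj' b hb => ?_, fun j' hj' b hb => ?_,
      fun u' hu' => ?_⟩
    · have : L ≤ L * (1 + 2 * j) := Nat.le_mul_of_pos_right _ (by omega)
      rw [l3 _ (by omega), k3 _ (by omega), h5 b hb]
    · have := hL' j' (by omega) b hb
      rw [l3 _ (by omega)]
      rcases Nat.lt_succ_iff_lt_or_eq.1 (Nat.lt_succ_of_le hj') with h | rfl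
      · have : L * (1 + 2 * j') + L ≤ L * (1 + 2 * j) := by
          rw [← Nat.mul_succ]; exact Nat.mul_le_mul_left _ (by omega)
        rw [k3 _ (by omega), h6 j' h b hb]
      · rw [← add_assoc, k2 b hb]
    · rcases Nat.lt_succ_iff_lt_or_eq.1 (Nat.lt_succ_of_le hj') with h | rfl
      · have := hL'' j' h b hb
        rw [l3 _ (by omega), k3 _ (by omega), h7 j' h b hb]
      · rw [show p + (L * (2 + 2 * j') + b) = p + L * (1 + 2 * j') + L + b by ring, l2 b hb]
    · rw [l4 u' hu', k4 u' hu', h8 u' hu']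
  rintro τ₂ ⟨⟨h4, h5, h6, h7, h8⟩, hf₂⟩
  have g0 : τ₂ 0 = σ 0 := by rw [hf₂ 0 rfl, f0]
  have g9 : τ₂ rTable = σ rTable := by rw [hf₂ 9 rfl, f9]
  have g40 : τ₂ 40 0 0 = u := by rw [hf₂ 40 rfl, f40]
  refine Runs.forLoop (fun t τ' => τ' rPtr 0 0 = p + L * (1 + 2 * J) + t ∧
    (∀ t' < t, τ' 3 u (p + L * (1 + 2 * J) + t') = σ rTable u t') ∧
    (∀ i < p + L * (1 + 2 * J), τ' 3 u i = τ₂ 3 u i) ∧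
    (∀ u', u' ≠ u → τ' 3 u' = τ 3 u')) (8 * d) hdB rfl ?_
    (fun i τ' hf' _ => by simp [hf' 0 rfl, g0, hd]) ?_ ?_
  · simp [Store.write_apply, h4]
    exact h8
  · rintro t ht τ₃ hf₃ ht41 ⟨k1, k2, k3, k4⟩
    have i9 : τ₃ rTable = σ rTable := by rw [hf₃ 9 rfl, g9]
    have i40 : τ₃ 40 0 0 = u := by rw [hf₃ 40 rfl, g40]
    refine .seq (.assign (.set ?_))
    simp only [Store.write_apply]
    simp [Store.write_apply, k1, i40, ht41, i9]
    refine ⟨by omega, fun t' ht' => ?_, fun i hi => ?_, fun u' hu' => by simp [hu', k4 u' hu']⟩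
    · rcases Nat.lt_succ_iff_lt_or_eq.1 (Nat.lt_succ_of_le ht') with h | rfl
      · rw [Function.update_of_ne (by omega), k2 t' h]
      · rw [Function.update_self]
    · rw [Function.update_of_ne (by omega), k3 i hi]
  · rintro τ₃ hf₃ ⟨k1, k2, k3, k4⟩ u' hu'
    simp only [Store.write_apply]
    simp
    rcases Nat.lt_succ_iff_lt_or_eq.1 hu' with h | rfl
    · rw [k4 u' h.ne]
      exact hI u' h
    · have hlt : ∀ j < J, ∀ b < L, L * (2 + 2 * j) + b < L * (1 + 2 * J) := by
        intro j hj b hb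
        have : L * (2 + 2 * j) + L ≤ L * (1 + 2 * J) := by
          rw [← Nat.mul_succ]; exact Nat.mul_le_mul_left _ (by omega)
        omega
      refine ⟨fun b hb => ?_, fun j hj b hb => ?_, fun j hj b hb => ?_, fun t ht => ?_⟩
      · have : L ≤ L * (1 + 2 * J) := Nat.le_mul_of_pos_right _ (by omega)
        rw [k3 _ (by omega), h5 b hb]
      · have h1 := hlt j hj b hb
        have h2 : L * (1 + 2 * j) ≤ L * (2 + 2 * j) := Nat.mul_le_mul_left _ (by omega)
        rw [k3 _ (by omega), h6 j hj b hb]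
      · have h1 := hlt j hj b hb
        rw [k3 _ (by omega), h7 j hj b hb]
      · rw [← add_assoc, k2 t ht]

end Ram

namespace Ram

/-! ## Random bits -/

variable {B : ℕ} {σ : Store}

/-- Copy the random bits to the first `k₂ * d` positions of the labels. -/
def randProg (k₂ : ℕ) : Program :=
  .seq (.set rPtr (.lit 0)) <|
  .forLoop 40 .order <| .forLoop 41 (.nmul k₂ .deg) <|
    .seq (.assign 3 (.var 40) (.var 41) (.cell 2 (.lit 0) (.var rPtr))) <|
    .set rPtr (.add (.var rPtr) (.lit 1))

/-- Each vertex consumes a fresh stretch of `k₂ * d` random bits, so the bits of different vertices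
are independent. -/
theorem runs_randProg (k₂ : ℕ) {n d : ℕ} (hn : σ 0 0 0 = n) (hd : σ 0 0 1 = d) (hnB : n ≤ B)
    (hdB : k₂ * d ≤ B) :
    Runs B (randProg k₂) σ fun τ => (∀ u < n, ∀ i < k₂ * d, τ 3 u i = σ 2 0 (u * (k₂ * d) + i)) ∧
      ∀ u i, k₂ * d ≤ i → τ 3 u i = σ 3 u i := by
  refine .seq (.set ?_)
  refine Runs.forLoop (fun v τ => τ rPtr 0 0 = v * (k₂ * d) ∧
      (∀ u < v, ∀ i < k₂ * d, τ 3 u i = σ 2 0 (u * (k₂ * d) + i)) ∧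
      ∀ u i, k₂ * d ≤ i → τ 3 u i = σ 3 u i) n hnB rfl (by simp [Store.write_apply])
    (fun i τ hf _ => by simp [hf 0 rfl, hn, Store.write_apply]) ?_ (fun τ hf hI => hI.2)
  rintro v hv τ hf h40 ⟨h1, h2, h3⟩
  have e0 : τ 0 = σ 0 := by rw [hf 0 rfl]; simp [Store.write_of_ne]
  have e2 : τ 2 = σ 2 := by rw [hf 2 rfl]; simp [Store.write_of_ne]
  clear hf
  refine Runs.forLoop (fun j τ' => τ' rPtr 0 0 = v * (k₂ * d) + j ∧
      (∀ u < v, ∀ i < k₂ * d, τ' 3 u i = σ 2 0 (u * (k₂ * d) + i)) ∧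
      (∀ i < j, τ' 3 v i = σ 2 0 (v * (k₂ * d) + i)) ∧
      ∀ u i, k₂ * d ≤ i → τ' 3 u i = σ 3 u i) (k₂ * d) hdB rfl ?_
    (fun i τ' hf' _ => by simp [hf' 0 rfl, hd, e0]) ?_ ?_
  · simp [Store.write_apply, h1]
    exact ⟨h2, h3⟩
  · rintro j hj τ' hf' h41 ⟨k1, k2, k3, k4⟩
    have f40 : τ' 40 0 0 = v := by rw [hf' 40 rfl, h40]
    have f2 : τ' 2 = σ 2 := by rw [hf' 2 rfl, e2]
    refine .seq (.assign (.set ?_))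
    simp only [Store.write_apply]
    simp [Store.write_apply, k1, f40, h41, f2]
    refine ⟨by omega, fun u hu i hi => by simp [hu.ne, k2 u hu i hi], fun i hi => ?_,
      fun u i hi => ?_⟩
    · rcases Nat.lt_succ_iff_lt_or_eq.1 (Nat.lt_succ_of_le hi) with h | rfl
      · rw [Function.update_of_ne (by omega), k3 i h]
      · rw [Function.update_self]
    · split_ifs with h
      · rw [Function.update_of_ne (by omega), ← h, k4 u i hi]
      · exact k4 u i hi
  · rintro τ' hf' ⟨k1, k2, k3, k4⟩
    simp only [Store.write_apply]
    simp
    refine ⟨by rw [k1]; ring, fun u hu i hi => ?_, k4⟩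
    rcases Nat.lt_succ_iff_lt_or_eq.1 (Nat.lt_succ_of_le hu) with h | rfl
    · exact k2 u h i hi
    · exact k3 i hi

/-! ## Case distinctions and constants -/

/-- Run `F l`, where `l` tells which of the terms are nonzero. -/
def Program.branch : List Term → (List Bool → Program) → Program
  | [], F => F []
  | e :: es, F => .ite e (branch es fun l => F (true :: l)) (branch es fun l => F (false :: l))

/-- Unrolls a function of finitely many bits into a decision tree. In this way multiplication in the
field is hard-wired into the program, whose text depends on `k` but not on `d` or the graph. -/
theorem Runs.branch {Q : Store → Prop} (es : List Term) {F : List Bool → Program}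
    (h : Runs B (F (es.map fun e => decide (e.eval σ ≠ 0))) σ Q) :
    Runs B (.branch es F) σ Q := by
  induction es generalizing F with
  | nil => exact h
  | cons e es ih =>
    refine .ite (fun he => ih ?_) (fun he => ih ?_)
    · simpa [he] using h
    · simpa [he] using h

theorem writes_branch {a : ℕ} (es : List Term) {F : List Bool → Program}
    (h : ∀ l, (F l).writes a = false) : (Program.branch es F).writes a = false := by
  induction es generalizing F with
  | nil => exact h _
  | cons e es ih =>
    rw [Program.branch, Program.writes, ih fun l => h _, ih fun l => h _, Bool.or_self]

/-- Write a list of bits to row `i` of the output, from column `e` on. -/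
def writeBits (i : Term) : Term → List Bool → Program
  | _, [] => .skip
  | e, b :: l => .seq (.assign 3 i e (.lit b.toNat)) (writeBits i (.add e (.lit 1)) l)

theorem writes_writeBits {a : ℕ} (ha : a ≠ 3) (i e : Term) (l : List Bool) :
    (writeBits i e l).writes a = false := by
  induction l generalizing e with
  | nil => rfl
  | cons b l ih => simp [writeBits, Program.writes, ih, ha]

theorem runs_writeBits {i e : Term} (hi : i.reads 3 = false) (he : e.reads 3 = false)
    (l : List Bool) :
    Runs B (writeBits i e l) σ fun τ =>
      (∀ t (h : t < l.length), τ 3 (i.eval σ) (e.eval σ + t) = l[t].toNat) ∧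
      (∀ c, (c < e.eval σ ∨ e.eval σ + l.length ≤ c) →
        τ 3 (i.eval σ) c = σ 3 (i.eval σ) c) ∧
      ∀ u, u ≠ i.eval σ → τ 3 u = σ 3 u := by
  induction l generalizing e σ with
  | nil => exact .skip (by simp)
  | cons b l ih =>
    refine .seq (.assign ((ih (e := .add e (.lit 1)) (by simp [Term.reads, he])).mono ?_))
    rintro τ ⟨h1, h2, h3⟩
    simp only [Term.eval_add, Term.eval_write hi, Term.eval_write he, Term.eval_lit] at h1 h2 h3
    refine ⟨fun t ht => ?_, fun c hc => ?_, fun u hu => ?_⟩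
    · cases t with
      | zero =>
        rw [h2 _ (by omega)]
        simp [Store.write_apply]
      | succ t =>
        have := h1 t (by simpa using ht)
        rw [show e.eval σ + 1 + t = e.eval σ + (t + 1) by ring] at this
        simpa using this
    · rw [List.length_cons] at hc
      rw [h2 c (by omega), Store.write_apply, if_pos ⟨rfl, rfl⟩, Function.update_of_ne (by omega)]
    · rw [h3 u hu, Store.write_apply, if_neg fun h => hu h.2]

/-! ## The larger ends of the edges -/

variable {k : ℕ}

theorem reads_nmul {e : Term} {a : ℕ} (h : e.reads a = false) (c : ℕ) :
    (Term.nmul c e).reads a = false := by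
  induction c with
  | zero => rfl
  | succ c ih => simp [Term.nmul, Term.reads, ih, h]

/-- The first position of the slot of the vertex `i` for the vertex `j`. -/
def slotTerm (k i j : ℕ) : Term := .nmul (2 * k) (.cell rSlot (.var i) (.var j))

/-- The terms for `k` consecutive entries of row `i` of the output, from column `e` on. -/
def bitTerms (k i : ℕ) (e : Term) : List Term :=
  List.ofFn fun b : Fin k => .cell 3 (.var i) (.add e (.lit b))

/-- If the vertices `41` and `40` are adjacent, compute the second half of the slot of `40`
for `41`. -/
def edgeProg (g : (Fin k → Bool) → (Fin k → Bool) → (Fin k → Bool) → (Fin k → Bool)) : Program :=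
  .ite (.cell 1 (.var 40) (.var 41))
    (.branch (bitTerms k 41 (slotTerm k 41 40)) fun l₁ =>
      .branch (bitTerms k 40 (slotTerm k 40 41)) fun l₂ =>
      .branch (bitTerms k 41 (.add (slotTerm k 41 40) (.lit k))) fun l₃ =>
      writeBits (.var 40) (.add (slotTerm k 40 41) (.lit k)) <|
        List.ofFn (g (fun b => l₁.getD b false) (fun b => l₂.getD b false)
          fun b => l₃.getD b false))
    .skip

/-- For every edge, compute the second half of the slot of the larger end. -/
def fixProg (g : (Fin k → Bool) → (Fin k → Bool) → (Fin k → Bool) → (Fin k → Bool)) : Program :=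
  .forLoop 40 .order <| .forLoop 41 (.var 40) <| edgeProg g

theorem writes_edgeProg (g : (Fin k → Bool) → (Fin k → Bool) → (Fin k → Bool) → (Fin k → Bool))
    {a : ℕ} (h : a ≠ 3) : (edgeProg g).writes a = false := by
  simp only [edgeProg, Program.writes, Bool.or_false]
  exact writes_branch _ fun _ => writes_branch _ fun _ => writes_branch _ fun _ =>
    writes_writeBits h _ _ _

theorem writes_forLoop {v a : ℕ} {e : Term} {P : Program} (hv : a ≠ v)
    (hP : P.writes a = false) : (Program.forLoop v e P).writes a = false := by
  simp [Program.forLoop, Program.writes, Program.set, hv, hP]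

theorem writes_fixProg (g : (Fin k → Bool) → (Fin k → Bool) → (Fin k → Bool) → (Fin k → Bool))
    {a : ℕ} (h : a ≠ 3) (h40 : a ≠ 40) (h41 : a ≠ 41) : (fixProg g).writes a = false :=
  writes_forLoop h40 (writes_forLoop h41 (writes_edgeProg g h))

theorem map_bitTerms (τ : Store) (i : ℕ) (e : Term) :
    (fun b : Fin k => ((bitTerms k i e).map fun e' => decide (e'.eval τ ≠ 0)).getD b false) =
      fun b : Fin k => decide (τ 3 (τ i 0 0) (e.eval τ + b) ≠ 0) := by
  funext b
  simp [bitTerms, List.getD]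
  rfl

/-- `k` consecutive entries of a row. -/
def bitsAt (k : ℕ) (row : ℕ → ℕ) (p : ℕ) : Fin k → Bool := fun b => decide (row (p + b) ≠ 0)

/-- The right-hand side refers to the initial memory `σ` although the program overwrites its data.
This is legitimate: for an edge `u < w` it reads two first halves, which are never overwritten, and
the second half at `u`, which belongs to a slot whose other end is larger and so keeps its initial
value. Injectivity of the slots excludes interference with other edges. -/
theorem runs_fixProg (g : (Fin k → Bool) → (Fin k → Bool) → (Fin k → Bool) → (Fin k → Bool))
    {n d : ℕ} (hG : GraphStore σ n d) (hnB : n ≤ B)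
    (hinj : ∀ u v w, v ≠ w → σ 1 u v ≠ 0 → σ 1 u w ≠ 0 → σ rSlot u v ≠ σ rSlot u w) :
    Runs B (fixProg g) σ fun τ => ∀ w < n,
      (∀ u < w, σ 1 w u ≠ 0 → ∀ b : Fin k, τ 3 w (2 * k * σ rSlot w u + k + b) =
        (g (bitsAt k (σ 3 u) (2 * k * σ rSlot u w)) (bitsAt k (σ 3 w) (2 * k * σ rSlot w u))
          (bitsAt k (σ 3 u) (2 * k * σ rSlot u w + k)) b).toNat) ∧
      ∀ i, (∀ u < w, σ 1 w u ≠ 0 → ∀ b < k, i ≠ 2 * k * σ rSlot w u + k + b) →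
        τ 3 w i = σ 3 w i := by
  -- entries of different slots, or of different halves, are different
  have hne : ∀ s s' b b', s ≠ s' → b < 2 * k → b' < 2 * k →
      2 * k * s + b ≠ 2 * k * s' + b' := by
    intro s s' b b' hs hb hb' h
    have h1 := congrArg (· / (2 * k)) h
    have hk : 0 < 2 * k := by omega
    simp only [Nat.mul_add_div hk, Nat.div_eq_of_lt hb, Nat.div_eq_of_lt hb'] at h1
    omega
  have hwr : ∀ {a : ℕ}, a ≠ 3 → a ≠ 40 → a ≠ 41 → (fixProg g).writes a = false :=
    writes_fixProg g
  refine Runs.forLoop (fun v τ => (∀ w < v,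
      (∀ u < w, σ 1 w u ≠ 0 → ∀ b : Fin k, τ 3 w (2 * k * σ rSlot w u + k + b) =
        (g (bitsAt k (σ 3 u) (2 * k * σ rSlot u w)) (bitsAt k (σ 3 w) (2 * k * σ rSlot w u))
          (bitsAt k (σ 3 u) (2 * k * σ rSlot u w + k)) b).toNat) ∧
      ∀ i, (∀ u < w, σ 1 w u ≠ 0 → ∀ b < k, i ≠ 2 * k * σ rSlot w u + k + b) →
        τ 3 w i = σ 3 w i) ∧ ∀ w, v ≤ w → τ 3 w = σ 3 w) n hnB ?_ ?_ ?_ ?_ (fun τ hf hI => hI.1)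
  · exact writes_forLoop (by decide) (writes_edgeProg g (by decide))
  · simp [Store.write_apply]
  · intro i τ hf _
    simp [hf 0 (hwr (by decide) (by decide) (by decide)), hG.order_eq]
  rintro w hw τ hf h40 ⟨h1, h2⟩
  have e1 : τ 1 = σ 1 := hf 1 (hwr (by decide) (by decide) (by decide))
  have e10 : τ rSlot = σ rSlot := hf 10 (hwr (by decide) (by decide) (by decide))
  clear hf
  have hin : ∀ {a : ℕ}, a ≠ 3 → a ≠ 41 →
      (Program.forLoop 41 (.var 40) (edgeProg g)).writes a = false :=
    fun h3 h41 => writes_forLoop h41 (writes_edgeProg g h3)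
  refine Runs.forLoop (fun v τ' =>
      (∀ u < v, σ 1 w u ≠ 0 → ∀ b : Fin k, τ' 3 w (2 * k * σ rSlot w u + k + b) =
        (g (bitsAt k (σ 3 u) (2 * k * σ rSlot u w)) (bitsAt k (σ 3 w) (2 * k * σ rSlot w u))
          (bitsAt k (σ 3 u) (2 * k * σ rSlot u w + k)) b).toNat) ∧
      (∀ i, (∀ u < v, σ 1 w u ≠ 0 → ∀ b < k, i ≠ 2 * k * σ rSlot w u + k + b) →
        τ' 3 w i = σ 3 w i) ∧ ∀ w', w' ≠ w → τ' 3 w' = τ 3 w') w (by omega) ?_ ?_ ?_ ?_ ?_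
  · exact writes_edgeProg g (by decide)
  · simp [Store.write_apply, h2]
  · intro i τ' hf' _
    simp [hf' 40 (hin (by decide) (by decide)), h40]
  · rintro u hu τ' hf' h41 ⟨h3, h4, h5⟩
    have f1 : τ' 1 = σ 1 := by rw [hf' 1 (hin (by decide) (by decide)), e1]
    have f10 : τ' rSlot = σ rSlot := by rw [hf' 10 (hin (by decide) (by decide)), e10]
    have f40 : τ' 40 0 0 = w := by rw [hf' 40 (hin (by decide) (by decide)), h40]
    clear hf'
    refine .ite (fun ha => .branch _ (.branch _ (.branch _ ?_))) (fun ha => .skip ?_)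
    · simp only [Term.eval_cell, Term.eval_var, f40, h41, f1] at ha
      rw [map_bitTerms, map_bitTerms, map_bitTerms]
      have hs1 : (slotTerm k 41 40).eval τ' = 2 * k * σ rSlot u w := by
        simp [slotTerm, f10, f40, h41]
      have hs2 : (slotTerm k 40 41).eval τ' = 2 * k * σ rSlot w u := by
        simp [slotTerm, f10, f40, h41]
      have hau := hG.symm _ _ ha
      -- the relevant entries have not been changed yet
      have hu1 : ∀ b < 2 * k, τ' 3 u (2 * k * σ rSlot u w + b) =
          σ 3 u (2 * k * σ rSlot u w + b) := by
        intro b hb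
        rw [h5 u hu.ne, (h1 u hu).2]
        intro u' hu' ha' b' hb'
        rw [add_assoc]
        exact hne _ _ _ _ (hinj u w u' (by omega) hau ha') hb (by omega)
      have hw1 : ∀ b < k, τ' 3 w (2 * k * σ rSlot w u + b) =
          σ 3 w (2 * k * σ rSlot w u + b) := by
        intro b hb
        rw [h4]
        intro u' hu' ha' b' hb'
        rw [add_assoc]
        exact hne _ _ _ _ (hinj w u u' (by omega) ha ha') (by omega) (by omega)
      have g1 : (fun b : Fin k => decide (τ' 3 (τ' 41 0 0) ((slotTerm k 41 40).eval τ' + b) ≠ 0)) =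
          bitsAt k (σ 3 u) (2 * k * σ rSlot u w) := by
        funext b
        rw [h41, hs1, hu1 b (by omega), bitsAt]
      have g2 : (fun b : Fin k => decide (τ' 3 (τ' 40 0 0) ((slotTerm k 40 41).eval τ' + b) ≠ 0)) =
          bitsAt k (σ 3 w) (2 * k * σ rSlot w u) := by
        funext b
        rw [f40, hs2, hw1 b b.2, bitsAt]
      have g3 : (fun b : Fin k => decide (τ' 3 (τ' 41 0 0)
          ((Term.add (slotTerm k 41 40) (.lit k)).eval τ' + b) ≠ 0)) =
          bitsAt k (σ 3 u) (2 * k * σ rSlot u w + k) := by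
        funext b
        rw [h41, Term.eval_add, hs1, Term.eval_lit, add_assoc, hu1 (k + b) (by omega), bitsAt,
          add_assoc]
      rw [g1, g2, g3]
      refine (runs_writeBits rfl ?_ _).mono ?_
      · simp [Term.reads, slotTerm, reads_nmul, Term.var]
      · rintro τ'' ⟨k1, k2, k3⟩
        simp only [Term.eval_var, f40, Term.eval_add, hs2, Term.eval_lit, List.length_ofFn]
          at k1 k2 k3
        simp only [Store.write_of_ne _ _ _ _ (show (3 : ℕ) ≠ 41 by decide)]
        refine ⟨fun u' hu' ha' b => ?_, fun i hi => ?_, fun w' hw' => by rw [k3 w' hw', h5 w' hw']⟩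
        · rcases Nat.lt_succ_iff_lt_or_eq.1 hu' with h | rfl
          · rw [k2, h3 u' h ha' b]
            -- If the entry for `u'` were overwritten now, it would lie in the second half of the
            -- slot for `u`, and two different slots would overlap.
            by_contra hcon
            push Not at hcon
            refine hne _ _ (k + b) (2 * k * σ rSlot w u' + k + b - (2 * k * σ rSlot w u + k) + k)
              (hinj w u' u (by omega) ha' ha) (by omega) (by omega) (by omega)
          · simpa using k1 b b.2
        · rw [k2, h4]
          · exact fun u' hu' => hi u' (by omega)
          · by_contra hcon
            push Not at hcon
            exact hi u (by omega) ha (i - (2 * k * σ rSlot w u + k)) (by omega) (by omega)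
    · simp only [Term.eval_cell, Term.eval_var, f40, h41, f1] at ha
      simp only [Store.write_of_ne _ _ _ _ (show (3 : ℕ) ≠ 41 by decide)]
      refine ⟨fun u' hu' ha' b => ?_, fun i hi => h4 i fun u' hu' => hi u' (by omega), h5⟩
      rcases Nat.lt_succ_iff_lt_or_eq.1 hu' with h | rfl
      · exact h3 u' h ha' b
      · exact absurd ha ha'
  · rintro τ' hf' ⟨h3, h4, h5⟩
    simp only [Store.write_of_ne _ _ _ _ (show (3 : ℕ) ≠ 40 by decide)]
    refine ⟨fun w' hw' => ?_, fun w' hw' => by rw [h5 w' (by omega), h2 w' (by omega)]⟩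
    rcases Nat.lt_succ_iff_lt_or_eq.1 hw' with h | rfl
    · rw [h5 w' h.ne]
      exact h1 w' h
    · exact ⟨h3, h4⟩

end Ram

/-! ## Reading the slots off the labels -/

/-- The number whose binary expansion is given by `L` bits from position `o` on. -/
def readNum (E : ℕ → Bool) (o L : ℕ) : ℕ := ∑ b ∈ Finset.range L, 2 ^ b * (E (o + b)).toNat

theorem sum_two_pow_mul_bit (x L : ℕ) :
    ∑ b ∈ Finset.range L, 2 ^ b * (x / 2 ^ b % 2) = x % 2 ^ L := by
  induction L with
  | zero => simp [Nat.mod_one]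
  | succ L ih => rw [Finset.sum_range_succ, ih, Nat.mod_pow_succ]

theorem readNum_eq {f : ℕ → ℕ} {o L x : ℕ} (hx : x < 2 ^ L)
    (h : ∀ b < L, f (o + b) = x / 2 ^ b % 2) :
    readNum (fun i => decide (f i ≠ 0)) o L = x := by
  rw [readNum, ← Nat.mod_eq_of_lt hx, ← sum_two_pow_mul_bit]
  refine Finset.sum_congr rfl fun b hb => ?_
  rw [h b (Finset.mem_range.1 hb)]
  rcases Nat.mod_two_eq_zero_or_one (x / 2 ^ b) with h | h <;> simp [h]

/-- The table in the label of a vertex. -/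
def readTable (d : ℕ) (E : ℕ → Bool) (t : ℕ) : ℕ :=
  (E (Nat.size (2 * (d * d + 1)) * (1 + 2 * Nat.size d) + t)).toNat

/-- The positions of the colour of the second label in the table of the first one. -/
def readPos (d : ℕ) (E E' : ℕ → Bool) : ℕ → ℕ :=
  let L := Nat.size (2 * (d * d + 1))
  hashPos d (fun j => readNum E (L * (1 + 2 * j)) L) (fun j => readNum E (L * (2 + 2 * j)) L)
    (readNum E' 0 L)

open Classical in
/-- The slot of a vertex for another one, as a function of their labels. -/
noncomputable def slotIndex (d : ℕ) (E E' : ℕ → Bool) : ℕ :=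
  if h : ∃ i, i < Nat.size d ∧ readTable d E (readPos d E E' i) ≠ 0 then
    onesBelow (readTable d E) (readPos d E E' (Nat.find h))
  else d

namespace Ram

/-- Only the seeds and the table of the first label and the colour of the second one are used. On
all levels the positions read agree with those of the construction and lie below `8 * d`, where the
table is stored. So the first hit, and its rank, are the same. -/
theorem slotIndex_eq {d w : ℕ} {ns : Finset ℕ} {χ sm sa bm slot f f' sm' sa' bm' : ℕ → ℕ}
    (hH : Hashed d (2 * (d * d + 1)) ns χ sm sa bm slot) {x : ℕ}
    (hE : Encodes d (Nat.size (2 * (d * d + 1))) (Nat.size d) f x sm sa bm)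
    (hE' : Encodes d (Nat.size (2 * (d * d + 1))) (Nat.size d) f' (χ w) sm' sa' bm')
    (hw : w ∈ ns) (hχ : χ w < 2 * (d * d + 1)) :
    slotIndex d (fun i => decide (f i ≠ 0)) (fun i => decide (f' i ≠ 0)) = slot w := by
  set E : ℕ → Bool := fun i => decide (f i ≠ 0) with hEdef
  set E' : ℕ → Bool := fun i => decide (f' i ≠ 0) with hEdef'
  have hX : ∀ y < 2 * (d * d + 1), y < 2 ^ Nat.size (2 * (d * d + 1)) :=
    fun y hy => hy.trans (Nat.lt_size_self _)
  have hpos : ∀ i < Nat.size d, readPos d E E' i = hashPos d sm sa (χ w) i := by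
    intro i hi
    simp only [readPos, hashPos]
    rw [readNum_eq (hX _ (hH.seed_lt i hi).1) (hE.seedM i hi),
      readNum_eq (hX _ (hH.seed_lt i hi).2) (hE.seedA i hi),
      readNum_eq (hX _ hχ) (fun b hb => by rw [zero_add]; exact hE'.color b hb)]
  have hlt : ∀ i < Nat.size d, hashPos d sm sa (χ w) i < 8 * d := by
    intro i hi
    have h1 := levelStart_le d (i + 1)
    have h2 := hashVal_lt (m := sm i) (a := sa i) (x := χ w)
      (Nat.pos_of_ne_zero (div_two_pow_ne_zero_iff.2 hi))
    rw [levelStart_succ] at h1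
    simp only [hashPos]
    omega
  have htab : ∀ t < 8 * d, (readTable d E t ≠ 0 ↔ bm t ≠ 0) := by
    intro t ht
    simp only [readTable, hEdef, hE.table t ht]
    by_cases h : bm t = 0 <;> simp [h]
  obtain ⟨i, hi, ⟨h1, h2⟩, h3⟩ := hH.hit w hw
  have hex : ∃ i, i < Nat.size d ∧ readTable d E (readPos d E E' i) ≠ 0 :=
    ⟨i, hi, by rw [hpos i hi, htab _ (hlt i hi)]; exact h1⟩
  rw [slotIndex, dif_pos hex]
  have hfind : Nat.find hex = i := by
    rw [Nat.find_eq_iff]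
    refine ⟨⟨hi, by rw [hpos i hi, htab _ (hlt i hi)]; exact h1⟩, ?_⟩
    rintro i' hi' ⟨hi'', hne⟩
    rw [hpos i' hi'', htab _ (hlt i' hi'')] at hne
    exact hne (h2 i' hi')
  rw [hfind, h3, hpos i hi]
  unfold onesBelow
  congr 1
  refine Finset.filter_congr fun t ht => htab t ?_
  exact (Finset.mem_range.1 ht).trans (hlt i hi)

theorem Encodes.congr {d L J x : ℕ} {f f' sm sa bm : ℕ → ℕ} (h : Encodes d L J f x sm sa bm)
    (hf : ∀ i < L * (1 + 2 * J) + 8 * d, f' i = f i) : Encodes d L J f' x sm sa bm := by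
  have hlt : ∀ j < J, ∀ b < L, L * (2 + 2 * j) + b < L * (1 + 2 * J) := by
    intro j hj b hb
    have : L * (2 + 2 * j) + L ≤ L * (1 + 2 * J) := by
      rw [← Nat.mul_succ]; exact Nat.mul_le_mul_left _ (by omega)
    omega
  refine ⟨fun b hb => ?_, fun j hj b hb => ?_, fun j hj b hb => ?_, fun t ht => ?_⟩
  · have : L ≤ L * (1 + 2 * J) := Nat.le_mul_of_pos_right _ (by omega)
    rw [hf _ (by omega), h.color b hb]
  · have h1 := hlt j hj b hb
    have h2 : L * (1 + 2 * j) ≤ L * (2 + 2 * j) := Nat.mul_le_mul_left _ (by omega)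
    rw [hf _ (by omega), h.seedM j hj b hb]
  · have h1 := hlt j hj b hb
    rw [hf _ (by omega), h.seedA j hj b hb]
  · rw [hf _ (by omega), h.table t ht]

/-- If `2 ^ j ≤ d < 2 ^ (j + 1)`, there are `2 * j + 3` numbers of at most `2 * j + 4` bits,
together at most `16 * 2 ^ j ≤ 16 * d` bits; the tables add `8 * d`. For `d = 0` the colour alone
would exceed the bound. -/
theorem extra_length_le {d : ℕ} (hd : 0 < d) :
    Nat.size (2 * (d * d + 1)) * (1 + 2 * Nat.size d) + 8 * d ≤ 24 * d := by
  obtain ⟨j, hj⟩ : ∃ j, Nat.size d = j + 1 :=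
    Nat.exists_eq_succ_of_ne_zero (Nat.size_pos.2 hd).ne'
  have h1 : 2 ^ j ≤ d := Nat.lt_size.1 (by omega)
  have h2 : d < 2 ^ (j + 1) := hj ▸ Nat.lt_size_self d
  have h3 : Nat.size (2 * (d * d + 1)) ≤ 2 * j + 4 := by
    rw [Nat.size_le, show 2 * j + 4 = (j + 1) + (j + 1) + 2 by ring, pow_add, pow_add]
    nlinarith
  have h4 : ∀ j : ℕ, (2 * j + 4) * (2 * j + 3) ≤ 16 * 2 ^ j := by
    intro j
    induction j with
    | zero => norm_num
    | succ j ih =>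
      rcases Nat.eq_zero_or_pos j with rfl | hj
      · norm_num
      · rw [pow_succ]
        nlinarith
  have h5 := h4 j
  have h6 : Nat.size (2 * (d * d + 1)) * (1 + 2 * Nat.size d) ≤ (2 * j + 4) * (2 * j + 3) :=
    Nat.mul_le_mul h3 (by omega)
  omega

/-! ## The encoding algorithm -/

/-- The part of the encoding algorithm that does not use random bits. -/
def structProg (k : ℕ) : Program :=
  .seq boundProg <| .seq halfProg <| .seq (sizeProg rLen (.var rBound)) <|
  .seq (sizeProg rLevels .deg) <| .seq colorProg <| .seq tablesProg (extrasProg (2 * k))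

theorem uses_structProg (k : ℕ) : (structProg k).uses 2 = false := by
  have h : (extrasProg (2 * k)).uses 2 = false := by
    simp only [extrasProg, Program.forLoop, Program.uses, Program.set, Term.reads,
      reads_nmul (e := .deg) (a := 2) rfl]
    rfl
  simp only [structProg, Program.uses, h]
  rfl

/-- The encoding algorithm. -/
def encodeProg {k : ℕ} (g : (Fin k → Bool) → (Fin k → Bool) → (Fin k → Bool) → (Fin k → Bool)) :
    Program :=
  .seq (structProg k) <| .seq (randProg (2 * k)) (fixProg g)

theorem runs_structProg {B k n d : ℕ} {σ : Store} (hG : GraphStore σ n d) (hnB : n ≤ B)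
    (hdB : 8 * d ≤ B) (hB : 2 * (d * d + 1) * (2 * (d * d + 1)) ≤ B)
    (h4 : σ rHalf = 0) (h6 : σ rForb = 0) (h9 : σ rTable = 0) :
    Runs B (structProg k) σ fun τ => ∃ (χ : ℕ → ℕ) (sm sa bm : ℕ → ℕ → ℕ),
      (∀ u < n, χ u < 2 * (d * d + 1)) ∧ ∀ u < n,
        Hashed d (2 * (d * d + 1)) {w ∈ Finset.range n | σ 1 u w ≠ 0} χ (sm u) (sa u) (bm u)
          (τ rSlot u) ∧
        Encodes d (Nat.size (2 * (d * d + 1))) (Nat.size d) (fun i => τ 3 u (2 * k * d + i)) (χ u)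
          (sm u) (sa u) (bm u) := by
  have hX : 2 * (d * d + 1) ≤ B := (Nat.le_mul_self _).trans hB
  have hd : d ≤ d * d := Nat.le_mul_self d
  have hsize : ∀ x, Nat.size x ≤ x := fun x => Nat.size_le.2 Nat.lt_two_pow_self
  refine .seq ((runs_boundProg (by rw [hG.deg_eq]; omega)).frame.mono ?_)
  rintro τ₁ ⟨a1, hf₁⟩
  rw [hG.deg_eq] at a1
  refine .seq ((runs_halfProg (by rw [a1]; omega) (by rw [hf₁ 4 rfl, h4])).frame.mono ?_)
  rintro τ₂ ⟨a2, hf₂⟩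
  have b20 : τ₂ rBound 0 0 = 2 * (d * d + 1) := by rw [hf₂ 20 rfl, a1]
  rw [a1] at a2
  refine .seq ((runs_sizeProg (x := 2 * (d * d + 1)) (by decide) (by decide) rfl (by simpa using b20) hX
    fun y hy => a2 y (by omega)).frame.mono ?_)
  rintro τ₃ ⟨a3, hf₃⟩
  have c4 : τ₃ rHalf = τ₂ rHalf := hf₃ 4 rfl
  have c0 : τ₃ 0 = σ 0 := by rw [hf₃ 0 rfl, hf₂ 0 rfl, hf₁ 0 rfl]
  have c1 : τ₃ 1 = σ 1 := by rw [hf₃ 1 rfl, hf₂ 1 rfl, hf₁ 1 rfl]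
  refine .seq ((runs_sizeProg (x := d) (by decide) (by decide) rfl (by simp [c0, hG.deg_eq])
    (by omega) fun y hy => by rw [c4]; exact a2 y (by omega)).frame.mono ?_)
  rintro τ₄ ⟨a4, hf₄⟩
  have d0 : τ₄ 0 = σ 0 := by rw [hf₄ 0 rfl, c0]
  have d1 : τ₄ 1 = σ 1 := by rw [hf₄ 1 rfl, c1]
  have hG₄ := hG.congr d0 d1
  refine .seq ((runs_colorProg hG₄ hnB (by omega) ?_).frame.mono ?_)
  · rw [hf₄ 6 rfl, hf₃ 6 rfl, hf₂ 6 rfl, hf₁ 6 rfl, h6]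
  rintro τ₅ ⟨⟨a5, a6⟩, hf₅⟩
  have e0 : τ₅ 0 = σ 0 := by rw [hf₅ 0 rfl, d0]
  have e1 : τ₅ 1 = σ 1 := by rw [hf₅ 1 rfl, d1]
  have e4 : τ₅ rHalf = τ₂ rHalf := by rw [hf₅ 4 rfl, hf₄ 4 rfl, c4]
  refine .seq ((runs_tablesProg (N := d * d + 1) (hG.congr e0 e1) ?_ (by omega) hnB hB (by omega)
    (fun w hw => Nat.lt_succ_of_le (a5 w hw)) ?_ ?_ ?_).frame.mono ?_)
  · rw [hf₅ 20 rfl, hf₄ 20 rfl, hf₃ 20 rfl, b20]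
  · rw [e1, ← d1]; exact a6
  · intro y hy
    rw [e4, a2 y (by omega)]
  · rw [hf₅ 9 rfl, hf₄ 9 rfl, hf₃ 9 rfl, hf₂ 9 rfl, hf₁ 9 rfl, h9]
  rintro τ₆ ⟨a7, hf₆⟩
  have f5 : τ₆ rColor = τ₅ rColor := hf₆ 5 rfl
  rw [e1] at a7
  refine (runs_extrasProg (2 * k) (n := n) (d := d) (L := Nat.size (2 * (d * d + 1)))
    (J := Nat.size d) (X := 2 * (d * d + 1)) ?_ ?_ ?_ ?_ hnB ((hsize _).trans hX)
    ((hsize _).trans (by omega)) hdB ?_ ?_ ?_).frame.mono ?_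
  · rw [hf₆ 0 rfl, e0, hG.order_eq]
  · rw [hf₆ 0 rfl, e0, hG.deg_eq]
  · rw [hf₆ 31 rfl, hf₅ 31 rfl, hf₄ 31 rfl, a3]
  · rw [hf₆ 32 rfl, hf₅ 32 rfl, a4]
  · intro z hz
    rw [hf₆ 4 rfl, e4, a2 z (by omega)]
  · intro u hu
    rw [f5]
    have := a5 u hu
    omega
  · intro u hu j hj
    have := (a7 u hu).seed_lt j hj
    omega
  rintro τ₇ ⟨a8, hf₇⟩
  refine ⟨τ₆ rColor 0, τ₆ rSeedM, τ₆ rSeedA, τ₆ rTable, fun u hu => ?_, fun u hu => ⟨?_, a8 u hu⟩⟩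
  · have := a5 u hu
    rw [f5]
    omega
  · rw [hf₇ 10 (by
      simp only [extrasProg, Program.forLoop, Program.writes, Program.set]; rfl), f5]
    exact a7 u hu

theorem graphStore_inputStore {d n m : ℕ} {G : SimpleGraph (Fin n)} (hG : G ∈ maxDegreeFamily d n)
    (r : Fin m → Bool) : GraphStore (inputStore d n G r) n d := by
  have h1 : ∀ i j, inputStore d n G r 1 i j ≠ 0 ↔
      ∃ (hi : i < n) (hj : j < n), G.Adj ⟨i, hi⟩ ⟨j, hj⟩ := by
    intro i j
    simp [inputStore]
  refine ⟨rfl, rfl, fun i j h => ?_, fun i j h => ?_, fun i => ?_⟩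
  · obtain ⟨-, hj, -⟩ := (h1 i j).1 h
    exact hj
  · obtain ⟨hi, hj, h⟩ := (h1 i j).1 h
    exact (h1 j i).2 ⟨hj, hi, h.symm⟩
  · by_cases hi : i < n
    · refine le_trans ?_ (hG ⟨i, hi⟩)
      rw [← Set.ncard_image_of_injective _ Fin.val_injective, ← Set.ncard_coe_finset]
      refine Set.ncard_le_ncard ?_ (Set.toFinite _)
      intro j hj
      simp only [Finset.coe_filter, Set.mem_ofPred_eq] at hj
      obtain ⟨_, hj, h⟩ := (h1 i j).1 hj.2
      exact ⟨⟨j, hj⟩, h, rfl⟩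
    · rw [Finset.filter_false_of_mem]
      · simp
      · intro j hj h
        exact hi ((h1 i j).1 h).1

theorem inputStore_eq_update {d n m : ℕ} {G : SimpleGraph (Fin n)} (r : Fin m → Bool) :
    inputStore d n G r = Function.update (inputStore d n G (Fin.elim0 : Fin 0 → Bool)) 2
      (inputStore d n G r 2) := by
  funext a
  by_cases h : a = 2
  · subst h; simp
  · rw [Function.update_of_ne h]
    funext i j
    unfold inputStore
    split <;> simp_all

/-- The random bit for position `i` of the label of `u`. -/
def randBit {m : ℕ} (r : Fin m → Bool) (l u i : ℕ) : Bool :=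
  if h : u * l + i < m then r ⟨u * l + i, h⟩ else false

/-- The labels in the memory `σ` are the ones prescribed by the slots, the extra bits `E` and the
random bits `r`. -/
structure LabelStore {k n m : ℕ} (g : (Fin k → Bool) → (Fin k → Bool) → (Fin k → Bool) →
    (Fin k → Bool)) (d : ℕ) (G : SimpleGraph (Fin n)) (slot : Fin n → Fin n → ℕ)
    (E : Fin n → ℕ → Bool) (r : Fin m → Bool) (σ : Store) : Prop where
  extra : ∀ (u : Fin n), ∀ i < 24 * d, decide (σ 3 u (2 * k * d + i) ≠ 0) = E u i
  fst : ∀ u : Fin n, ∀ s < d, ∀ b < k, decide (σ 3 u (2 * k * s + b) ≠ 0) =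
    randBit r (2 * k * d) u (2 * k * s + b)
  snd_of_lt : ∀ u w, w < u → G.Adj u w → ∀ b : Fin k,
    decide (σ 3 u (2 * k * slot u w + k + b) ≠ 0) =
      g (fun b => randBit r (2 * k * d) w (2 * k * slot w u + b))
        (fun b => randBit r (2 * k * d) u (2 * k * slot u w + b))
        (fun b => randBit r (2 * k * d) w (2 * k * slot w u + k + b)) b
  snd : ∀ u : Fin n, ∀ s < d, (∀ w < u, G.Adj u w → slot u w ≠ s) → ∀ b < k,
    decide (σ 3 u (2 * k * s + k + b) ≠ 0) = randBit r (2 * k * d) u (2 * k * s + k + b)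

-- The order of the quantifiers matters: the slots and the extra bits are fixed before the random
-- bits `r` are given. Otherwise the labels could not be treated as a function of uniform field
-- values with a fixed matching.
open Polynomial in
theorem exists_encoding {k : ℕ}
    (g : (Fin k → Bool) → (Fin k → Bool) → (Fin k → Bool) → (Fin k → Bool)) :
    ∃ p : ℕ[X], ∀ d n, ∀ G ∈ maxDegreeFamily d n,
      ∃ (slot : Fin n → Fin n → ℕ) (E : Fin n → ℕ → Bool),
        (∀ u w, G.Adj u w → slot u w < d) ∧
        (∀ u i, 24 * d ≤ i → E u i = false) ∧
        (∀ u w, G.Adj u w → slotIndex d (E u) (E w) = slot u w) ∧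
        (∀ u v w, G.Adj u v → G.Adj u w → slot u v = slot u w → v = w) ∧
        ∀ (m : ℕ) (r : Fin m → Bool), n * (2 * k * d) ≤ m →
          ∃ σ t, Exec (encodeProg g) (inputStore d n G r) σ t ∧ t ≤ p.eval (n + d) ∧
            LabelStore g d G slot E r σ := by
  -- a bound for the number of rounds of all loops
  set q : ℕ[X] := X + 8 * X + 2 * (X * X + 1) * (2 * (X * X + 1)) + C (2 * k) * X with hq
  refine ⟨(encodeProg g).time.comp q, fun d n G hG => ?_⟩
  set B := q.eval (n + d) with hB
  have hBval : B = (n + d) + 8 * (n + d) +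
      2 * ((n + d) * (n + d) + 1) * (2 * ((n + d) * (n + d) + 1)) + 2 * k * (n + d) := by
    rw [hB, hq]
    simp
  have hnB : n ≤ B := by rw [hBval]; omega
  have hdB : 8 * d ≤ B := by rw [hBval]; omega
  have hkB : 2 * k * d ≤ B := by
    have : 2 * k * d ≤ 2 * k * (n + d) := Nat.mul_le_mul_left _ (by omega)
    rw [hBval]; omega
  have hB2 : 2 * (d * d + 1) * (2 * (d * d + 1)) ≤ B := by
    have h1 : d * d ≤ (n + d) * (n + d) := Nat.mul_le_mul (by omega) (by omega)
    have h2 : 2 * (d * d + 1) * (2 * (d * d + 1)) ≤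
        2 * ((n + d) * (n + d) + 1) * (2 * ((n + d) * (n + d) + 1)) := by gcongr
    rw [hBval]; omega
  -- The deterministic part is run without any random bits, to define the slots and extra bits
  -- independently of `r`.
  set r₀ : Fin 0 → Bool := Fin.elim0
  have hG₀ := graphStore_inputStore hG r₀
  have hzero : ∀ a, 3 ≤ a → inputStore d n G r₀ a = 0 := by
    intro a ha
    funext i j
    unfold inputStore
    split <;> first | omega | rfl
  obtain ⟨τ, t₁, hex, ht₁, ⟨χ, sm, sa, bm, hχ, hH⟩, hf⟩ := (runs_structProg (k := k) hG₀ hnB hdB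
    hB2 (hzero _ (by decide)) (hzero _ (by decide)) (hzero _ (by decide))).frame
  have hadj : ∀ u w : Fin n, inputStore d n G r₀ 1 u w ≠ 0 ↔ G.Adj u w := by
    intro u w
    simp [inputStore]
  have hns : ∀ u w : Fin n, G.Adj u w →
      (w : ℕ) ∈ {w ∈ Finset.range n | inputStore d n G r₀ 1 u w ≠ 0} := by
    intro u w h
    rw [Finset.mem_filter, Finset.mem_range]
    exact ⟨w.2, (hadj u w).2 h⟩
  have hslot : ∀ u w, G.Adj u w → τ rSlot u w < d :=
    fun u w h => (hH u u.2).1.slot_lt _ (hns u w h)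
  -- Extra bits beyond `24 * d` are set to zero. For positive `d` this cuts off nothing that is
  -- read, and whenever two vertices are adjacent `d` is positive.
  have henc : 0 < d → ∀ u < n, ∀ i < Nat.size (2 * (d * d + 1)) * (1 + 2 * Nat.size d) + 8 * d,
      (if i < 24 * d then τ 3 u (2 * k * d + i) else 0) = τ 3 u (2 * k * d + i) :=
    fun hd u _ i hi => if_pos (hi.trans_le (extra_length_le hd))
  refine ⟨fun u w => τ rSlot u w,
    fun u i => decide ((if i < 24 * d then τ 3 u (2 * k * d + i) else 0) ≠ 0), hslot,
    fun u i hi => by simp [hi.not_gt],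
    fun u w h => slotIndex_eq (hH u u.2).1
      ((hH u u.2).2.congr (henc ((Nat.zero_le _).trans_lt (hslot u w h)) u u.2))
      ((hH w w.2).2.congr (henc ((Nat.zero_le _).trans_lt (hslot u w h)) w w.2))
      (hns u w h) (hχ w w.2),
    fun u v w h1 h2 h3 => Fin.ext ((hH u u.2).1.slot_inj (hns u v h1) (hns u w h2) h3), ?_⟩
  intro m r hm
  -- The same run, with the actual random bits in array `2`, which the deterministic part never
  -- touches.
  have hex' := hex.update (uses_structProg k) (inputStore d n G r 2)
  rw [← inputStore_eq_update r] at hex'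
  set τ' := Function.update τ 2 (inputStore d n G r 2) with hτ'
  have hτ'_ne : ∀ a, a ≠ 2 → τ' a = τ a := fun a ha => Function.update_of_ne ha _ _
  have hw : ∀ a, a < 2 → (structProg k).writes a = false := by
    intro a ha
    interval_cases a <;> rfl
  have h0 : τ' 0 = inputStore d n G r₀ 0 := by rw [hτ'_ne 0 (by decide), hf 0 (hw 0 (by decide))]
  have h1 : τ' 1 = inputStore d n G r₀ 1 := by rw [hτ'_ne 1 (by decide), hf 1 (hw 1 (by decide))]
  have hG' := hG₀.congr h0 h1
  obtain ⟨ρ, t₂, hex₂, ht₂, ⟨hr1, hr2⟩, hf₂⟩ := (runs_randProg (2 * k) hG'.order_eq hG'.deg_eq hnB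
    hkB).frame
  have hwr : ∀ a, a ≠ 3 → a ≠ 30 → a ≠ 40 → a ≠ 41 → (randProg (2 * k)).writes a = false := by
    intro a h3 h30 h40 h41
    simp [randProg, Program.writes, Program.forLoop, Program.set, h3, h30, h40, h41]
  have e0 : ρ 0 = τ' 0 := hf₂ 0 (hwr _ (by decide) (by decide) (by decide) (by decide))
  have e1 : ρ 1 = τ' 1 := hf₂ 1 (hwr _ (by decide) (by decide) (by decide) (by decide))
  have e10 : ρ rSlot = τ rSlot := by
    rw [hf₂ 10 (hwr _ (by decide) (by decide) (by decide) (by decide)), hτ'_ne _ (by decide)]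
  have hρ1 : ρ 1 = inputStore d n G r₀ 1 := by rw [e1, h1]
  have hGρ := hG'.congr e0 e1
  obtain ⟨σ, t₃, hex₃, ht₃, hfix⟩ := runs_fixProg g hGρ hnB (by
    intro u v w hvw ha hb
    rw [hρ1] at ha hb
    rw [e10]
    have hu : u < n := by
      by_contra hu
      simp [inputStore, hu] at ha
    have hv := hG₀.lt _ _ ha
    have hw := hG₀.lt _ _ hb
    intro hs
    exact hvw ((hH u hu).1.slot_inj (Finset.mem_filter.2 ⟨Finset.mem_range.2 hv, ha⟩)
      (Finset.mem_filter.2 ⟨Finset.mem_range.2 hw, hb⟩) hs))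
  refine ⟨σ, t₁ + (t₂ + t₃), .seq hex' (.seq hex₂ hex₃), ?_, ?_⟩
  · rw [eval_comp, ← hB]
    simp only [encodeProg, Program.time, eval_add]
    omega
  -- the entries before the second halves are completed
  have hraw : ∀ u : Fin n, ∀ i < 2 * k * d,
      decide (ρ 3 u i ≠ 0) = randBit r (2 * k * d) u i := by
    intro u i hi
    rw [hr1 u u.2 i hi, hτ', Function.update_self, randBit]
    simp only [inputStore]
    by_cases h : (u : ℕ) * (2 * k * d) + i < m
    · simp [h]
    · simp [h]
  have hlt : ∀ s < d, ∀ b < 2 * k, 2 * k * s + b < 2 * k * d := by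
    intro s hs b hb
    calc 2 * k * s + b < 2 * k * s + 2 * k := by omega
      _ = 2 * k * (s + 1) := by ring
      _ ≤ 2 * k * d := Nat.mul_le_mul_left _ hs
  have hne : ∀ s s' b b', s ≠ s' ∨ b ≠ b' → b < 2 * k → b' < 2 * k →
      2 * k * s + b ≠ 2 * k * s' + b' := by
    intro s s' b b' hs hb hb' h
    have hk : 0 < 2 * k := by omega
    have h1 := congrArg (· / (2 * k)) h
    have h2 := congrArg (· % (2 * k)) h
    simp only [Nat.mul_add_div hk, Nat.div_eq_of_lt hb, Nat.div_eq_of_lt hb'] at h1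
    simp only [Nat.mul_add_mod, Nat.mod_eq_of_lt hb, Nat.mod_eq_of_lt hb'] at h2
    omega
  refine ⟨fun u i hi => ?_, fun u s hs b hb => ?_, fun u w hwu ha b => ?_,
    fun u s hs hsw b hb => ?_⟩
  · rw [(hfix u u.2).2, hr2 _ _ (by omega), hτ'_ne _ (by decide), if_pos hi]
    intro w hwu ha b hb
    rw [e10]
    rw [hρ1] at ha
    have := hslot u ⟨w, hwu.trans u.2⟩ ((hadj u ⟨w, hwu.trans u.2⟩).1 ha)
    have := hlt _ this (k + b) (by omega)
    simp only at this
    omega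
  · rw [(hfix u u.2).2, hraw u _ (hlt s hs b (by omega))]
    intro w hwu ha b' hb'
    rw [add_assoc]
    exact hne _ _ _ _ (.inr (by omega)) (by omega) (by omega)
  · have := (hfix u u.2).1 w hwu (by rw [hρ1, hadj]; exact ha) b
    rw [e10] at this
    rw [this]
    have hb1 : bitsAt k (ρ 3 w) (2 * k * τ rSlot w u) =
        fun b : Fin k => randBit r (2 * k * d) w (2 * k * τ rSlot w u + b) := by
      funext b
      exact hraw w _ (hlt _ (hslot w u ha.symm) b (by omega))
    have hb2 : bitsAt k (ρ 3 u) (2 * k * τ rSlot u w) =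
        fun b : Fin k => randBit r (2 * k * d) u (2 * k * τ rSlot u w + b) := by
      funext b
      exact hraw u _ (hlt _ (hslot u w ha) b (by omega))
    have hb3 : bitsAt k (ρ 3 w) (2 * k * τ rSlot w u + k) =
        fun b : Fin k => randBit r (2 * k * d) w (2 * k * τ rSlot w u + k + b) := by
      funext b
      have := hraw w _ (hlt _ (hslot w u ha.symm) (k + b) (by omega))
      rw [← add_assoc] at this
      exact this
    rw [hb1, hb2, hb3]
    cases g _ _ _ b <;> rfl
  · rw [(hfix u u.2).2, add_assoc, hraw u _ (hlt s hs (k + b) (by omega))]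
    intro w hwu ha b' hb'
    rw [add_assoc, add_assoc, e10]
    rw [hρ1] at ha
    exact hne _ _ _ _ (.inl (hsw ⟨w, hwu.trans u.2⟩ hwu
      ((hadj u ⟨w, hwu.trans u.2⟩).1 ha)).symm) (by omega) (by omega)

end Ram

/-! ## Counting by averaging over a family of permutations -/

/-- If, for every point of a set that is invariant under the permutations `T p`, at most `K` of
the permutations lead to a bad point, then the bad points are few. -/
theorem card_mul_card_bad_le {P Ω : Type*} [Fintype P] [Fintype Ω] [DecidableEq Ω]
    (T : P → Equiv.Perm Ω) (S : Finset Ω) (hS : ∀ p ω, T p ω ∈ S ↔ ω ∈ S) (bad : Ω → Prop)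
    [DecidablePred bad] (K : ℕ) (hK : ∀ ω ∈ S, #{p | bad (T p ω)} ≤ K) :
    Fintype.card P * #{ω ∈ S | bad ω} ≤ K * #S := by
  -- As `T p` permutes `S`, every `p` moves equally many points of `S` to bad points. The pairs of a
  -- permutation and a point moved to a bad one are then counted in two ways.
  have h1 : ∀ p, #{ω ∈ S | bad ω} = #{ω ∈ S | bad (T p ω)} := by
    intro p
    refine (Finset.card_bij (fun ω _ => T p ω) ?_ (fun _ _ _ _ h => (T p).injective h) ?_).symm
    · intro ω hω
      rw [Finset.mem_filter] at hω ⊢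
      exact ⟨(hS p ω).2 hω.1, hω.2⟩
    · intro ω hω
      rw [Finset.mem_filter] at hω
      refine ⟨(T p).symm ω, ?_, by simp⟩
      rw [Finset.mem_filter, ← hS p]
      simpa using hω
  calc Fintype.card P * #{ω ∈ S | bad ω} = ∑ p : P, #{ω ∈ S | bad (T p ω)} := by
        rw [← Finset.sum_congr rfl fun p _ => h1 p]
        simp
    _ = ∑ ω ∈ S, #{p | bad (T p ω)} := by
        simp only [Finset.card_filter]
        exact Finset.sum_comm
    _ ≤ K * #S := by
        rw [mul_comm, ← smul_eq_mul, ← Finset.sum_const]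
        exact Finset.sum_le_sum hK

/-- A hyperbola, possibly degenerate, has few points. -/
theorem card_hyperbola_le {F : Type*} [Field F] [Fintype F] [DecidableEq F] (p r K : F) :
    #{x : F × F | (x.1 - p) * (x.2 - r) = K} ≤ 2 * Fintype.card F := by
  -- The points lie on the vertical line through `p`, which matters only if `K = 0`, or on the graph
  -- of a function.
  have hsub : ({x : F × F | (x.1 - p) * (x.2 - r) = K} : Finset (F × F)) ⊆
      Finset.univ.image (fun y => (p, y)) ∪ Finset.univ.image (fun x => (x, K / (x - p) + r)) := by
    rintro ⟨x, y⟩ hx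
    simp only [Finset.mem_filter, Finset.mem_univ, true_and] at hx
    simp only [Finset.mem_union, Finset.mem_image, Finset.mem_univ, true_and, Prod.mk.injEq]
    by_cases h : x = p
    · exact .inl ⟨y, h.symm, rfl⟩
    · refine .inr ⟨x, rfl, ?_⟩
      rw [← hx, mul_div_cancel_left₀ _ (sub_ne_zero.2 h)]
      ring
  refine (Finset.card_le_card hsub).trans ((Finset.card_union_le _ _).trans ?_)
  have h1 := Finset.card_image_le (s := (Finset.univ : Finset F)) (f := fun y => (p, y))
  have h2 := Finset.card_image_le (s := (Finset.univ : Finset F))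
    (f := fun x => (x, K / (x - p) + r))
  rw [Finset.card_univ] at h1 h2
  omega

/-! ## Random solutions of the edge equations -/

namespace EdgeCode

variable {V S F : Type*} [LinearOrder V] [Field F]

/-- `M x = some y` means that the sites `x` and `y` are the two ends of an edge. -/
structure IsMatching (M : V × S → Option (V × S)) : Prop where
  symm : ∀ x y, M x = some y → M y = some x
  ne : ∀ x y, M x = some y → x.1 ≠ y.1

/-- The second component of the value at `x`: the random one, except at larger ends of edges,
where it is determined by the edge equation. -/
def snd (M : V × S → Option (V × S)) (ω : V × S → F × F) (x : V × S) : F :=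
  match M x with
  | none => (ω x).2
  | some y => if y.1 < x.1 then (ω y).1 * (ω x).1 - (ω y).2 else (ω x).2

/-- The first component of the value at the other end of the edge. -/
def slope (M : V × S → Option (V × S)) (ω : V × S → F × F) (x : V × S) : F :=
  match M x with
  | none => 0
  | some y => (ω y).1

variable {M : V × S → Option (V × S)}

theorem snd_add_snd (hM : IsMatching M) (ω : V × S → F × F) {x y : V × S} (h : M x = some y) :
    snd M ω x + snd M ω y = (ω x).1 * (ω y).1 := by
  have h' := hM.symm x y h
  rcases lt_or_gt_of_ne (hM.ne x y h) with hlt | hlt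
  · simp only [snd, h, h', hlt, if_true, if_neg hlt.asymm]
    ring
  · simp only [snd, h, h', hlt, if_true, if_neg hlt.asymm]
    ring

variable [DecidableEq S]

theorem slope_update (hM : IsMatching M) (ω : V × S → F × F) (x : V × S) (z : F × F) :
    slope M (Function.update ω x z) x = slope M ω x := by
  unfold slope
  cases h : M x with
  | none => rfl
  | some y =>
    have : y ≠ x := fun h' => hM.ne x y h (by rw [h'])
    simp [Function.update_of_ne this]

/-- Change the value at `x`, without changing the values at any other site. -/
def shear (hM : IsMatching M) (x : V × S) (c : F) : Equiv.Perm (V × S → F × F) where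
  -- The point moves along a line whose slope is the first component at the other end: the edge
  -- equation is affine in the pair at `x`, with exactly this line as its solutions.
  toFun ω := Function.update ω x (ω x + (c, c * slope M ω x))
  invFun ω := Function.update ω x (ω x + (-c, -c * slope M ω x))
  left_inv ω := by
    simp only [slope_update hM, Function.update_self, Function.update_idem]
    rw [Function.update_eq_self_iff]
    ext <;> simp
  right_inv ω := by
    simp only [slope_update hM, Function.update_self, Function.update_idem]
    rw [Function.update_eq_self_iff]
    ext <;> simp

section shear

variable (hM : IsMatching M) (x : V × S) (c : F) (ω : V × S → F × F)

theorem shear_apply_self : shear hM x c ω x = ω x + (c, c * slope M ω x) := by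
  simp [shear]

theorem shear_apply_of_ne {z : V × S} (hz : z ≠ x) : shear hM x c ω z = ω z := by
  simp [shear, Function.update_of_ne hz]

/-- The visible second component moves by the same amount whether it is random or solved for, so no
distinction between the two ends of an edge is needed later. -/
theorem snd_shear_self : snd M (shear hM x c ω) x = snd M ω x + c * slope M ω x := by
  cases h : M x with
  | none => simp [snd, h, shear_apply_self]
  | some y =>
    have hy : y ≠ x := fun h' => hM.ne x y h (by rw [h'])
    simp only [snd, h, shear_apply_self, shear_apply_of_ne hM x c ω hy, slope]
    split_ifs
    · simp only [Prod.fst_add]; ring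
    · simp

/-- The only critical case is a site whose second component is computed from `x`: there the changes
of the product and of the second component at `x` cancel, by the choice of the slope. This is what
hides the shear from anyone who does not see `x`. -/
theorem snd_shear_of_ne {z : V × S} (hz : z ≠ x) :
    snd M (shear hM x c ω) z = snd M ω z := by
  cases h : M z with
  | none => simp [snd, h, shear_apply_of_ne hM x c ω hz]
  | some y =>
    simp only [snd, h, shear_apply_of_ne hM x c ω hz]
    by_cases hy : y = x
    · subst hy
      have h' := hM.symm _ _ h
      simp only [shear_apply_self, slope, h']
      split_ifs
      · simp only [Prod.fst_add, Prod.snd_add]; ring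
      · rfl
    · rw [shear_apply_of_ne hM x c ω hy]

theorem slope_shear_of_ne {z : V × S} (hz : M z ≠ some x) :
    slope M (shear hM x c ω) z = slope M ω z := by
  cases h : M z with
  | none => simp [slope, h]
  | some y =>
    have hy : y ≠ x := fun h' => hz (by rw [h, h'])
    simp [slope, h, shear_apply_of_ne hM x c ω hy]

end shear

/-! ### Counting solutions of the tested equation -/

variable [Fintype V] [Fintype S] [Fintype F] [DecidableEq F]

/-- Given the values outside `u` and `v`, the edge equation for a site of `u` and a site of `v`
that are not matched is rarely satisfied. -/
theorem card_mul_card_equation_le (hM : IsMatching M) {x y : V × S} (hxy : x.1 ≠ y.1)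
    (hne : M x ≠ some y) (A : Finset (V × S → F × F))
    (hA : ∀ z, (z = x ∨ z = y) → ∀ c ω, shear hM z c ω ∈ A ↔ ω ∈ A) :
    Fintype.card F * #{ω ∈ A | snd M ω x + snd M ω y = (ω x).1 * (ω y).1} ≤ 2 * #A := by
  have hxy' : x ≠ y := fun h => hxy (by rw [h])
  have hne' : M y ≠ some x := fun h => hne (hM.symm _ _ h)
  -- Both sites are sheared independently. Since they are not matched with each other, neither shear
  -- changes the slope at the other site.
  have key := card_mul_card_bad_le (P := F × F)
    (fun p => (shear hM y p.2).trans (shear hM x p.1)) A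
    (fun p ω => by
      simp only [Equiv.trans_apply]
      rw [hA x (.inl rfl), hA y (.inr rfl)])
    (fun ω => snd M ω x + snd M ω y = (ω x).1 * (ω y).1) (2 * Fintype.card F) (fun ω _ => by
      -- With first components `a`, `a'` and slopes `m`, `m'` at `x` and `y`, the sheared equation
      -- takes the form `(c - (m' - a)) * (c' - (m - a')) = K`, where `K` does not involve `c` and
      -- `c'`.
      refine le_trans (Finset.card_le_card_of_injOn id ?_ (Set.injOn_id _))
        (card_hyperbola_le (slope M ω y - (ω x).1) (slope M ω x - (ω y).1)
          (snd M ω x + snd M ω y - slope M ω x * (ω x).1 - slope M ω y * (ω y).1 +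
            slope M ω x * slope M ω y))
      rintro ⟨c, c'⟩ hp
      simp only [Equiv.trans_apply, Finset.coe_filter, Finset.mem_univ, true_and,
        Set.mem_ofPred_eq, snd_shear_self, shear_apply_self,
        snd_shear_of_ne hM x _ _ hxy'.symm, snd_shear_of_ne hM y _ _ hxy',
        shear_apply_of_ne hM x _ _ hxy'.symm, shear_apply_of_ne hM y _ _ hxy',
        slope_shear_of_ne hM y _ _ hne, Prod.fst_add] at hp
      simp only [id, Finset.coe_filter, Finset.mem_univ, true_and, Set.mem_ofPred_eq]
      linear_combination -hp)
  rw [Fintype.card_prod] at key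
  have hpos : 0 < Fintype.card F := Fintype.card_pos
  -- Of the `|F| ^ 2` shears at most `2 * |F|` are bad; one factor `|F|` cancels.
  refine Nat.le_of_mul_le_mul_left ?_ hpos
  calc Fintype.card F * (Fintype.card F * _) = Fintype.card F * Fintype.card F * _ := by ring
    _ ≤ _ := key
    _ = _ := by ring

/-- In characteristic two, the edge equation for a site and itself is rarely satisfied. -/
theorem card_mul_card_equation_self_le [CharP F 2] (hM : IsMatching M) (x : V × S) :
    Fintype.card F * #{ω : V × S → F × F | snd M ω x + snd M ω x = (ω x).1 * (ω x).1} ≤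
      Fintype.card (V × S → F × F) := by
  -- In characteristic two the left side is zero, so the sheared first component must vanish, which
  -- happens for a single `c`.
  have key := card_mul_card_bad_le (P := F) (fun c => shear hM x c)
    (Finset.univ : Finset (V × S → F × F)) (by simp)
    (fun ω => snd M ω x + snd M ω x = (ω x).1 * (ω x).1) 1 (fun ω _ => by
      rw [Finset.card_le_one]
      intro c hc c' hc'
      simp only [Finset.mem_filter, Finset.mem_univ, true_and, CharTwo.add_self_eq_zero,
        shear_apply_self, Prod.fst_add, zero_eq_mul, or_self] at hc hc'
      linear_combination hc - hc')
  simpa using key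

end EdgeCode

/-! ## Adaptive adversaries -/

/-- If every pair of vertices is decoded wrongly with small probability, given the labels of the
other vertices, then this also holds for the pair an adaptive adversary ends with. -/
theorem Strategy.card_wins_le {V L Ω : Type} [Fintype L] [DecidableEq L] [DecidableEq Ω]
    (G : SimpleGraph V) (D : L → L → Bool) (lab : Ω → V → L) (q K : ℕ)
    (h : ∀ x y, x ≠ y → ∀ A : Finset Ω,
      (∀ ω ω', (∀ z, z ≠ x → z ≠ y → lab ω z = lab ω' z) → (ω ∈ A ↔ ω' ∈ A)) →
      q * Set.ncard {ω ∈ (A : Set Ω) | ¬ (D (lab ω x) (lab ω y) = true ↔ G.Adj x y)} ≤ K * #A)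
    (a : Strategy V L) : ∀ (Q : Set V) (A : Finset Ω),
      (∀ ω ω', (∀ z ∈ Q, lab ω z = lab ω' z) → (ω ∈ A ↔ ω' ∈ A)) →
      q * Set.ncard {ω ∈ (A : Set Ω) | a.Wins G D (lab ω) Q} ≤ K * #A := by
  induction a with
  | declare x y =>
    intro Q A hA
    by_cases hxy : x ∉ Q ∧ y ∉ Q ∧ x ≠ y
    · refine le_trans (Nat.mul_le_mul_left q (Set.ncard_le_ncard ?_ ?_)) (h x y hxy.2.2 A ?_)
      · rintro ω ⟨h1, h2⟩
        exact ⟨h1, h2.2.2.2⟩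
      · exact (Finset.finite_toSet A).subset fun ω hω => hω.1
      · intro ω ω' hω
        refine hA ω ω' fun z hz => hω z ?_ ?_
        · rintro rfl; exact hxy.1 hz
        · rintro rfl; exact hxy.2.1 hz
    · have : {ω ∈ (A : Set Ω) | (Strategy.declare x y).Wins G D (lab ω) Q} = ∅ := by
        ext ω
        simp only [Strategy.Wins]
        constructor
        · rintro ⟨-, h1, h2, h3, -⟩
          exact hxy ⟨h1, h2, h3⟩
        · exact fun h => h.elim
      rw [this]
      simp
  | query x next ih =>
    intro Q A hA
    -- Split according to the answer `l`: on each piece the continuation is a fixed strategy, and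
    -- the piece is determined by the labels of the enlarged set of queried vertices.
    have h1 : ∀ l : L, q * Set.ncard {ω ∈ ((A.filter fun ω => lab ω x = l : Finset Ω) : Set Ω) |
        (next l).Wins G D (lab ω) (insert x Q)} ≤ K * #{ω ∈ A | lab ω x = l} := by
      intro l
      refine ih l (insert x Q) _ fun ω ω' hω => ?_
      rw [Finset.mem_filter, Finset.mem_filter,
        hA ω ω' fun z hz => hω z (Set.mem_insert_of_mem x hz), hω x (Set.mem_insert x Q)]
    have hsub : {ω ∈ (A : Set Ω) | (Strategy.query x next).Wins G D (lab ω) Q} ⊆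
        ⋃ l ∈ (Finset.univ : Finset L),
          {ω ∈ ((A.filter fun ω => lab ω x = l : Finset Ω) : Set Ω) |
            (next l).Wins G D (lab ω) (insert x Q)} := by
      rintro ω ⟨hω, hw⟩
      simp only [Set.mem_iUnion, Finset.mem_univ, exists_true_left]
      exact ⟨lab ω x, by simpa using hω, hw⟩
    calc q * Set.ncard {ω ∈ (A : Set Ω) | (Strategy.query x next).Wins G D (lab ω) Q}
        ≤ q * ∑ l : L, Set.ncard {ω ∈ ((A.filter fun ω => lab ω x = l : Finset Ω) : Set Ω) |
            (next l).Wins G D (lab ω) (insert x Q)} := by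
          refine Nat.mul_le_mul_left q ((Set.ncard_le_ncard hsub ?_).trans
            (Finset.set_ncard_biUnion_le _ _))
          refine Set.Finite.subset (Finset.finite_toSet A) fun ω hω => ?_
          simp only [Set.mem_iUnion] at hω
          obtain ⟨l, -, hω, -⟩ := hω
          exact (Finset.mem_filter.1 (Finset.mem_coe.1 hω)).1
      _ ≤ ∑ l : L, K * #{ω ∈ A | lab ω x = l} := by
          rw [Finset.mul_sum]
          exact Finset.sum_le_sum fun l _ => h1 l
      _ = K * #A := by
          rw [← Finset.mul_sum]
          congr 1
          exact (Finset.card_eq_sum_card_fiberwise fun ω _ => Finset.mem_univ _).symm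

/-! ## Uniform distributions -/

namespace PMF

/-- The image of a uniform distribution under a map whose fibres all have the same size. -/
theorem map_uniformOfFintype {α β : Type*} [Fintype α] [Nonempty α] [Fintype β] [Nonempty β]
    (f : α → β) (m : ℕ) (h : ∀ b, Nat.card {a // f a = b} = m) :
    (uniformOfFintype α).map f = uniformOfFintype β := by
  classical
  have hcard : Fintype.card α = Fintype.card β * m := by
    rw [← Fintype.card_congr (Equiv.sigmaFiberEquiv f), Fintype.card_sigma]
    simp [← Nat.card_eq_fintype_card, h]
  have hα : Fintype.card α ≠ 0 := Fintype.card_ne_zero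
  have hm : m ≠ 0 := fun h0 => hα (by rw [hcard, h0, mul_zero])
  ext b
  rw [← toOuterMeasure_apply_singleton, toOuterMeasure_map_apply,
    toOuterMeasure_uniformOfFintype_apply, uniformOfFintype_apply]
  have hf : Fintype.card (f ⁻¹' {b}) = m := by
    rw [← Nat.card_eq_fintype_card, ← h b]
    rfl
  rw [hf, hcard, Nat.cast_mul, ENNReal.div_eq_inv_mul,
    ENNReal.mul_inv (.inr (ENNReal.natCast_ne_top m)) (.inl (ENNReal.natCast_ne_top _)), mul_assoc,
    ENNReal.inv_mul_cancel (by exact_mod_cast hm) (ENNReal.natCast_ne_top m), mul_one]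

theorem map_uniformOfFintype_equiv {α β : Type*} [Fintype α] [Nonempty α] [Fintype β] [Nonempty β]
    (e : α ≃ β) : (uniformOfFintype α).map e = uniformOfFintype β := by
  refine map_uniformOfFintype e 1 fun b => Nat.card_eq_one_iff_unique.2 ⟨⟨?_⟩, ⟨e.symm b, by simp⟩⟩
  rintro ⟨x, hx⟩ ⟨y, hy⟩
  exact Subtype.ext (e.injective (hx.trans hy.symm))

/-- A selection of independent fair bits consists of independent fair bits. -/
theorem map_uniformOfFintype_comp {I J : Type*} [Fintype I] [DecidableEq I] [Fintype J]
    [DecidableEq J] (ι : J → I) (hι : Function.Injective ι) :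
    (uniformOfFintype (I → Bool)).map (fun r => r ∘ ι) = uniformOfFintype (J → Bool) := by
  refine map_uniformOfFintype _ (Nat.card {r : I → Bool // r ∘ ι = fun _ => false}) fun b => ?_
  -- Adding modulo two an extension `t` of `b` identifies the fibre over `b` with the fibre over
  -- zero, so all fibres have the same size.
  set t : I → Bool := Function.extend ι b fun _ => false with ht
  have htb : ∀ j, t (ι j) = b j := fun j => hι.extend_apply _ _ _
  refine Nat.card_congr
    { toFun := fun r => ⟨fun i => xor (r.1 i) (t i), ?_⟩
      invFun := fun r => ⟨fun i => xor (r.1 i) (t i), ?_⟩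
      left_inv := fun r => ?_
      right_inv := fun r => ?_ }
  · funext j
    have := congrFun r.2 j
    simp only [Function.comp_apply] at this ⊢
    simp [htb, this]
  · funext j
    have := congrFun r.2 j
    simp only [Function.comp_apply] at this ⊢
    simp [htb, this]
  · ext i; simp
  · ext i; simp

/-- An event with few points has small probability. -/
theorem toOuterMeasure_uniformOfFintype_le {Ω : Type*} [Fintype Ω] [Nonempty Ω] {q : ℕ} {ε : ℝ}
    (hε : 2 ≤ ε * q) (hq : 0 < q) (s : Set Ω) (h : q * s.ncard ≤ 2 * Fintype.card Ω) :
    (uniformOfFintype Ω).toOuterMeasure s ≤ ENNReal.ofReal ε := by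
  classical
  have hT : 0 < (Fintype.card Ω : ℝ) := by exact_mod_cast Fintype.card_pos
  have hq' : (0 : ℝ) < q := by exact_mod_cast hq
  have h' : (q : ℝ) * s.ncard ≤ 2 * Fintype.card Ω := by exact_mod_cast h
  rw [toOuterMeasure_uniformOfFintype_apply, ← Nat.card_eq_fintype_card, Nat.card_coe_set_eq,
    ← ENNReal.ofReal_natCast, ← ENNReal.ofReal_natCast, ← ENNReal.ofReal_div_of_pos hT]
  refine ENNReal.ofReal_le_ofReal ?_
  rw [div_le_iff₀ hT]
  refine le_of_mul_le_mul_left ?_ hq'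
  nlinarith

/-- The complement of an event with few points has large probability. -/
theorem le_toOuterMeasure_uniformOfFintype {Ω : Type*} [Fintype Ω] [Nonempty Ω] {q : ℕ} {ε : ℝ}
    (hε : 2 ≤ ε * q) (hq : 0 < q) (s : Set Ω) (h : q * sᶜ.ncard ≤ 2 * Fintype.card Ω) :
    ENNReal.ofReal (1 - ε) ≤ (uniformOfFintype Ω).toOuterMeasure s := by
  classical
  have hT : 0 < (Fintype.card Ω : ℝ) := by exact_mod_cast Fintype.card_pos
  have hq' : (0 : ℝ) < q := by exact_mod_cast hq
  have h' : (q : ℝ) * sᶜ.ncard ≤ 2 * Fintype.card Ω := by exact_mod_cast h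
  have hs : (s.ncard : ℝ) + sᶜ.ncard = Fintype.card Ω := by
    rw [← Nat.card_eq_fintype_card]
    exact_mod_cast Set.ncard_add_ncard_compl s
  rw [toOuterMeasure_uniformOfFintype_apply, ← Nat.card_eq_fintype_card, Nat.card_coe_set_eq,
    ← ENNReal.ofReal_natCast, ← ENNReal.ofReal_natCast, ← ENNReal.ofReal_div_of_pos hT]
  refine ENNReal.ofReal_le_ofReal ?_
  rw [le_div_iff₀ hT]
  refine le_of_mul_le_mul_left ?_ hq'
  nlinarith

/-- The probability of an event is bounded by its probabilities given the first component. -/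
theorem toOuterMeasure_bind_map_le {α β : Type*} (A : PMF α) (μ : PMF β) (s : Set (α × β))
    (x : ENNReal) (h : ∀ a, μ.toOuterMeasure {b | (a, b) ∈ s} ≤ x) :
    (A.bind fun a => μ.map fun b => (a, b)).toOuterMeasure s ≤ x := by
  rw [toOuterMeasure_bind_apply]
  calc ∑' a, A a * (μ.map fun b => (a, b)).toOuterMeasure s ≤ ∑' a, A a * x := by
        refine ENNReal.tsum_le_tsum fun a => mul_le_mul_right ?_ _
        rw [toOuterMeasure_map_apply]
        exact h a
    _ = x := by rw [ENNReal.tsum_mul_right, A.tsum_coe, one_mul]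

end PMF

/-! ## The labels and the decoder -/

namespace EdgeCode

section partner

variable {n d : ℕ} {G : SimpleGraph (Fin n)} {slot : Fin n → Fin n → ℕ}

open Classical in
/-- The site at the other end of the edge in slot `x.2` of the vertex `x.1`. -/
noncomputable def partner (hslot : ∀ u w, G.Adj u w → slot u w < d) (x : Fin n × Fin d) :
    Option (Fin n × Fin d) :=
  if h : ∃ w, G.Adj x.1 w ∧ slot x.1 w = x.2 then
    some (h.choose, ⟨slot h.choose x.1, hslot _ _ h.choose_spec.1.symm⟩)
  else none

/-- By `hinj` at most one edge occupies a slot, so the vertex chosen in `partner` is the expected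
one. -/
theorem partner_eq_some_iff (hslot : ∀ u w, G.Adj u w → slot u w < d)
    (hinj : ∀ u v w, G.Adj u v → G.Adj u w → slot u v = slot u w → v = w) (x y : Fin n × Fin d) :
    partner hslot x = some y ↔
      G.Adj x.1 y.1 ∧ slot x.1 y.1 = x.2 ∧ slot y.1 x.1 = y.2 := by
  unfold partner
  constructor
  · intro h
    split_ifs at h with h'
    rw [Option.some.injEq] at h
    subst h
    exact ⟨h'.choose_spec.1, h'.choose_spec.2, rfl⟩
  · rintro ⟨h1, h2, h3⟩
    have h' : ∃ w, G.Adj x.1 w ∧ slot x.1 w = x.2 := ⟨y.1, h1, h2⟩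
    have hw : h'.choose = y.1 :=
      hinj _ _ _ h'.choose_spec.1 h1 (h'.choose_spec.2.trans h2.symm)
    rw [dif_pos h', Option.some.injEq]
    refine Prod.ext hw (Fin.ext ?_)
    rw [← h3]
    simp only [hw]

theorem isMatching_partner (hslot : ∀ u w, G.Adj u w → slot u w < d)
    (hinj : ∀ u v w, G.Adj u v → G.Adj u w → slot u v = slot u w → v = w) :
    IsMatching (partner hslot) where
  symm x y h := by
    rw [partner_eq_some_iff hslot hinj] at h ⊢
    exact ⟨h.1.symm, h.2.2, h.2.1⟩
  ne x y h := by
    rw [partner_eq_some_iff hslot hinj] at h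
    exact h.1.ne

end partner

variable {k : ℕ} {F : Type} [Field F] (e : F ≃ (Fin k → Bool))

/-- The bit `i` of a label. -/
def getBit {c : ℕ} (l : Fin c → Bool) (i : ℕ) : Bool :=
  if h : i < c then l ⟨i, h⟩ else false

/-- The field element written in a label at the position `o`. -/
def readField {c : ℕ} (l : Fin c → Bool) (o : ℕ) : F :=
  e.symm fun b => getBit l (o + b)

/-- The bits of a label that determine the slots of the edges. -/
def extraBits (k d : ℕ) {c : ℕ} (l : Fin c → Bool) (i : ℕ) : Bool :=
  getBit l (2 * k * d + i)

/-- Test the edge equation at the slots that the two vertices would use for an edge. -/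
noncomputable def decode [DecidableEq F] (d : ℕ) {c : ℕ} (l l' : Fin c → Bool) : Bool :=
  let s := slotIndex d (extraBits k d l) (extraBits k d l')
  let s' := slotIndex d (extraBits k d l') (extraBits k d l)
  decide (s < d ∧ s' < d ∧
    readField e l (2 * k * s + k) + readField e l' (2 * k * s' + k) =
      readField e l (2 * k * s) * readField e l' (2 * k * s'))

/-- The bits of the label of the vertex `u`. -/
def labelBit {n d : ℕ} (M : Fin n × Fin d → Option (Fin n × Fin d)) (E : Fin n → ℕ → Bool)
    (ω : Fin n × Fin d → F × F) (u : Fin n) (i : ℕ) : Bool :=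
  if h : i / (2 * k) < d then
    if i % (2 * k) < k then getBit (e (ω (u, ⟨i / (2 * k), h⟩)).1) (i % (2 * k))
    else getBit (e (snd M ω (u, ⟨i / (2 * k), h⟩))) (i % (2 * k) - k)
  else E u (i - 2 * k * d)

section label

variable {n d : ℕ} (M : Fin n × Fin d → Option (Fin n × Fin d)) (E : Fin n → ℕ → Bool)
  (ω : Fin n × Fin d → F × F) (u : Fin n)

theorem labelBit_fst (s : Fin d) (b : Fin k) :
    labelBit e M E ω u (2 * k * s + b) = e (ω (u, s)).1 b := by
  have hb := b.2
  have h1 : (2 * k * s + b) / (2 * k) = s := by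
    rw [Nat.mul_add_div (by omega), Nat.div_eq_of_lt (by omega), add_zero]
  have h2 : (2 * k * s + b) % (2 * k) = b := by
    rw [Nat.mul_add_mod, Nat.mod_eq_of_lt (by omega)]
  simp [labelBit, h1, h2, getBit]

theorem labelBit_snd (s : Fin d) (b : Fin k) :
    labelBit e M E ω u (2 * k * s + k + b) = e (snd M ω (u, s)) b := by
  have hb := b.2
  have h1 : (2 * k * s + k + b) / (2 * k) = s := by
    rw [add_assoc, Nat.mul_add_div (by omega), Nat.div_eq_of_lt (by omega), add_zero]
  have h2 : (2 * k * s + k + b) % (2 * k) = k + b := by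
    rw [add_assoc, Nat.mul_add_mod, Nat.mod_eq_of_lt (by omega)]
  simp [labelBit, h1, h2, getBit]

theorem labelBit_extra (hk : k ≠ 0) (i : ℕ) :
    labelBit e M E ω u (2 * k * d + i) = E u i := by
  have h1 : ¬ (2 * k * d + i) / (2 * k) < d := by
    rw [Nat.mul_add_div (by omega)]
    exact (Nat.le_add_right _ _).not_gt
  simp [labelBit, h1]

variable {ω u} in
theorem labelBit_congr {ω' : Fin n × Fin d → F × F} (h1 : ∀ s, ω (u, s) = ω' (u, s))
    (h2 : ∀ s, snd M ω (u, s) = snd M ω' (u, s)) : labelBit e M E ω u = labelBit e M E ω' u := by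
  funext i
  simp only [labelBit, h1, h2]

/-- The label of the vertex `u`. -/
def label (c : ℕ) : Fin c → Bool := fun i => labelBit e M E ω u i

variable {c : ℕ} (hc : c = (2 * k + 24) * d)

include hc in
theorem getBit_label {i : ℕ} (hi : i < 2 * k * d) :
    getBit (label e M E ω u c) i = labelBit e M E ω u i := by
  have : i < c := by rw [hc, add_mul]; omega
  simp [getBit, label, this]

include hc in
theorem extraBits_label (hk : k ≠ 0) (hE : ∀ i, 24 * d ≤ i → E u i = false) :
    extraBits k d (label e M E ω u c) = E u := by
  funext i
  rw [extraBits, getBit]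
  split_ifs with h
  · rw [label, labelBit_extra e M E ω u hk]
  · rw [hE i]
    rw [hc, add_mul] at h
    omega

include hc in
theorem readField_label_fst (s : Fin d) :
    readField e (label e M E ω u c) (2 * k * s) = (ω (u, s)).1 := by
  rw [readField, Equiv.symm_apply_eq]
  funext b
  have hlt : 2 * k * s + b < 2 * k * d := by
    have := Nat.mul_le_mul_left (2 * k) (show (s : ℕ) + 1 ≤ d from s.2)
    have hb := b.2
    rw [mul_add] at this
    omega
  rw [getBit_label e M E ω u hc hlt, labelBit_fst]

include hc in
theorem readField_label_snd (s : Fin d) :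
    readField e (label e M E ω u c) (2 * k * s + k) = snd M ω (u, s) := by
  rw [readField, Equiv.symm_apply_eq]
  funext b
  have hlt : 2 * k * s + k + b < 2 * k * d := by
    have := Nat.mul_le_mul_left (2 * k) (show (s : ℕ) + 1 ≤ d from s.2)
    have hb := b.2
    rw [mul_add] at this
    omega
  rw [getBit_label e M E ω u hc hlt, labelBit_snd]

variable [DecidableEq F] (hk : k ≠ 0) (hE : ∀ u i, 24 * d ≤ i → E u i = false)

-- The slot indices depend on the extra bits only. So even for a nonadjacent pair the tested sites
-- are fixed and independent of `ω`, and an index that is out of range leads to rejection.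
include hc hk hE in
theorem decode_label (v : Fin n) :
    decode e d (label e M E ω u c) (label e M E ω v c) = true ↔
      ∃ (s s' : Fin d), slotIndex d (E u) (E v) = s ∧ slotIndex d (E v) (E u) = s' ∧
        snd M ω (u, s) + snd M ω (v, s') = (ω (u, s)).1 * (ω (v, s')).1 := by
  simp only [decode, decide_eq_true_eq, extraBits_label e M E ω _ hc hk (hE _)]
  constructor
  · rintro ⟨h1, h2, h3⟩
    refine ⟨⟨_, h1⟩, ⟨_, h2⟩, rfl, rfl, ?_⟩
    rw [← readField_label_fst e M E ω u hc ⟨_, h1⟩, ← readField_label_fst e M E ω v hc ⟨_, h2⟩,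
      ← readField_label_snd e M E ω u hc ⟨_, h1⟩, ← readField_label_snd e M E ω v hc ⟨_, h2⟩]
    exact h3
  · rintro ⟨s, s', h1, h2, h3⟩
    rw [h1, h2, readField_label_fst e M E ω u hc, readField_label_fst e M E ω v hc,
      readField_label_snd e M E ω u hc, readField_label_snd e M E ω v hc]
    exact ⟨s.2, s'.2, h3⟩

end label

/-! ## The error of the decoder -/

section error

variable [DecidableEq F] {n d c : ℕ} {G : SimpleGraph (Fin n)} {slot : Fin n → Fin n → ℕ}
  {E : Fin n → ℕ → Bool} (hc : c = (2 * k + 24) * d) (hk : k ≠ 0)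
  (hslot : ∀ u w, G.Adj u w → slot u w < d)
  (hE : ∀ u i, 24 * d ≤ i → E u i = false)
  (hidx : ∀ u w, G.Adj u w → slotIndex d (E u) (E w) = slot u w)
  (hinj : ∀ u v w, G.Adj u v → G.Adj u w → slot u v = slot u w → v = w)

include hc hk hE hidx hinj in
theorem decode_label_of_adj (ω : Fin n × Fin d → F × F) {u v : Fin n} (h : G.Adj u v) :
    decode e d (label e (partner hslot) E ω u c) (label e (partner hslot) E ω v c) = true := by
  rw [decode_label e _ E ω u hc hk hE]
  refine ⟨⟨_, hslot u v h⟩, ⟨_, hslot v u h.symm⟩, hidx u v h, hidx v u h.symm, ?_⟩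
  refine snd_add_snd (isMatching_partner hslot hinj) ω ?_
  rw [partner_eq_some_iff hslot hinj]
  exact ⟨h, rfl, rfl⟩

include hc hk hE hidx hinj in
/-- Given the labels of all other vertices, a pair of distinct vertices is rarely decoded
wrongly. -/
theorem card_mul_ncard_wrong_le [Fintype F] {u v : Fin n} (huv : u ≠ v)
    (A : Finset (Fin n × Fin d → F × F))
    (hA : ∀ ω ω', (∀ z, z ≠ u → z ≠ v →
      label e (partner hslot) E ω z c = label e (partner hslot) E ω' z c) → (ω ∈ A ↔ ω' ∈ A)) :
    Fintype.card F * Set.ncard {ω ∈ (A : Set (Fin n × Fin d → F × F)) |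
      ¬ (decode e d (label e (partner hslot) E ω u c) (label e (partner hslot) E ω v c) = true ↔
        G.Adj u v)} ≤ 2 * #A := by
  by_cases hadj : G.Adj u v
  · simp [decode_label_of_adj e hc hk hslot hE hidx hinj, hadj]
  by_cases hs : slotIndex d (E u) (E v) < d ∧ slotIndex d (E v) (E u) < d
  · have hM := isMatching_partner hslot hinj
    -- For a non-edge, a wrong answer means that the equation holds at two sites that are not
    -- matched.
    refine le_trans (Nat.mul_le_mul_left _ ?_) (card_mul_card_equation_le hM
      (x := (u, ⟨_, hs.1⟩)) (y := (v, ⟨_, hs.2⟩)) huv ?_ A ?_)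
    · rw [← Set.ncard_coe_finset]
      refine Set.ncard_le_ncard ?_ (Finset.finite_toSet _)
      rintro ω ⟨hω, hw⟩
      simp only [hadj, iff_false, not_not, decode_label e _ E ω u hc hk hE] at hw
      obtain ⟨s, s', h1, h2, h3⟩ := hw
      rw [Finset.mem_coe, Finset.mem_filter]
      refine ⟨hω, ?_⟩
      have e1 : (⟨_, hs.1⟩ : Fin d) = s := Fin.ext h1
      have e2 : (⟨_, hs.2⟩ : Fin d) = s' := Fin.ext h2
      rw [e1, e2]
      exact h3
    · rw [Ne, partner_eq_some_iff hslot hinj]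
      exact fun h => hadj h.1
    · intro x hx t ω
      have hx1 : x.1 = u ∨ x.1 = v := by
        rcases hx with rfl | rfl
        · exact .inl rfl
        · exact .inr rfl
      -- A shear at a site of `u` or `v` does not change the label of any other vertex `z`, so it
      -- preserves `A`.
      refine hA _ _ fun z hzu hzv => ?_
      have hz : ∀ s, (z, s) ≠ x := by
        rintro s rfl
        rcases hx1 with h | h
        · exact hzu h
        · exact hzv h
      unfold label
      rw [labelBit_congr e (partner hslot) E (fun s => shear_apply_of_ne hM x t ω (hz s))
        (fun s => snd_shear_of_ne hM x t ω (hz s))]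
  · rw [show {ω ∈ (A : Set (Fin n × Fin d → F × F)) | _} = ∅ from ?_]
    · simp
    · rw [Set.eq_empty_iff_forall_notMem]
      rintro ω ⟨-, hw⟩
      simp only [hadj, iff_false, not_not, decode_label e _ E ω u hc hk hE] at hw
      obtain ⟨s, s', h1, h2, -⟩ := hw
      exact hs ⟨h1 ▸ s.2, h2 ▸ s'.2⟩

include hc hk hE hidx hinj in
/-- Every pair of vertices is rarely decoded wrongly. -/
theorem card_mul_ncard_wrong_le_card [Fintype F] [CharP F 2] (u v : Fin n) :
    Fintype.card F * Set.ncard {ω : Fin n × Fin d → F × F |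
      ¬ (decode e d (label e (partner hslot) E ω u c) (label e (partner hslot) E ω v c) = true ↔
        G.Adj u v)} ≤ 2 * Fintype.card (Fin n × Fin d → F × F) := by
  by_cases huv : u = v
  · subst huv
    by_cases hs : slotIndex d (E u) (E u) < d
    · refine (Nat.mul_le_mul_left _ ?_).trans ((card_mul_card_equation_self_le
        (isMatching_partner hslot hinj) (u, ⟨_, hs⟩)).trans (Nat.le_mul_of_pos_left _ two_pos))
      rw [← Set.ncard_coe_finset]
      refine Set.ncard_le_ncard ?_ (Finset.finite_toSet _)
      rintro ω hw
      simp only [Set.mem_ofPred_eq, SimpleGraph.irrefl, iff_false, not_not,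
        decode_label e _ E ω u hc hk hE] at hw
      obtain ⟨s, s', h1, h2, h3⟩ := hw
      rw [Finset.mem_coe, Finset.mem_filter]
      refine ⟨Finset.mem_univ _, ?_⟩
      have e1 : (⟨_, hs⟩ : Fin d) = s := Fin.ext h1
      have e2 : s' = s := Fin.ext (h2.symm.trans h1)
      rw [e1]
      rwa [e2] at h3
    · rw [show {ω : Fin n × Fin d → F × F | _} = ∅ from ?_]
      · simp
      · rw [Set.eq_empty_iff_forall_notMem]
        intro ω hw
        simp only [Set.mem_ofPred_eq, SimpleGraph.irrefl, iff_false, not_not,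
          decode_label e _ E ω u hc hk hE] at hw
        obtain ⟨s, s', h1, h2, -⟩ := hw
        exact hs (h1 ▸ s.2)
  · simpa using card_mul_ncard_wrong_le e hc hk hslot hE hidx hinj huv Finset.univ (by simp)

include hc hk hE hidx hinj in
/-- Every adaptive adversary wins rarely. -/
theorem card_mul_ncard_wins_le [Fintype F] (a : Strategy (Fin n) (Fin c → Bool)) :
    Fintype.card F * Set.ncard {ω : Fin n × Fin d → F × F |
      a.Wins G (decode e d) (fun u => label e (partner hslot) E ω u c) ∅} ≤
        2 * Fintype.card (Fin n × Fin d → F × F) := by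
  have := Strategy.card_wins_le G (decode e d)
    (fun (ω : Fin n × Fin d → F × F) u => label e (partner hslot) E ω u c) (Fintype.card F) 2
    (fun x y hxy A hA => card_mul_ncard_wrong_le e hc hk hslot hE hidx hinj hxy A hA) a ∅
    Finset.univ (by simp)
  simpa using this

end error

end EdgeCode

/-! ## The encoder -/

namespace EdgeCode

variable {k : ℕ} {F : Type} [Field F] (e : F ≃ (Fin k → Bool))

/-- The values at the sites that are written in a sequence of random bits. -/
def parse {n d m : ℕ} (r : Fin m → Bool) (x : Fin n × Fin d) : F × F :=
  (e.symm fun b => Ram.randBit r (2 * k * d) x.1 (2 * k * x.2 + b),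
    e.symm fun b => Ram.randBit r (2 * k * d) x.1 (2 * k * x.2 + k + b))

theorem eq_and_eq_of_mul_add_eq {l a b a' b' : ℕ} (h : a * l + b = a' * l + b') (hb : b < l)
    (hb' : b' < l) : a = a' ∧ b = b' := by
  have hl : 0 < l := by omega
  have h1 := congrArg (· / l) h
  have h2 := congrArg (· % l) h
  simp only [mul_comm _ l, Nat.mul_add_div hl, Nat.div_eq_of_lt hb, Nat.div_eq_of_lt hb',
    Nat.mul_add_mod, Nat.mod_eq_of_lt hb, Nat.mod_eq_of_lt hb', add_zero] at h1 h2
  exact ⟨h1, h2⟩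

/-- Uniformly random bits give uniformly random values at the sites. -/
theorem map_parse [Fintype F] {n d m : ℕ} (hm : n * (2 * k * d) ≤ m) :
    (PMF.uniformOfFintype (Fin m → Bool)).map (parse e) =
      PMF.uniformOfFintype (Fin n × Fin d → F × F) := by
  set off : Fin k ⊕ Fin k → ℕ := Sum.elim (fun b => b) (fun b => k + b) with hoff
  have hoff_lt : ∀ b, off b < 2 * k := by
    rintro (b | b) <;> simp only [hoff, Sum.elim_inl, Sum.elim_inr] <;> omega
  have hoff_inj : Function.Injective off := by
    rintro (b | b) (b' | b') h <;> simp only [hoff, Sum.elim_inl, Sum.elim_inr] at h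
    · exact congrArg _ (Fin.ext h)
    · omega
    · omega
    · exact congrArg _ (Fin.ext (by omega))
  have hcol : ∀ (s : Fin d) b, s * (2 * k) + off b < 2 * k * d := by
    intro s b
    have h1 := Nat.mul_le_mul_right (2 * k) (show (s : ℕ) + 1 ≤ d from s.2)
    have h2 := hoff_lt b
    rw [add_mul, mul_comm d] at h1
    omega
  have hlt : ∀ (u : Fin n) (s : Fin d) b, u * (2 * k * d) + (s * (2 * k) + off b) < m := by
    intro u s b
    have h1 := Nat.mul_le_mul_right (2 * k * d) (show (u : ℕ) + 1 ≤ n from u.2)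
    have h2 := hcol s b
    rw [add_mul] at h1
    omega
  -- The position in the random sequence of each bit of each site. It is injective by uniqueness of
  -- mixed-radix expansions, so the bits read are independent and fair.
  let ι : (Fin n × Fin d) × (Fin k ⊕ Fin k) → Fin m := fun z => ⟨_, hlt z.1.1 z.1.2 z.2⟩
  have hι : Function.Injective ι := by
    rintro ⟨⟨u, s⟩, b⟩ ⟨⟨u', s'⟩, b'⟩ h
    have h1 := eq_and_eq_of_mul_add_eq (congrArg Fin.val h) (hcol s b) (hcol s' b')
    have h2 := eq_and_eq_of_mul_add_eq h1.2 (hoff_lt b) (hoff_lt b')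
    exact Prod.ext (Prod.ext (Fin.ext h1.1) (Fin.ext h2.1)) (hoff_inj h2.2)
  let Φ : ((Fin n × Fin d) × (Fin k ⊕ Fin k) → Bool) ≃ (Fin n × Fin d → F × F) :=
    (Equiv.curry _ _ _).trans (Equiv.piCongrRight fun _ =>
      (Equiv.sumArrowEquivProdArrow _ _ _).trans (Equiv.prodCongr e.symm e.symm))
  have hparse : (parse e : (Fin m → Bool) → Fin n × Fin d → F × F) =
      Φ ∘ fun r => r ∘ ι := by
    funext r x
    refine Prod.ext ?_ ?_
    · refine congrArg e.symm (funext fun b => ?_)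
      have h : (x.1 : ℕ) * (2 * k * d) + (2 * k * x.2 + b) < m := by
        simpa [hoff, mul_comm] using hlt x.1 x.2 (.inl b)
      rw [Ram.randBit, dif_pos h]
      exact congrArg r (Fin.ext (by simp [hoff, ι, mul_comm]))
    · refine congrArg e.symm (funext fun b => ?_)
      have h : (x.1 : ℕ) * (2 * k * d) + (2 * k * x.2 + k + b) < m := by
        simpa [hoff, mul_comm, add_assoc] using hlt x.1 x.2 (.inr b)
      rw [Ram.randBit, dif_pos h]
      exact congrArg r (Fin.ext (by simp [hoff, ι, mul_comm, add_assoc]))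
  rw [hparse, ← PMF.map_comp, PMF.map_uniformOfFintype_comp ι hι, PMF.map_uniformOfFintype_equiv]

/-- The second component at the larger end of an edge, in terms of bits. -/
def solveBits (a b c : Fin k → Bool) : Fin k → Bool :=
  e (e.symm a * e.symm b - e.symm c)

/-- The memory left by the encoding program contains the labels. -/
theorem label_parse_eq_outputLabels {n d m c : ℕ} {G : SimpleGraph (Fin n)}
    {slot : Fin n → Fin n → ℕ} {E : Fin n → ℕ → Bool} {r : Fin m → Bool} {σ : Ram.Store}
    (hc : c = (2 * k + 24) * d) (hk : k ≠ 0)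
    (hslot : ∀ u w, G.Adj u w → slot u w < d)
    (hinj : ∀ u v w, G.Adj u v → G.Adj u w → slot u v = slot u w → v = w)
    (h : Ram.LabelStore (solveBits e) d G slot E r σ) (u : Fin n) :
    label e (partner hslot) E (parse e r) u c = Ram.outputLabels n c σ u := by
  funext i
  unfold label Ram.outputLabels
  obtain ⟨i, hi⟩ := i
  simp only
  rcases lt_or_ge i (2 * k * d) with hlt | hge
  · obtain ⟨s, b, rfl, hb⟩ : ∃ s b, i = 2 * k * s + b ∧ b < 2 * k :=
      ⟨i / (2 * k), i % (2 * k), (Nat.div_add_mod _ _).symm, Nat.mod_lt _ (by omega)⟩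
    have hs : s < d := by
      by_contra hs
      have := Nat.mul_le_mul_left (2 * k) (not_lt.1 hs)
      omega
    rcases lt_or_ge b k with hbk | hbk
    · have h1 := labelBit_fst e (partner hslot) E (parse e r) u ⟨s, hs⟩ ⟨b, hbk⟩
      simp only at h1
      rw [h1, h.fst u s hs b hbk]
      simp [parse]
    · obtain ⟨b, rfl⟩ := Nat.exists_eq_add_of_le hbk
      have hb' : b < k := by omega
      have h1 := labelBit_snd e (partner hslot) E (parse e r) u ⟨s, hs⟩ ⟨b, hb'⟩
      simp only at h1
      simp only [← add_assoc]
      rw [h1]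
      have hrand : (∀ w < u, G.Adj u w → slot u w ≠ s) →
          e (parse e r (u, (⟨s, hs⟩ : Fin d))).2 ⟨b, hb'⟩ =
            decide (σ 3 u (2 * k * s + k + b) ≠ 0) := by
        intro hw
        rw [h.snd u s hs hw b hb']
        simp [parse]
      unfold snd
      cases hy : partner hslot (u, (⟨s, hs⟩ : Fin d)) with
      | none =>
        refine hrand fun w _ hadj hsl => ?_
        have := (partner_eq_some_iff hslot hinj (u, ⟨s, hs⟩)
          (w, ⟨slot w u, hslot w u hadj.symm⟩)).2 ⟨hadj, hsl, rfl⟩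
        rw [hy] at this
        exact Option.some_ne_none _ this.symm
      | some y =>
        obtain ⟨h2, h3, h4⟩ := (partner_eq_some_iff hslot hinj _ _).1 hy
        simp only at h2 h3 h4
        simp only
        split_ifs with hyu
        · have h5 := h.snd_of_lt u y.1 hyu h2 ⟨b, hb'⟩
          simp only [h3, h4] at h5
          rw [h5]
          rfl
        · refine hrand fun w hwu hadj hsl => hyu ?_
          rwa [hinj u y.1 w h2 hadj (h3.trans hsl.symm)]
  · obtain ⟨i, rfl⟩ := Nat.exists_eq_add_of_le hge
    rw [labelBit_extra e _ E _ u hk, h.extra u i]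
    rw [hc, add_mul] at hi
    omega

include e in
open Polynomial in
/-- The adjacency sketch over a field of characteristic two with `2 ^ k` elements. -/
theorem exists_sketch [Fintype F] [DecidableEq F] [CharP F 2] (hk : k ≠ 0) {ε : ℝ}
    (hε : 2 ≤ ε * Fintype.card F) :
    ∃ S : (d : ℕ) → AdjacencySketch ((2 * k + 24) * d),
      (∀ d : ℕ,
        (S d).HasError (maxDegreeFamily d) ε ∧
        (S d).OneSided (maxDegreeFamily d) ∧
        (S d).Resilient (maxDegreeFamily d) ε) ∧
      PolyTimeEncodable maxDegreeFamily (fun d => (2 * k + 24) * d) S := by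
  classical
  obtain ⟨p, hp⟩ := Ram.exists_encoding (solveBits e)
  choose slot E hslot hE hidx hinj hrun using hp
  let S : (d : ℕ) → AdjacencySketch ((2 * k + 24) * d) := fun d =>
    { encoder := fun n G =>
        if hG : G ∈ maxDegreeFamily d n then
          (PMF.uniformOfFintype (Fin n × Fin d → F × F)).map fun ω u =>
            label e (partner (hslot d n G hG)) (E d n G hG) ω u _
        -- An arbitrary value: nothing is required of graphs outside the family.
        else PMF.pure fun _ _ => false
      decoder := decode e d }
  have hS : ∀ d n G (hG : G ∈ maxDegreeFamily d n), (S d).encoder n G =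
      (PMF.uniformOfFintype (Fin n × Fin d → F × F)).map fun ω u =>
        label e (partner (hslot d n G hG)) (E d n G hG) ω u _ := fun d n G hG => dif_pos hG
  have hF : 0 < Fintype.card F := Fintype.card_pos
  refine ⟨S, fun d => ⟨?_, ?_, ?_⟩, ?_⟩
  · intro n G hG u v
    rw [hS d n G hG, PMF.toOuterMeasure_map_apply]
    exact PMF.le_toOuterMeasure_uniformOfFintype hε hF _
      (card_mul_ncard_wrong_le_card e rfl hk (hslot d n G hG) (hE d n G hG) (hidx d n G hG)
        (hinj d n G hG) u v)
  · intro n G hG l hl u v huv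
    rw [hS d n G hG, PMF.support_map] at hl
    obtain ⟨ω, -, rfl⟩ := hl
    exact decode_label_of_adj e rfl hk (hslot d n G hG) (hE d n G hG) (hidx d n G hG)
      (hinj d n G hG) ω huv
  · intro n G hG A
    refine PMF.toOuterMeasure_bind_map_le A _ _ _ fun a => ?_
    rw [hS d n G hG, PMF.toOuterMeasure_map_apply]
    exact PMF.toOuterMeasure_uniformOfFintype_le hε hF _
      (card_mul_ncard_wins_le e rfl hk (hslot d n G hG) (hE d n G hG) (hidx d n G hG)
        (hinj d n G hG) a)
  · refine ⟨Ram.encodeProg (solveBits e), p, C (2 * k) * X ^ 2, fun d n G hG => ?_⟩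
    have hm : n * (2 * k * d) ≤ (C (2 * k) * X ^ 2 : ℕ[X]).eval (n + d) := by
      simp only [eval_mul, eval_C, eval_pow, eval_X]
      nlinarith [Nat.zero_le (2 * k * (n * n + n * d + d * d))]
    refine ⟨fun r u => label e (partner (hslot d n G hG)) (E d n G hG) (parse e r) u _, ?_,
      fun r => ?_⟩
    · rw [hS d n G hG, ← map_parse e hm, PMF.map_comp]
      rfl
    · obtain ⟨σ, t, h1, h2, h3⟩ := hrun d n G hG _ r hm
      exact ⟨σ, t, h1, h2, funext fun u => label_parse_eq_outputLabels e rfl hk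
        (hslot d n G hG) (hinj d n G hG) h3 u⟩

end EdgeCode

/-! ### Choice of the field and length of the labels -/

/-- A field of characteristic two with a given number of bits per element. -/
theorem exists_sketch_of_two_pow {k : ℕ} (hk : k ≠ 0) {ε : ℝ} (hε : 2 ≤ ε * 2 ^ k) :
    ∃ S : (d : ℕ) → AdjacencySketch ((2 * k + 24) * d),
      (∀ d : ℕ,
        (S d).HasError (maxDegreeFamily d) ε ∧
        (S d).OneSided (maxDegreeFamily d) ∧
        (S d).Resilient (maxDegreeFamily d) ε) ∧
      PolyTimeEncodable maxDegreeFamily (fun d => (2 * k + 24) * d) S := by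
  classical
  have : Fintype (GaloisField 2 k) := Fintype.ofFinite _
  have hcard : Fintype.card (GaloisField 2 k) = 2 ^ k := by
    rw [← Nat.card_eq_fintype_card, GaloisField.card 2 k hk]
  have e : GaloisField 2 k ≃ (Fin k → Bool) :=
    Fintype.equivOfCardEq (by rw [hcard]; simp)
  refine EdgeCode.exists_sketch e hk ?_
  rw [hcard]
  exact_mod_cast hε

theorem mainTheorem1 :
    ∃ η : ℝ → ℝ, Tendsto η (𝓝[>] 0) (𝓝 0) ∧
      ∀ ε : ℝ, 0 < ε → ε < 1 →
        ∃ (c : ℕ → ℕ) (S : (d : ℕ) → AdjacencySketch (c d)),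
          (∀ d : ℕ,
            (c d : ℝ) ≤ 2 * d * Real.logb 2 (1 / ε) * (1 + η ε) ∧
            (S d).HasError (maxDegreeFamily d) ε ∧
            (S d).OneSided (maxDegreeFamily d) ∧
            (S d).Resilient (maxDegreeFamily d) ε) ∧
          PolyTimeEncodable maxDegreeFamily c S := by
  have htop : Tendsto (fun ε : ℝ => Real.logb 2 (1 / ε)) (𝓝[>] 0) atTop := by
    simp only [one_div]
    exact (Real.tendsto_logb_atTop one_lt_two).comp tendsto_inv_nhdsGT_zero
  -- With `k = ⌈log (1 / ε)⌉ + 1` a label has `(2 * k + 24) * d = 2 * d * (⌈log (1 / ε)⌉ + 13)`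
  -- bits, and `η` is chosen to make the bound an equality.
  refine ⟨fun ε => (⌈Real.logb 2 (1 / ε)⌉₊ : ℝ) / Real.logb 2 (1 / ε) +
    13 / Real.logb 2 (1 / ε) - 1, ?_, ?_⟩
  · have h1 := (tendsto_nat_ceil_div_atTop (R := ℝ)).comp htop
    have h2 := (tendsto_const_nhds (x := (13 : ℝ))).div_atTop htop
    simpa using (h1.add h2).sub_const 1
  · intro ε hε hε1
    have hΛ : 0 < Real.logb 2 (1 / ε) :=
      Real.logb_pos one_lt_two (by rw [one_div]; exact (one_lt_inv₀ hε).2 hε1)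
    -- The additional bit pays for the factor `2` in the number of points of a hyperbola.
    have hk : 2 ≤ ε * 2 ^ (⌈Real.logb 2 (1 / ε)⌉₊ + 1) := by
      have h1 : 1 / ε ≤ 2 ^ ⌈Real.logb 2 (1 / ε)⌉₊ := by
        rw [← Real.rpow_natCast, ← Real.logb_le_iff_le_rpow one_lt_two (by positivity)]
        exact Nat.le_ceil _
      rw [div_le_iff₀ hε] at h1
      rw [pow_succ]
      linarith
    obtain ⟨S, h1, h2⟩ := exists_sketch_of_two_pow (Nat.succ_ne_zero _) hk
    refine ⟨_, S, fun d => ⟨le_of_eq ?_, h1 d⟩, h2⟩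
    push_cast
    field_simp
    ring
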